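/- Setting. Let $\Bbbk$ be a field, $\mathcal R=\Bbbk[x_1,x_2,x_3,x_4]$ with the graded reverse lexicographic (grevlex) order, $x_1\succ x_2\succ x_3\succ x_4$, let $n\ge 3$, and let $M$ be an $n\times n$ matrix whose entries are linear forms (homogeneous of degree $1$) of $\mathcal R$. Let $F=(f_1,\dots,f_{n^2})$ be the $(n-1)$-minors of $M$, listed in any order, let $I$ be the ideal they generate, and let $h_D=\dim_\Bbbk I_D$ be its Hilbert function. Assume that * $I$ is reverse lexicographic: $I\neq0$, and for every leading monomial $\tau\in\operatorname{LM}(I)$ all monomials $\sigma\succ\tau$ with $\deg\sigma=\deg\tau$ lie in $\operatorname{LM}(I)$; * $I$ has the generic Hilbert function: $h_D=n^2\binom{D+4-n}{3}-(2n^2-2)\binom{D+3-n}{3}+n^2\binom{D+2-n}{3}$ for $n-1\le D\le 2n-3$. The matrices. For $d\ge n-1$ let $\widetilde{\mathcal M}_d$ be the reduced row echelon form of the Macaulay matrix of $F$ in degree $d$ (columns: monomials of degree $d$ in decreasing order; rows: the products $\tau f_i$ with $\tau$ a monomial of degree $d-n+1$). Order the monomials $\tau e_i$ of $\mathcal R^{n^2}$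 by term over position: $\tau e_i\succ\sigma e_j$ iff $\tau\succ\sigma$, or $\tau=\sigma$ and $i>j$. The signature of a nonzero row $g$ of $\widetilde{\mathcal M}_d$ is the smallest $\operatorname{LM}(u)$ over the homogeneous $u\in\mathcal R^{n^2}$ such that $\sum_i u_if_i$ has the same leading monomial as $g$. The matrix $\mathcal M_{d+1}$ built by the algorithm DetGB has, for every nonzero row $g$ of $\widetilde{\mathcal M}_d$, with signature $\tau e_i$, and every variable $x_k$ such that no $x_l$ with $l>k$ divides $\tau$ and such that $x_k\tau e_i$ is not the leading monomial of a syzygy of $F$, the row of coefficients of $x_kg$. Block sizes. Put $$\alpha_{d+1}=\frac{(d-2n+3)(d-2n+2)}2,\qquad \beta_{d+1}=h_{d+1}-\alpha_{d+1},\qquad \gamma_{d+1}=\binom{d+4}3-\beta_{d+1}.$$ Cost. Computations are algebraic computation trees over $\Bbbk$: one arithmetic operation $+,-,\times,/$ of $\Bbbk$ or one zero test costs $1$; constants of $\Bbbk$ are free. Let $2\le\omega\le3$ be a complexity exponent for matrix multiplication over $\Bbbk$, i.e. for some constant $c$ and every $m$, two $m\times m$ matrices over $\Bbbk$ can be multiplied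 with at most $c\,m^\omega$ operations. Statement. For $n-1\le d\le 2n-3$, the reduced row echelon form of $\mathcal M_{d+1}$ can be computed from $\mathcal M_{d+1}$ with $$O\!\left(\beta_{d+1}^2\,\alpha_{d+1}^{\omega-2}+\alpha_{d+1}^{\omega-2}\,\beta_{d+1}\gamma_{d+1}\right)$$ operations in $\Bbbk$. Precisely, there is a constant $C$ depending only on $\omega$ and $c$ such that for every $\Bbbk$ as above, every $n\ge3$ and every $d$ in this range there is a computation tree (for the given number of rows of $\mathcal M_{d+1}$) which, for every $M$ as above and every order of the rows of $\mathcal M_{d+1}$, returns the reduced row echelon form of $\mathcal M_{d+1}$ with at most $C\left(\beta_{d+1}^2\alpha_{d+1}^{\omega-2}+\alpha_{d+1}^{\omega-2}\beta_{d+1}\gamma_{d+1}\right)$ operations. -/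

import Mathlib

open MvPolynomial

noncomputable section

namespace DetGB

/-! ### Arithmetic complexity: computation trees over a field -/

/-- The four arithmetic operations of a field. -/
inductive ArithOp
  | add
  | sub
  | mul
  | div

/-- What an instruction may read: an input entry, a memory cell, or a constant of the field. -/
inductive Operand (𝕜 ι : Type*)
  | input (i : ι)
  | cell (j : ℕ)
  | const (c : 𝕜)

/-- Algebraic computation trees with inputs indexed by `ι` and outputs indexed by `κ`.
A node either performs one arithmetic operation and stores the result in a memory cell, or
branches on whether a value is zero; a leaf returns the outputs. -/
inductive CompTree (𝕜 ι κ : Type*)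
  | output (f : κ → Operand 𝕜 ι)
  | compute (o : ArithOp) (a b : Operand 𝕜 ι) (dst : ℕ) (next : CompTree 𝕜 ι κ)
  | branch (a : Operand 𝕜 ι) (ifZero ifNonzero : CompTree 𝕜 ι κ)

/-- The value of an operand, given the input `x` and the memory `mem`. -/
def Operand.eval {𝕜 ι : Type*} (x : ι → 𝕜) (mem : ℕ → 𝕜) : Operand 𝕜 ι → 𝕜
  | .input i => x i
  | .cell j => mem j
  | .const c => c

open Classical in
/-- The result of an arithmetic operation; division by zero is undefined. -/
def ArithOp.apply {𝕜 : Type*} [Field 𝕜] : ArithOp → 𝕜 → 𝕜 → Option 𝕜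
  | .add, a, b => some (a + b)
  | .sub, a, b => some (a - b)
  | .mul, a, b => some (a * b)
  | .div, a, b => if b = 0 then none else some (a / b)

open Classical in
/-- Run a tree on the input `x` from the memory `mem`. The result is the family of outputs and
the number of steps on the path taken, where every arithmetic operation and every zero test
costs one step; it is `none` if a division by zero occurs. -/
def CompTree.run {𝕜 ι κ : Type*} [Field 𝕜] (x : ι → 𝕜) :
    CompTree 𝕜 ι κ → (ℕ → 𝕜) → Option ((κ → 𝕜) × ℕ)
  | .output f, mem => some (fun k => (f k).eval x mem, 0)
  | .compute o a b dst next, mem =>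
      (o.apply (a.eval x mem) (b.eval x mem)).bind fun v =>
        (next.run x (Function.update mem dst v)).map fun p => (p.1, p.2 + 1)
  | .branch a ifZero ifNonzero, mem =>
      (if a.eval x mem = 0 then ifZero.run x mem else ifNonzero.run x mem).map
        fun p => (p.1, p.2 + 1)

/-- On input `x`, the tree `t` returns `y` after `cost` steps (the memory is initially zero). -/
def CompTree.Computes {𝕜 ι κ : Type*} [Field 𝕜] (t : CompTree 𝕜 ι κ) (x : ι → 𝕜) (y : κ → 𝕜)
    (cost : ℕ) : Prop :=
  t.run x (fun _ => 0) = some (y, cost)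

/-- For every `m`, two `m × m` matrices over `𝕜` can be multiplied in at most `c * m ^ ω`
steps: `ω` is a complexity exponent for matrix multiplication over `𝕜`, with constant `c`. -/
def IsMatMulExponent (𝕜 : Type*) [Field 𝕜] (ω c : ℝ) : Prop :=
  ∀ m : ℕ, ∃ t : CompTree 𝕜 ((Fin m × Fin m) ⊕ (Fin m × Fin m)) (Fin m × Fin m),
    ∀ A B : Matrix (Fin m) (Fin m) 𝕜, ∃ cost : ℕ,
      t.Computes (Sum.elim (fun p => A p.1 p.2) (fun p => B p.1 p.2))
        (fun p => (A * B) p.1 p.2) cost ∧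
      (cost : ℝ) ≤ c * (m : ℝ) ^ ω

/-! ### Monomials and the graded reverse lexicographic order

The four variables are `X 0`, `X 1`, `X 2`, `X 3`, in decreasing order. -/

/-- `a ≺ b` in the graded reverse lexicographic order. -/
def GrevlexLT (a b : Fin 4 →₀ ℕ) : Prop :=
  a.degree < b.degree ∨
    (a.degree = b.degree ∧ ∃ i, b i < a i ∧ ∀ j, i < j → a j = b j)

/-- `m` is the leading monomial of the polynomial `f` (which is then nonzero). -/
def IsLM {𝕜 : Type*} [Field 𝕜] (f : MvPolynomial (Fin 4) 𝕜) (m : Fin 4 →₀ ℕ) : Prop :=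
  m ∈ f.support ∧ ∀ m' ∈ f.support, m' ≠ m → GrevlexLT m' m

/-- The leading monomials of the nonzero elements of an ideal. -/
def leadingMonomials {𝕜 : Type*} [Field 𝕜] (I : Ideal (MvPolynomial (Fin 4) 𝕜)) :
    Set (Fin 4 →₀ ℕ) :=
  {m | ∃ f ∈ I, IsLM f m}

/-- A nonzero ideal is reverse lexicographic if, with each leading monomial `τ`, every larger
monomial of the same degree is a leading monomial. -/
def IsReverseLex {𝕜 : Type*} [Field 𝕜] (I : Ideal (MvPolynomial (Fin 4) 𝕜)) : Prop :=
  I ≠ ⊥ ∧ ∀ τ ∈ leadingMonomials I, ∀ σ : Fin 4 →₀ ℕ,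
    σ.degree = τ.degree → GrevlexLT τ σ → σ ∈ leadingMonomials I

/-- The Hilbert function of an ideal: the dimension of its homogeneous part of degree `d`. -/
def hilbertFun {𝕜 : Type*} [Field 𝕜] (I : Ideal (MvPolynomial (Fin 4) 𝕜)) (d : ℕ) : ℕ :=
  Module.finrank 𝕜
    ↥(Submodule.restrictScalars 𝕜 I ⊓ homogeneousSubmodule (Fin 4) 𝕜 d)

/-- The monomials of degree `d`. -/
def MonDeg (d : ℕ) : Type :=
  {m : Fin 4 →₀ ℕ // m ∈ Finset.finsuppAntidiag (Finset.univ : Finset (Fin 4)) d}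

instance (d : ℕ) : Fintype (MonDeg d) :=
  inferInstanceAs (Fintype
    {m : Fin 4 →₀ ℕ // m ∈ Finset.finsuppAntidiag (Finset.univ : Finset (Fin 4)) d})

/-- The order of the columns of a Macaulay matrix: the columns are indexed by monomials in
decreasing grevlex order, so a column comes first if its monomial is larger. -/
instance (d : ℕ) : LT (MonDeg d) :=
  ⟨fun a b => GrevlexLT b.1 a.1⟩

/-! ### Macaulay matrices and reduced row echelon forms -/

/-- The polynomial represented by a row of a Macaulay matrix in degree `d`. -/
def rowPoly {𝕜 : Type*} [Field 𝕜] {d : ℕ} (v : MonDeg d → 𝕜) : MvPolynomial (Fin 4) 𝕜 :=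
  ∑ m : MonDeg d, monomial m.1 (v m)

/-- The Macaulay matrix in degree `d` of a family of forms of degree `δ ≤ d`: one row for each
product `τ * F i` with `τ` a monomial of degree `d - δ`. -/
def macaulay {𝕜 : Type*} [Field 𝕜] {s : ℕ} (F : Fin s → MvPolynomial (Fin 4) 𝕜) (δ d : ℕ) :
    Matrix (MonDeg (d - δ) × Fin s) (MonDeg d) 𝕜 :=
  fun p σ => coeff σ.1 (monomial p.1.1 (1 : 𝕜) * F p.2)

/-- `E` is a reduced row echelon form of `A`: it is in reduced row echelon form and has the
same row space. (It is unique up to the number of zero rows at the bottom.) -/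
def IsRREFOf {𝕜 ρ : Type*} [Field 𝕜] {q d : ℕ} (A : Matrix ρ (MonDeg d) 𝕜)
    (E : Matrix (Fin q) (MonDeg d) 𝕜) : Prop :=
  E.IsReducedRowEchelon ∧
    Submodule.span 𝕜 (Set.range fun i => E i) = Submodule.span 𝕜 (Set.range fun i => A i)

/-! ### Module monomials, syzygies and signatures

The pair `(τ, i)` stands for the monomial `τ e_i` of the free module with basis `e_i`. -/

/-- The term-over-position order on module monomials induced by grevlex. -/
def TopLT {s : ℕ} (t u : (Fin 4 →₀ ℕ) × Fin s) : Prop :=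
  GrevlexLT t.1 u.1 ∨ (t.1 = u.1 ∧ t.2 < u.2)

/-- `t` is the leading monomial of the module element `u` (which is then nonzero). -/
def IsModLM {𝕜 : Type*} [Field 𝕜] {s : ℕ} (u : Fin s → MvPolynomial (Fin 4) 𝕜)
    (t : (Fin 4 →₀ ℕ) × Fin s) : Prop :=
  coeff t.1 (u t.2) ≠ 0 ∧
    ∀ t' : (Fin 4 →₀ ℕ) × Fin s, coeff t'.1 (u t'.2) ≠ 0 → t' ≠ t → TopLT t' t

/-- The leading monomials of the syzygies of `F`. -/
def syzLM {𝕜 : Type*} [Field 𝕜] {s : ℕ} (F : Fin s → MvPolynomial (Fin 4) 𝕜) :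
    Set ((Fin 4 →₀ ℕ) × Fin s) :=
  {t | ∃ u : Fin s → MvPolynomial (Fin 4) 𝕜, ∑ i, u i * F i = 0 ∧ IsModLM u t}

/-- `t` is attained at the monomial `p`: some homogeneous module element with leading monomial
`t` is sent by `e_i ↦ F i` to a polynomial with leading monomial `p`. -/
def Attains {𝕜 : Type*} [Field 𝕜] {s : ℕ} (F : Fin s → MvPolynomial (Fin 4) 𝕜)
    (p : Fin 4 →₀ ℕ) (t : (Fin 4 →₀ ℕ) × Fin s) : Prop :=
  ∃ (e : ℕ) (u : Fin s → MvPolynomial (Fin 4) 𝕜),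
    (∀ i, (u i).IsHomogeneous e) ∧ IsModLM u t ∧ IsLM (∑ i, u i * F i) p

/-- `t` is the signature of the echelonized row `g`: the smallest signature at which the leading
monomial of `g` occurs. This is the label that the row with this leading monomial carries when
the rows are processed by increasing signature, each being reduced by rows of smaller
signature. -/
def IsSignature {𝕜 : Type*} [Field 𝕜] {s : ℕ} (F : Fin s → MvPolynomial (Fin 4) 𝕜)
    (g : MvPolynomial (Fin 4) 𝕜) (t : (Fin 4 →₀ ℕ) × Fin s) : Prop :=
  ∃ p, IsLM g p ∧ Attains F p t ∧ ∀ t', Attains F p t' → t' ≠ t → TopLT t t'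

/-! ### The matrix built by the algorithm -/

/-- The rows of the next Macaulay matrix. For a nonzero row `g` of the echelonized matrix `E` in
degree `d`, with signature `τ e_i`, the row `X k * g` is inserted for each `k` such that no
variable smaller than `X k` divides `τ`, unless `X k * τ e_i` is the leading monomial of a
syzygy. -/
def newRows {𝕜 : Type*} [Field 𝕜] {s q d : ℕ} (F : Fin s → MvPolynomial (Fin 4) 𝕜)
    (E : Matrix (Fin q) (MonDeg d) 𝕜) : Set (Fin q × Fin 4) :=
  {r | E r.1 ≠ 0 ∧ ∃ t, IsSignature F (rowPoly (E r.1)) t ∧ (∀ l ∈ t.1.support, l ≤ r.2) ∧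
    (t.1 + Finsupp.single r.2 1, t.2) ∉ syzLM F}

/-- `A` is the unreduced Macaulay matrix in degree `d + 1` that the algorithm builds for forms
`F` of degree `δ`, with its rows listed in some order. -/
def IsBuiltMatrix {𝕜 : Type*} [Field 𝕜] {s r : ℕ} (F : Fin s → MvPolynomial (Fin 4) 𝕜)
    (δ d : ℕ) (A : Matrix (Fin r) (MonDeg (d + 1)) 𝕜) : Prop :=
  ∃ (q : ℕ) (E : Matrix (Fin q) (MonDeg d) 𝕜), IsRREFOf (macaulay F δ d) E ∧
    ∃ e : Fin r ≃ newRows F E, ∀ (i : Fin r) (σ : MonDeg (d + 1)),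
      A i σ = coeff σ.1 (X (e i).1.2 * rowPoly (E (e i).1.1))

/-! ### Determinantal ideals -/

/-- The minor of size `n - 1` given by increasing selections of rows and columns. -/
def minor {𝕜 : Type*} [Field 𝕜] {n : ℕ} (M : Matrix (Fin n) (Fin n) (MvPolynomial (Fin 4) 𝕜))
    (p : (Fin (n - 1) ↪o Fin n) × (Fin (n - 1) ↪o Fin n)) : MvPolynomial (Fin 4) 𝕜 :=
  (M.submatrix p.1 p.2).det

/-- The ideal generated by the minors of size `n - 1`. -/
def detIdeal {𝕜 : Type*} [Field 𝕜] {n : ℕ}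
    (M : Matrix (Fin n) (Fin n) (MvPolynomial (Fin 4) 𝕜)) : Ideal (MvPolynomial (Fin 4) 𝕜) :=
  Ideal.span (Set.range (minor M))

/-- The Hilbert function of `I` in the degrees from `n - 1` to `2 n - 3` is the one of the ideal
of `(n - 1)`-minors of a generic `n × n` matrix of linear forms in four variables. -/
def HasGenericHilbertFun {𝕜 : Type*} [Field 𝕜] (n : ℕ) (I : Ideal (MvPolynomial (Fin 4) 𝕜)) :
    Prop :=
  ∀ D : ℕ, n - 1 ≤ D → D ≤ 2 * n - 3 →
    (hilbertFun I D : ℤ) =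
      (n : ℤ) ^ 2 * ((D + 4 - n).choose 3 : ℤ)
        - (2 * (n : ℤ) ^ 2 - 2) * ((D + 3 - n).choose 3 : ℤ)
        + (n : ℤ) ^ 2 * ((D + 2 - n).choose 3 : ℤ)

/-- The block size `α_{d+1}`. -/
def alphaSucc (n d : ℕ) : ℝ :=
  ((d : ℝ) - 2 * n + 3) * ((d : ℝ) - 2 * n + 2) / 2

/-- The block size `β_{d+1} = h_{d+1} - α_{d+1}`, with `h` the Hilbert function of `I`. -/
def betaSucc {𝕜 : Type*} [Field 𝕜] (n d : ℕ) (I : Ideal (MvPolynomial (Fin 4) 𝕜)) : ℝ :=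
  (hilbertFun I (d + 1) : ℝ) - alphaSucc n d

/-- The block size `γ_{d+1} = binom (d + 4) 3 - β_{d+1}`. -/
def gammaSucc {𝕜 : Type*} [Field 𝕜] (n d : ℕ) (I : Ideal (MvPolynomial (Fin 4) 𝕜)) : ℝ :=
  ((d + 4).choose 3 : ℝ) - betaSucc n d I

end DetGB

end

/-!
The columns of degree `D` are graded by the exponent of `x₄`. A reverse lexicographic ideal with
the generic Hilbert function has no choice about its leading monomials: in a degree `D` with
`n - 1 ≤ D ≤ 2 n - 3` they are the monomials whose exponent of `x₄` is less than
`2 (D + 2 - n)`. Put `a = 2 (d + 2 - n)`. For each of the `β_{d+1}` columns with exponent at most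
`a`, one of the products `x_k g` has the entry `1` there and zeros in all other columns with
exponent less than `a`, so the pivots in these columns are known and most of the reduction is back
substitution. Genuine elimination happens only in the `α_{d+1}` columns with exponent `a + 1`. Both
parts are cut into blocks whose products are computed by the given multiplication algorithm. The
syzygy criterion deletes no row that is needed as a pivot, and the module monomials `x_k τ e_i` of
the remaining rows are distinct and no leading monomials of syzygies, so there are at most
`h_{d+1} = β_{d+1} + α_{d+1}` rows.
-/

noncomputable section

namespace DetGB

/-! ### Semantics of computation trees -/

section Computation

variable {𝕜 S ι κ : Type*} {P P' : Set S} {K K' : Set (S → 𝕜)} {f g : S → 𝕜} {N N' c c' : ℕ}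

/-- A computation on a set `S` of instances is described by the set `P` of instances that can still
occur and the set `K` of functions of the instance computed so far. In this situation, `f` is known
if it is constant or agrees with a function in `K` on the instances that can still occur. -/
def Known (P : Set S) (K : Set (S → 𝕜)) (f : S → 𝕜) : Prop :=
  (∃ a, ∀ s ∈ P, f s = a) ∨ ∃ g ∈ K, ∀ s ∈ P, f s = g s

theorem Known.mono (h : Known P K f) (hP : P' ⊆ P) (hK : K ⊆ K') : Known P' K' f := by
  rcases h with ⟨a, ha⟩ | ⟨g, hg, h⟩
  · exact .inl ⟨a, fun s hs => ha s (hP hs)⟩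
  · exact .inr ⟨g, hK hg, fun s hs => h s (hP hs)⟩

theorem Known.of_mem (h : f ∈ K) : Known P K f :=
  .inr ⟨f, h, fun _ _ => rfl⟩

theorem Known.const (a : 𝕜) : Known P K (fun _ => a) :=
  .inl ⟨a, fun _ _ => rfl⟩

theorem Known.congr (h : Known P K f) (hfg : ∀ s ∈ P, g s = f s) : Known P K g := by
  rcases h with ⟨a, ha⟩ | ⟨k, hk, h⟩
  · exact .inl ⟨a, fun s hs => (hfg s hs).trans (ha s hs)⟩
  · exact .inr ⟨k, hk, fun s hs => (hfg s hs).trans (h s hs)⟩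

theorem Known.eval {x : ι → S → 𝕜} {mem : ℕ → S → 𝕜} (hx : ∀ i, Known P K (x i))
    (hmem : ∀ j, Known P K (mem j)) (o : Operand 𝕜 ι) :
    Known P K fun s => o.eval (fun i => x i s) fun j => mem j s := by
  cases o with
  | input i => exact hx i
  | cell j => exact hmem j
  | const a => exact .const a

/-- An operand that reads no memory cell from `N` on. -/
def Operand.Below (N : ℕ) : Operand 𝕜 ι → Prop
  | .cell j => j < N
  | _ => True

theorem Operand.Below.mono {o : Operand 𝕜 ι} (h : o.Below N) (hN : N ≤ N') : o.Below N' := by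
  cases o with
  | cell j => exact Nat.lt_of_lt_of_le h hN
  | _ => trivial

theorem Operand.Below.eval_update {o : Operand 𝕜 ι} (h : o.Below N) (x : ι → 𝕜) (mem : ℕ → 𝕜)
    (v : 𝕜) : o.eval x (Function.update mem N v) = o.eval x mem := by
  cases o with
  | cell j => exact Function.update_of_ne (Nat.ne_of_lt h) v mem
  | _ => rfl

/-- On the instances in `P`, the functions in `K` are read off from the inputs `x` and the first
`N` memory cells. -/
def Stores (P : Set S) (K : Set (S → 𝕜)) (x : S → ι → 𝕜) (mem : S → ℕ → 𝕜) (N : ℕ) : Prop :=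
  ∀ f ∈ K, ∃ o : Operand 𝕜 ι, o.Below N ∧ ∀ s ∈ P, o.eval (x s) (mem s) = f s

namespace Stores

variable {x : S → ι → 𝕜} {mem : S → ℕ → 𝕜}

theorem subset (h : Stores P K x mem N) (hP : P' ⊆ P) : Stores P' K x mem N :=
  fun f hf => (h f hf).imp fun _ ho => ⟨ho.1, fun s hs => ho.2 s (hP hs)⟩

theorem exists_operand (h : Stores P K x mem N) (hf : Known P K f) :
    ∃ o : Operand 𝕜 ι, o.Below N ∧ ∀ s ∈ P, o.eval (x s) (mem s) = f s := by
  rcases hf with ⟨a, ha⟩ | ⟨g, hg, hfg⟩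
  · exact ⟨.const a, trivial, fun s hs => (ha s hs).symm⟩
  · obtain ⟨o, ho, hog⟩ := h g hg
    exact ⟨o, ho, fun s hs => (hog s hs).trans (hfg s hs).symm⟩

theorem insert (h : Stores P K x mem N) (f : S → 𝕜) :
    Stores P (insert f K) x (fun s => Function.update (mem s) N (f s)) (N + 1) := by
  intro k hk
  rcases Set.mem_insert_iff.1 hk with rfl | hk
  · exact ⟨.cell N, Nat.lt_succ_self N, fun s _ => Function.update_self ..⟩
  · obtain ⟨o, ho, hok⟩ := h k hk
    exact ⟨o, ho.mono N.le_succ, fun s hs => by rw [ho.eval_update, hok s hs]⟩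

theorem range_input (x : S → ι → 𝕜) (mem : S → ℕ → 𝕜) :
    Stores P (Set.range fun i s => x s i) x mem 0 := by
  rintro _ ⟨i, rfl⟩
  exact ⟨.input i, trivial, fun s _ => rfl⟩

end Stores

variable [Field 𝕜]

/-- From the known functions `K` on the instances `P`, at most `c` steps suffice to reach, along
every path of a computation tree, a situation `P'`, `K'` with `Q P' K'` or one in which no instance
is left. -/
inductive Reaches (Q : Set S → Set (S → 𝕜) → Prop) : Set S → Set (S → 𝕜) → ℕ → Prop
  | done {P : Set S} {K : Set (S → 𝕜)} {c : ℕ} : Q P K → Reaches Q P K c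
  | empty {K : Set (S → 𝕜)} {c : ℕ} : Reaches Q ∅ K c
  | compute {P : Set S} {K : Set (S → 𝕜)} {c : ℕ} (o : ArithOp) (f g h : S → 𝕜) :
      Known P K f → Known P K g → (∀ s ∈ P, o.apply (f s) (g s) = some (h s)) →
      Reaches Q P (insert h K) c → Reaches Q P K (c + 1)
  | branch {P : Set S} {K : Set (S → 𝕜)} {c : ℕ} (f : S → 𝕜) : Known P K f →
      Reaches Q {s ∈ P | f s = 0} K c → Reaches Q {s ∈ P | f s ≠ 0} K c → Reaches Q P K (c + 1)

namespace Reaches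

variable {Q Q' : Set S → Set (S → 𝕜) → Prop}

theorem mono_cost (h : Reaches Q P K c) (hc : c ≤ c') : Reaches Q P K c' := by
  induction h generalizing c' with
  | done h => exact .done h
  | empty => exact .empty
  | compute o f g h hf hg hh _ ih =>
    obtain ⟨k, rfl⟩ := Nat.exists_eq_add_of_le' (Nat.one_le_of_lt hc)
    exact .compute o f g h hf hg hh (ih (Nat.le_of_succ_le_succ hc))
  | branch f hf _ _ ih₁ ih₂ =>
    obtain ⟨k, rfl⟩ := Nat.exists_eq_add_of_le' (Nat.one_le_of_lt hc)
    exact .branch f hf (ih₁ (Nat.le_of_succ_le_succ hc)) (ih₂ (Nat.le_of_succ_le_succ hc))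

theorem bind (h : Reaches Q P K c)
    (hQ : ∀ P' K', P' ⊆ P → K ⊆ K' → Q P' K' → Reaches Q' P' K' c') :
    Reaches Q' P K (c + c') := by
  induction h with
  | done h => exact (hQ _ _ subset_rfl subset_rfl h).mono_cost (Nat.le_add_left ..)
  | empty => exact .empty
  | compute o f g h hf hg hh _ ih =>
    rw [Nat.add_right_comm]
    exact .compute o f g h hf hg hh
      (ih fun P' K' hP hK => hQ P' K' hP ((Set.subset_insert _ _).trans hK))
  | branch f hf _ _ ih₁ ih₂ =>
    rw [Nat.add_right_comm]
    exact .branch f hf (ih₁ fun P' K' hP hK => hQ P' K' (hP.trans (Set.sep_subset _ _)) hK)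
      (ih₂ fun P' K' hP hK => hQ P' K' (hP.trans (Set.sep_subset _ _)) hK)

theorem imp (h : Reaches Q P K c) (hQ : ∀ P' K', P' ⊆ P → K ⊆ K' → Q P' K' → Q' P' K') :
    Reaches Q' P K c :=
  h.bind (c' := 0) fun P' K' hP hK hq => .done (hQ P' K' hP hK hq)

theorem op (o : ArithOp) {h : S → 𝕜} (hf : Known P K f) (hg : Known P K g)
    (hh : ∀ s ∈ P, o.apply (f s) (g s) = some (h s)) :
    Reaches (fun P' K' => Known P' K' h) P K 1 :=
  .compute o f g h hf hg hh (.done (.of_mem (Set.mem_insert _ _)))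

theorem forall_mem {Q : κ → Set S → Set (S → 𝕜) → Prop}
    (hQ : ∀ {k P K P' K'}, P' ⊆ P → K ⊆ K' → Q k P K → Q k P' K')
    (hc : ∀ k P' K', P' ⊆ P → K ⊆ K' → Reaches (Q k) P' K' c) (T : Finset κ) :
    Reaches (fun P' K' => ∀ k ∈ T, Q k P' K') P K (T.card * c) := by
  classical
  induction T using Finset.induction_on with
  | empty => exact .done (by simp only [Finset.notMem_empty, false_imp_iff, implies_true])
  | insert a T ha ih =>
    rw [Finset.card_insert_of_notMem ha, Nat.succ_mul]
    refine ih.bind fun P' K' hP hK hT => ?_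
    refine (hc a P' K' hP hK).imp fun P'' K'' hP' hK' haQ => ?_
    exact Finset.forall_mem_insert .. |>.2 ⟨haQ, fun k hk => hQ hP' hK' (hT k hk)⟩

theorem forall_of_fintype [Fintype κ] {Q : κ → Set S → Set (S → 𝕜) → Prop}
    (hQ : ∀ {k P K P' K'}, P' ⊆ P → K ⊆ K' → Q k P K → Q k P' K')
    (hc : ∀ k P' K', P' ⊆ P → K ⊆ K' → Reaches (Q k) P' K' c) :
    Reaches (fun P' K' => ∀ k, Q k P' K') P K (Fintype.card κ * c) :=
  (forall_mem (Q := Q) hQ hc Finset.univ).imp fun _ _ _ _ hk k => hk k (Finset.mem_univ k)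

theorem test_zero (hf : Known P K f) :
    Reaches (fun P' _ => ∃ p : Prop, ∀ s ∈ P', f s = 0 ↔ p) P K 1 :=
  .branch (c := 0) f hf (.done ⟨True, fun _ hs => iff_true_intro hs.2⟩)
    (.done ⟨False, fun _ hs => iff_false_intro hs.2⟩)

theorem test_zero_family [Fintype κ] {h : κ → S → 𝕜} (hK : ∀ k, Known P K (h k)) :
    Reaches (fun P' _ => ∃ Z : Set κ, ∀ s ∈ P', ∀ k, h k s = 0 ↔ k ∈ Z) P K (Fintype.card κ) := by
  have hall := forall_of_fintype (P := P) (K := K)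
    (Q := fun k P' _ => ∃ p : Prop, ∀ s ∈ P', h k s = 0 ↔ p)
    (fun hP _ hp => hp.imp fun _ hp s hs => hp s (hP hs))
    fun k P' K' hP hKK => test_zero ((hK k).mono hP hKK)
  rw [Nat.mul_one] at hall
  refine hall.imp fun P' K' _ _ hp => ?_
  choose p hp using hp
  exact ⟨{k | p k}, fun s hs k => hp k s hs⟩

theorem exists_tree_of_stores {x : S → ι → 𝕜} {mem : S → ℕ → 𝕜} (h : Reaches Q P K c)
    {spec : S → (κ → 𝕜) → Prop}
    (hQ : ∀ P' K', Q P' K' → ∃ y : κ → S → 𝕜, (∀ k, Known P' K' (y k)) ∧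
      ∀ s ∈ P', spec s fun k => y k s) (hmem : Stores P K x mem N) :
    ∃ t : CompTree 𝕜 ι κ, ∀ s ∈ P, ∃ y cost,
      t.run (x s) (mem s) = some (y, cost) ∧ spec s y ∧ cost ≤ c := by
  induction h generalizing N mem with
  | done h =>
    obtain ⟨y, hK, hy⟩ := hQ _ _ h
    choose o ho using fun k => hmem.exists_operand (hK k)
    refine ⟨.output o, fun s hs => ⟨_, 0, rfl, ?_, Nat.zero_le _⟩⟩
    simpa only [(ho _).2 s hs] using hy s hs
  | empty => exact ⟨.output fun _ => .const 0, fun _ hs => hs.elim⟩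
  | compute o f g h hf hg hh _ ih =>
    obtain ⟨a, -, ha⟩ := hmem.exists_operand hf
    obtain ⟨b, -, hb⟩ := hmem.exists_operand hg
    obtain ⟨t, ht⟩ := ih (hmem.insert h)
    refine ⟨.compute o a b N t, fun s hs => ?_⟩
    obtain ⟨y, cost, hrun, hy, hc⟩ := ht s hs
    exact ⟨y, cost + 1, by simp [CompTree.run, ha s hs, hb s hs, hh s hs, hrun], hy,
      Nat.succ_le_succ hc⟩
  | branch f hf _ _ ih₁ ih₂ =>
    obtain ⟨a, -, ha⟩ := hmem.exists_operand hf
    obtain ⟨t₁, ht₁⟩ := ih₁ (hmem.subset (Set.sep_subset _ _))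
    obtain ⟨t₂, ht₂⟩ := ih₂ (hmem.subset (Set.sep_subset _ _))
    refine ⟨.branch a t₁ t₂, fun s hs => ?_⟩
    by_cases h0 : f s = 0
    · obtain ⟨y, cost, hrun, hy, hc⟩ := ht₁ s ⟨hs, h0⟩
      exact ⟨y, cost + 1, by simp [CompTree.run, ha s hs, h0, hrun], hy, Nat.succ_le_succ hc⟩
    · obtain ⟨y, cost, hrun, hy, hc⟩ := ht₂ s ⟨hs, h0⟩
      exact ⟨y, cost + 1, by simp [CompTree.run, ha s hs, h0, hrun], hy, Nat.succ_le_succ hc⟩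

theorem exists_tree (x : S → ι → 𝕜) (spec : S → (κ → 𝕜) → Prop)
    (h : Reaches (fun P' K' => ∃ y : κ → S → 𝕜, (∀ k, Known P' K' (y k)) ∧
      ∀ s ∈ P', spec s fun k => y k s) P (Set.range fun i s => x s i) c) :
    ∃ t : CompTree 𝕜 ι κ, ∀ s ∈ P, ∃ y cost, t.Computes (x s) y cost ∧ spec s y ∧ cost ≤ c :=
  h.exists_tree_of_stores (fun _ _ h => h) (.range_input x _)

end Reaches

open Classical in
theorem CompTree.run_branch_eq_some {x : ι → 𝕜} {a : Operand 𝕜 ι} {t₁ t₂ : CompTree 𝕜 ι κ}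
    {mem : ℕ → 𝕜} {y : κ → 𝕜} {cost : ℕ} :
    (CompTree.branch a t₁ t₂).run x mem = some (y, cost) ↔
      ∃ cost', (if a.eval x mem = 0 then t₁ else t₂).run x mem = some (y, cost') ∧
        cost = cost' + 1 := by
  rw [CompTree.run, ← apply_ite (fun t : CompTree 𝕜 ι κ => t.run x mem)]
  simp [eq_comm (a := cost)]

theorem CompTree.run_compute_eq_some {x : ι → 𝕜} {o : ArithOp} {a b : Operand 𝕜 ι} {dst : ℕ}
    {t : CompTree 𝕜 ι κ} {mem : ℕ → 𝕜} {y : κ → 𝕜} {cost : ℕ} :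
    (CompTree.compute o a b dst t).run x mem = some (y, cost) ↔
      ∃ v, o.apply (a.eval x mem) (b.eval x mem) = some v ∧
        ∃ cost', t.run x (Function.update mem dst v) = some (y, cost') ∧ cost = cost' + 1 := by
  simp [CompTree.run, Option.bind_eq_some_iff, Option.map_eq_some_iff, eq_comm (a := cost)]

namespace Reaches

theorem run_compute {x : ι → S → 𝕜} {mem : ℕ → S → 𝕜} {y : κ → S → 𝕜} {o : ArithOp}
    {a b : Operand 𝕜 ι} {dst : ℕ} {t : CompTree 𝕜 ι κ} {Q : Set S → Set (S → 𝕜) → Prop}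
    (hx : ∀ i, Known P K (x i)) (hmem : ∀ j, Known P K (mem j))
    (ht : ∀ s ∈ P, ∃ cost ≤ c + 1, (CompTree.compute o a b dst t).run (fun i => x i s)
      (fun j => mem j s) = some (fun k => y k s, cost))
    (hnext : ∀ v : S → 𝕜, (∀ j, Known P (insert v K) (Function.update mem dst v j)) →
      (∀ s ∈ P, ∃ cost ≤ c, t.run (fun i => x i s) (fun j => Function.update mem dst v j s) =
        some (fun k => y k s, cost)) → Reaches Q P (insert v K) c) :
    Reaches Q P K (c + 1) := by
  let v : S → 𝕜 := fun s => (o.apply (a.eval (fun i => x i s) fun j => mem j s)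
    (b.eval (fun i => x i s) fun j => mem j s)).getD 0
  have hupdate (s : S) : (fun j => Function.update mem dst v j s) =
      Function.update (fun j => mem j s) dst (v s) := by
    funext j
    rcases eq_or_ne j dst with rfl | hj
    · simp only [Function.update_self]
    · simp only [Function.update_of_ne hj]
  have hrun : ∀ s ∈ P, o.apply (a.eval (fun i => x i s) fun j => mem j s)
      (b.eval (fun i => x i s) fun j => mem j s) = some (v s) ∧ ∃ cost ≤ c,
        t.run (fun i => x i s) (fun j => Function.update mem dst v j s) =
          some (fun k => y k s, cost) := by
    intro s hs
    obtain ⟨_, hc, h⟩ := ht s hs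
    obtain ⟨w, hw, cost, hrun, rfl⟩ := CompTree.run_compute_eq_some.1 h
    have hvw : v s = w := by simp only [v, hw, Option.getD_some]
    exact ⟨hvw ▸ hw, cost, Nat.le_of_succ_le_succ hc, by rwa [hupdate, hvw]⟩
  refine .compute o _ _ v (.eval hx hmem a) (.eval hx hmem b) (fun s hs => (hrun s hs).1)
    (hnext v (fun j => ?_) fun s hs => (hrun s hs).2)
  rcases eq_or_ne j dst with rfl | hj
  · simpa using Known.of_mem (Set.mem_insert v K)
  · simpa [hj] using (hmem j).mono subset_rfl (Set.subset_insert v K)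

theorem run (t : CompTree 𝕜 ι κ) {x : ι → S → 𝕜} {mem : ℕ → S → 𝕜} {y : κ → S → 𝕜}
    (hx : ∀ i, Known P K (x i)) (hmem : ∀ j, Known P K (mem j))
    (ht : ∀ s ∈ P, ∃ cost ≤ c, t.run (fun i => x i s) (fun j => mem j s) =
      some (fun k => y k s, cost)) :
    Reaches (fun P' K' => ∀ k, Known P' K' (y k)) P K c := by
  induction t generalizing P K c mem with
  | output f =>
    refine .done fun k => (Known.eval hx hmem (f k)).congr fun s hs => ?_
    obtain ⟨cost, -, h⟩ := ht s hs
    simp only [CompTree.run, Option.some.injEq, Prod.mk.injEq] at h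
    exact (congrFun h.1 k).symm
  | compute o a b dst next ih =>
    cases c with
    | zero =>
      obtain rfl : P = ∅ := Set.eq_empty_of_forall_notMem fun s hs => by
        obtain ⟨_, hc, h⟩ := ht s hs
        obtain ⟨_, _, _, _, rfl⟩ := CompTree.run_compute_eq_some.1 h
        exact Nat.not_succ_le_zero _ hc
      exact .empty
    | succ c =>
      exact run_compute hx hmem ht fun v hmem' hrun =>
        ih (fun i => (hx i).mono subset_rfl (Set.subset_insert v K)) hmem' hrun
  | branch a t₁ t₂ ih₁ ih₂ =>
    cases c with
    | zero =>
      obtain rfl : P = ∅ := Set.eq_empty_of_forall_notMem fun s hs => by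
        obtain ⟨_, hc, h⟩ := ht s hs
        obtain ⟨_, _, rfl⟩ := CompTree.run_branch_eq_some.1 h
        exact Nat.not_succ_le_zero _ hc
      exact .empty
    | succ c =>
      refine .branch _ (.eval hx hmem a)
        (ih₁ (fun i => (hx i).mono (Set.sep_subset _ _) subset_rfl)
          (fun i => (hmem i).mono (Set.sep_subset _ _) subset_rfl) fun s hs => ?_)
        (ih₂ (fun i => (hx i).mono (Set.sep_subset _ _) subset_rfl)
          (fun i => (hmem i).mono (Set.sep_subset _ _) subset_rfl) fun s hs => ?_)
      all_goals
        obtain ⟨_, hc, h⟩ := ht s hs.1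
        obtain ⟨cost, hrun, rfl⟩ := CompTree.run_branch_eq_some.1 h
      · exact ⟨cost, Nat.le_of_succ_le_succ hc, by rwa [if_pos hs.2] at hrun⟩
      · exact ⟨cost, Nat.le_of_succ_le_succ hc, by rwa [if_neg hs.2] at hrun⟩

end Reaches

end Computation

section MatrixArithmetic

variable {𝕜 S m n l m' n' : Type*} {P P' : Set S} {K K' : Set (S → 𝕜)}

/-- All entries of the matrix `X`, which depends on the instance, are known. -/
def KnownMat (P : Set S) (K : Set (S → 𝕜)) (X : S → Matrix m n 𝕜) : Prop :=
  ∀ i j, Known P K fun s => X s i j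

theorem KnownMat.mono {X : S → Matrix m n 𝕜} (h : KnownMat P K X) (hP : P' ⊆ P) (hK : K ⊆ K') :
    KnownMat P' K' X :=
  fun i j => (h i j).mono hP hK

theorem KnownMat.congr {X Y : S → Matrix m n 𝕜} (h : KnownMat P K X) (hXY : ∀ s ∈ P, Y s = X s) :
    KnownMat P K Y :=
  fun i j => (h i j).congr fun s hs => by rw [hXY s hs]

/-- Extension of a matrix by zeros along injections of the index types. -/
def padMat [Zero 𝕜] (f : m → m') (g : n → n') (X : Matrix m n 𝕜) : Matrix m' n' 𝕜 :=
  Function.extend f (fun i => Function.extend g (X i) 0) 0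

section Padding

variable {f : m → m'} {g : n → n'}

theorem padMat_apply [Zero 𝕜] (hf : f.Injective) (hg : g.Injective) (X : Matrix m n 𝕜) (i : m)
    (j : n) : padMat f g X (f i) (g j) = X i j := by
  rw [padMat, hf.extend_apply, hg.extend_apply]

theorem padMat_apply_of_notMem_left [Zero 𝕜] (X : Matrix m n 𝕜) {u : m'} (hu : u ∉ Set.range f)
    (v : n') : padMat f g X u v = 0 := by
  rw [padMat, Function.extend_apply' _ _ _ hu]
  rfl

theorem padMat_apply_of_notMem_right [Zero 𝕜] (hf : f.Injective) (X : Matrix m n 𝕜) (u : m')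
    {v : n'} (hv : v ∉ Set.range g) : padMat f g X u v = 0 := by
  by_cases hu : u ∈ Set.range f
  · obtain ⟨i, rfl⟩ := hu
    rw [padMat, hf.extend_apply, Function.extend_apply' _ _ _ hv]
    rfl
  · exact padMat_apply_of_notMem_left X hu v

theorem KnownMat.pad [Zero 𝕜] {X : S → Matrix m n 𝕜} (h : KnownMat P K X) (hf : f.Injective)
    (hg : g.Injective) : KnownMat P K fun s => padMat f g (X s) := by
  intro u v
  by_cases hu : u ∈ Set.range f
  · by_cases hv : v ∈ Set.range g
    · obtain ⟨⟨i, rfl⟩, j, rfl⟩ := And.intro hu hv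
      simpa only [padMat_apply hf hg] using h i j
    · simpa only [padMat_apply_of_notMem_right hf _ _ hv] using Known.const 0
  · simpa only [padMat_apply_of_notMem_left _ hu] using Known.const 0

end Padding

variable [Field 𝕜]

namespace Reaches

theorem sum {κ : Type*} (T : Finset κ) {f : κ → S → 𝕜} (hf : ∀ k ∈ T, Known P K (f k)) :
    Reaches (fun P' K' => Known P' K' fun s => ∑ k ∈ T, f k s) P K T.card := by
  classical
  induction T using Finset.induction_on with
  | empty => exact .done (by simpa only [Finset.sum_empty] using Known.const 0)
  | insert a T ha ih =>
    rw [Finset.card_insert_of_notMem ha]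
    refine (ih fun k hk => hf k (Finset.mem_insert_of_mem hk)).bind fun P' K' hP hK h => ?_
    exact .op .add ((hf a (Finset.mem_insert_self a T)).mono hP hK) h fun s _ => by
      simp only [ArithOp.apply, Finset.sum_insert ha]

variable [Fintype m] [Fintype l] {X : S → Matrix m l 𝕜} {c : ℕ}

theorem knownMat (h : ∀ i j P' K', P' ⊆ P → K ⊆ K' →
      Reaches (fun P'' K'' => Known P'' K'' fun s => X s i j) P' K' c) :
    Reaches (fun P' K' => KnownMat P' K' X) P K (Fintype.card m * Fintype.card l * c) := by
  have hall := forall_of_fintype (P := P) (K := K)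
    (Q := fun (p : m × l) P' K' => Known P' K' fun s => X s p.1 p.2)
    (fun hP hK h => h.mono hP hK) fun p => h p.1 p.2
  rw [Fintype.card_prod] at hall
  exact hall.imp fun _ _ _ _ h i j => h (i, j)

theorem add_mat {Y : S → Matrix m l 𝕜} (hX : KnownMat P K X) (hY : KnownMat P K Y) :
    Reaches (fun P' K' => KnownMat P' K' fun s => X s + Y s) P K
      (Fintype.card m * Fintype.card l) :=
  (knownMat fun i j _ _ hP hK => .op .add ((hX i j).mono hP hK) ((hY i j).mono hP hK)
    fun _ _ => rfl).mono_cost (Nat.mul_one _).le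

theorem sub_mat {Y : S → Matrix m l 𝕜} (hX : KnownMat P K X) (hY : KnownMat P K Y) :
    Reaches (fun P' K' => KnownMat P' K' fun s => X s - Y s) P K
      (Fintype.card m * Fintype.card l) :=
  (knownMat fun i j _ _ hP hK => .op .sub ((hX i j).mono hP hK) ((hY i j).mono hP hK)
    fun _ _ => rfl).mono_cost (Nat.mul_one _).le

end Reaches

/-- Two `b × b` matrices can be multiplied with at most `μ` steps. -/
def HasMulTree (𝕜 : Type*) [Field 𝕜] (b μ : ℕ) : Prop :=
  ∃ t : CompTree 𝕜 ((Fin b × Fin b) ⊕ (Fin b × Fin b)) (Fin b × Fin b),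
    ∀ A B : Matrix (Fin b) (Fin b) 𝕜, ∃ cost ≤ μ,
      t.Computes (Sum.elim (fun p => A p.1 p.2) (fun p => B p.1 p.2))
        (fun p => (A * B) p.1 p.2) cost

theorem IsMatMulExponent.hasMulTree {ω c : ℝ} (h : IsMatMulExponent 𝕜 ω c) (b : ℕ) :
    HasMulTree 𝕜 b ⌊c * (b : ℝ) ^ ω⌋₊ := by
  obtain ⟨t, ht⟩ := h b
  refine ⟨t, fun A B => ?_⟩
  obtain ⟨cost, hrun, hcost⟩ := ht A B
  exact ⟨cost, Nat.le_floor hcost, hrun⟩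

namespace HasMulTree

variable {b μ p q t : ℕ}

theorem reaches_mul_square (h : HasMulTree 𝕜 b μ) {X Y : S → Matrix (Fin b) (Fin b) 𝕜}
    (hX : KnownMat P K X) (hY : KnownMat P K Y) :
    Reaches (fun P' K' => KnownMat P' K' fun s => X s * Y s) P K μ := by
  obtain ⟨t, ht⟩ := h
  have hrun := Reaches.run (P := P) (K := K) (c := μ) t
    (x := Sum.elim (fun p s => X s p.1 p.2) fun p s => Y s p.1 p.2) (mem := fun _ _ => 0)
    (y := fun p s => (X s * Y s) p.1 p.2) (by rintro (p | p); exacts [hX _ _, hY _ _])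
    (fun _ => .const 0) fun s _ => by
      obtain ⟨cost, hc, h⟩ := ht (X s) (Y s)
      refine ⟨cost, hc, ?_⟩
      rw [← h]
      congr 1
      funext p
      cases p <;> rfl
  exact hrun.imp fun _ _ _ _ h i j => h (i, j)

theorem reaches_mul_blocks (h : HasMulTree 𝕜 b μ) {X : S → Matrix (Fin p × Fin b) (Fin q × Fin b) 𝕜}
    {Y : S → Matrix (Fin q × Fin b) (Fin t × Fin b) 𝕜} (hX : KnownMat P K X)
    (hY : KnownMat P K Y) :
    Reaches (fun P' K' => KnownMat P' K' fun s => X s * Y s) P K (p * q * t * (μ + b ^ 2)) := by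
  let blockProd : (Fin p × Fin q × Fin t) → S → Matrix (Fin b) (Fin b) 𝕜 := fun k s =>
    (Matrix.of fun i j => X s (k.1, i) (k.2.1, j)) * Matrix.of fun i j => Y s (k.2.1, i) (k.2.2, j)
  have hprod := Reaches.forall_of_fintype (P := P) (K := K) (c := μ)
    (Q := fun k P' K' => KnownMat P' K' (blockProd k)) (fun hP hK h => h.mono hP hK)
    fun k P' K' hP hK => h.reaches_mul_square (fun i j => (hX _ _).mono hP hK)
      fun i j => (hY _ _).mono hP hK
  refine (hprod.bind fun P₁ K₁ _ _ hblock => Reaches.knownMat (c := q)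
    fun i j P₂ K₂ hP hK => ?_).mono_cost ?_
  · have hsum := Reaches.sum (P := P₂) (K := K₂) (Finset.univ : Finset (Fin q))
      (f := fun u s => blockProd (i.1, u, j.1) s i.2 j.2) fun u _ =>
        (hblock (i.1, u, j.1) i.2 j.2).mono hP hK
    rw [Finset.card_univ, Fintype.card_fin] at hsum
    refine hsum.imp fun _ _ _ _ h => h.congr fun s _ => ?_
    simp only [blockProd, Matrix.mul_apply, Matrix.of_apply, Fintype.sum_prod_type]
  · simp only [Fintype.card_prod, Fintype.card_fin]
    exact le_of_eq (by ring)

theorem reaches_mul [Fintype m] [Fintype n] [Fintype l] (h : HasMulTree 𝕜 b μ)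
    (hm : Fintype.card m ≤ p * b) (hn : Fintype.card n ≤ q * b) (hl : Fintype.card l ≤ t * b)
    {X : S → Matrix m n 𝕜} {Y : S → Matrix n l 𝕜} (hX : KnownMat P K X) (hY : KnownMat P K Y) :
    Reaches (fun P' K' => KnownMat P' K' fun s => X s * Y s) P K (p * q * t * (μ + b ^ 2)) := by
  obtain ⟨f⟩ : Nonempty (m ↪ Fin p × Fin b) := Function.Embedding.nonempty_of_card_le (by simpa)
  obtain ⟨g⟩ : Nonempty (n ↪ Fin q × Fin b) := Function.Embedding.nonempty_of_card_le (by simpa)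
  obtain ⟨k⟩ : Nonempty (l ↪ Fin t × Fin b) := Function.Embedding.nonempty_of_card_le (by simpa)
  refine (h.reaches_mul_blocks (hX.pad f.injective g.injective)
    (hY.pad g.injective k.injective)).imp fun _ _ _ _ h i j => (h (f i) (k j)).congr fun s _ => ?_
  change (X s * Y s) i j = (padMat f g (X s) * padMat g k (Y s)) (f i) (k j)
  rw [Matrix.mul_apply, Matrix.mul_apply]
  refine Fintype.sum_of_injective g g.injective _ _ (fun v hv => ?_) fun v => ?_
  · rw [padMat_apply_of_notMem_right f.injective _ _ hv, zero_mul]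
  · rw [padMat_apply f.injective g.injective, padMat_apply g.injective k.injective]

end HasMulTree

end MatrixArithmetic

/-! ### Blocked Gaussian elimination -/

section Elimination

variable {𝕜 S ρ : Type*} [Field 𝕜] [DecidableEq ρ] {k t : ℕ} {X : Matrix ρ (Fin k) 𝕜}
  {W : Matrix ρ ρ 𝕜} {R R₀ : Finset ρ} {π : ρ → Fin k} {c : Fin k} {r : ρ}

/-- The first `t` columns of `X` are in reduced form: the rows in `R` have their pivots in the
columns given by `π`, and the other rows vanish. -/
structure ReducedUpTo (X : Matrix ρ (Fin k) 𝕜) (R : Finset ρ) (π : ρ → Fin k) (t : ℕ) :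
    Prop where
  lt : ∀ i ∈ R, (π i : ℕ) < t
  pivot : ∀ i ∈ R, ∀ j, X j (π i) = if j = i then 1 else 0
  zero : ∀ i ∉ R, ∀ c : Fin k, (c : ℕ) < t → X i c = 0
  left : ∀ i ∈ R, ∀ c : Fin k, c < π i → X i c = 0

theorem ReducedUpTo.succ_of_zero (h : ReducedUpTo X R π t)
    (hz : ∀ c : Fin k, (c : ℕ) = t → ∀ i ∉ R, X i c = 0) : ReducedUpTo X R π (t + 1) where
  lt i hi := (h.lt i hi).trans (Nat.lt_succ_self t)
  pivot := h.pivot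
  zero i hi c hc := (Nat.lt_succ_iff_lt_or_eq.1 hc).elim (h.zero i hi c) fun hc => hz c hc i hi
  left := h.left

/-- The multiple of row `r` to be added to row `i` of a matrix to replace its column `v` by the
`r`-th unit vector. -/
def pivotWeight (v : ρ → 𝕜) (r i : ρ) : 𝕜 :=
  ((if i = r then 1 else 0) - v i) / v r

section Pivot

variable [Fintype ρ]

/-- The row transformation replacing the column `v` of a matrix by the `r`-th unit vector. -/
def pivotMatrix (v : ρ → 𝕜) (r : ρ) : Matrix ρ ρ 𝕜 :=
  1 + Matrix.vecMulVec (pivotWeight v r) (Pi.single r 1)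

theorem pivotMatrix_mul_apply {n : Type*} (v : ρ → 𝕜) (r : ρ) (X : Matrix ρ n 𝕜) (i : ρ) (j : n) :
    (pivotMatrix v r * X) i j = X i j + pivotWeight v r i * X r j := by
  simp [pivotMatrix, Matrix.add_mul, Matrix.vecMulVec_mul, Matrix.vecMulVec_apply]

theorem isUnit_pivotMatrix {v : ρ → 𝕜} (hv : v r ≠ 0) : IsUnit (pivotMatrix v r) := by
  have hdet : 1 + pivotWeight v r r = (v r)⁻¹ := by
    rw [pivotWeight, if_pos rfl]
    field_simp
    ring
  rw [Matrix.isUnit_iff_isUnit_det, pivotMatrix, Matrix.vecMulVec_eq Unit,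
    Matrix.det_one_add_replicateCol_mul_replicateRow, single_one_dotProduct, hdet]
  exact (inv_ne_zero hv).isUnit

theorem ReducedUpTo.succ_of_pivot (h : ReducedUpTo X R π c) (hr : r ∉ R) (hX : X r c ≠ 0) :
    ReducedUpTo (pivotMatrix (fun i => X i c) r * X) (insert r R) (Function.update π r c)
      (c + 1) := by
  let X' : Matrix ρ (Fin k) 𝕜 := pivotMatrix (fun i => X i c) r * X
  have hX' : ∀ i j, X' i j = X i j + pivotWeight (fun i => X i c) r i * X r j :=
    pivotMatrix_mul_apply _ r X
  change ReducedUpTo X' _ _ _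
  have hold : ∀ i (j : Fin k), (j : ℕ) < c → X' i j = X i j := fun i j hj => by
    rw [hX', h.zero r hr j hj, mul_zero, add_zero]
  have hnew : ∀ i, X' i c = if i = r then 1 else 0 := fun i => by
    rw [hX', pivotWeight, div_mul_cancel₀ _ hX, add_sub_cancel]
  have hπ : ∀ i ∈ R, Function.update π r c i = π i := fun i hi =>
    Function.update_of_ne (ne_of_mem_of_not_mem hi hr) _ _
  constructor
  · intro i hi
    rcases Finset.mem_insert.1 hi with rfl | hi
    · rw [Function.update_self]
      exact Nat.lt_succ_self _
    · rw [hπ i hi]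
      exact (h.lt i hi).trans (Nat.lt_succ_self _)
  · intro i hi j
    rcases Finset.mem_insert.1 hi with rfl | hi
    · rw [Function.update_self, hnew]
    · rw [hπ i hi, hold _ _ (h.lt i hi), h.pivot i hi]
  · intro i hi j hj
    rw [Finset.mem_insert, not_or] at hi
    rcases Nat.lt_succ_iff_lt_or_eq.1 hj with hj | hj
    · rw [hold _ _ hj, h.zero i hi.2 j hj]
    · rw [Fin.ext hj, hnew, if_neg hi.1]
  · intro i hi j hj
    rcases Finset.mem_insert.1 hi with rfl | hi
    · rw [Function.update_self] at hj
      rw [hold _ _ hj, h.zero i hr j hj]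
    · rw [hπ i hi] at hj
      rw [hold _ _ (lt_trans (Fin.lt_def.1 hj) (h.lt i hi)), h.left i hi j hj]

/-- The matrix `W'` such that `1 + W'` performs the row transformation `1 + W` followed by
`pivotMatrix v r`. -/
def pivotUpdate (W : Matrix ρ ρ 𝕜) (v : ρ → 𝕜) (r : ρ) : Matrix ρ ρ 𝕜 :=
  pivotMatrix v r * (1 + W) - 1

theorem one_add_pivotUpdate (W : Matrix ρ ρ 𝕜) (v : ρ → 𝕜) (r : ρ) :
    1 + pivotUpdate W v r = pivotMatrix v r * (1 + W) :=
  add_sub_cancel _ _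

theorem pivotUpdate_apply_self (v : ρ → 𝕜) (hr : ∀ i, W i r = 0) (i : ρ) :
    pivotUpdate W v r i r = pivotWeight v r i := by
  simp [pivotUpdate, pivotMatrix_mul_apply, hr]

theorem pivotUpdate_apply_of_ne (W : Matrix ρ ρ 𝕜) (v : ρ → 𝕜) {l : ρ} (hl : l ≠ r) (i : ρ) :
    pivotUpdate W v r i l = W i l + pivotWeight v r i * W r l := by
  simp [pivotUpdate, pivotMatrix_mul_apply, Matrix.one_apply_ne hl.symm, add_sub_right_comm]

/-- The invertible matrix `1 + W` reduces `X` up to column `t`, with pivots in the rows `R`, and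
`W` vanishes outside the columns indexed by the rows whose pivots were found after `R₀`. -/
structure PanelReduced (W : Matrix ρ ρ 𝕜) (X : Matrix ρ (Fin k) 𝕜) (R₀ R : Finset ρ)
    (π : ρ → Fin k) (t : ℕ) : Prop where
  isUnit : IsUnit (1 + W)
  support : ∀ i, ∀ l ∉ R \ R₀, W i l = 0
  reduced : ReducedUpTo ((1 + W) * X) R π t

theorem PanelReduced.succ_of_zero (h : PanelReduced W X R₀ R π t)
    (hz : ∀ c : Fin k, (c : ℕ) = t → ∀ i ∉ R, ((1 + W) * X : Matrix ρ _ 𝕜) i c = 0) :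
    PanelReduced W X R₀ R π (t + 1) :=
  ⟨h.isUnit, h.support, h.reduced.succ_of_zero hz⟩

theorem PanelReduced.succ_of_pivot (h : PanelReduced W X R₀ R π c) (hR : R₀ ⊆ R) (hr : r ∉ R)
    (hX : ((1 + W) * X : Matrix ρ _ 𝕜) r c ≠ 0) :
    PanelReduced (pivotUpdate W (fun i => ((1 + W) * X : Matrix ρ _ 𝕜) i c) r) X R₀ (insert r R)
      (Function.update π r c) (c + 1) where
  isUnit := by
    rw [one_add_pivotUpdate]
    exact IsUnit.mul (isUnit_pivotMatrix hX) h.isUnit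
  support i l hl := by
    rw [Finset.insert_sdiff_of_notMem _ fun hr' => hr (hR hr'), Finset.mem_insert, not_or] at hl
    rw [pivotUpdate_apply_of_ne _ _ hl.1, h.support _ _ hl.2, h.support _ _ hl.2, mul_zero,
      add_zero]
  reduced := by
    rw [one_add_pivotUpdate, Matrix.mul_assoc]
    exact h.reduced.succ_of_pivot hr hX

end Pivot

variable [Fintype ρ] {P : Set S} {K : Set (S → 𝕜)}

namespace Reaches

theorem column_one_add_mul {n : Type*} {W : S → Matrix ρ ρ 𝕜} {X : S → Matrix ρ n 𝕜}
    {N : Finset ρ} (hW : KnownMat P K W) (hX : KnownMat P K X)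
    (hN : ∀ s ∈ P, ∀ i, ∀ l ∉ N, W s i l = 0) (c : n) :
    Reaches (fun P' K' => ∀ i, Known P' K' fun s => ((1 + W s) * X s : Matrix ρ n 𝕜) i c) P K
      (Fintype.card ρ * (2 * N.card + 1)) := by
  have hsum : ∀ s ∈ P, ∀ i, ((1 + W s) * X s : Matrix ρ n 𝕜) i c =
      X s i c + ∑ l ∈ N, W s i l * X s l c := by
    intro s hs i
    rw [Matrix.add_mul, Matrix.one_mul, Matrix.add_apply, Matrix.mul_apply,
      Finset.sum_subset (Finset.subset_univ N) fun l _ hl => by rw [hN s hs i l hl, zero_mul]]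
  refine forall_of_fintype
    (Q := fun i P' K' => Known P' K' fun s => ((1 + W s) * X s : Matrix ρ n 𝕜) i c)
    (fun hP hK h => h.mono hP hK) fun i P₁ K₁ hP₁ hK₁ => ?_
  have hprod := forall_mem (P := P₁) (K := K₁) (c := 1)
    (Q := fun l P' K' => Known P' K' fun s => W s i l * X s l c) (fun hP hK h => h.mono hP hK)
    (fun l P' K' hP hK => .op .mul ((hW i l).mono (hP.trans hP₁) (hK₁.trans hK))
      ((hX l c).mono (hP.trans hP₁) (hK₁.trans hK)) fun s _ => rfl) N
  refine (hprod.bind (c' := N.card + 1) fun P₂ K₂ hP₂ hK₂ hprod =>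
    (sum N hprod).bind fun P₃ K₃ hP₃ hK₃ h => ?_).mono_cost (by lia)
  have hP : P₃ ⊆ P := (hP₃.trans hP₂).trans hP₁
  exact .op .add ((hX i c).mono hP ((hK₁.trans hK₂).trans hK₃)) h fun s hs =>
    congrArg some (hsum s (hP hs) i).symm

theorem pivotWeight {v : S → ρ → 𝕜} (hv : ∀ i, Known P K fun s => v s i)
    (hr : ∀ s ∈ P, v s r ≠ 0) :
    Reaches (fun P' K' => ∀ i, Known P' K' fun s => DetGB.pivotWeight (v s) r i) P K
      (Fintype.card ρ * 2) := by
  refine forall_of_fintype (Q := fun i P' K' => Known P' K' fun s => DetGB.pivotWeight (v s) r i)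
    (fun hP hK h => h.mono hP hK) fun i P₁ K₁ hP₁ hK₁ => ?_
  refine (op .sub (.const (if i = r then 1 else 0)) ((hv i).mono hP₁ hK₁) fun _ _ => rfl).bind
    fun P₂ K₂ hP₂ hK₂ h => op .div h ((hv r).mono (hP₂.trans hP₁) (hK₁.trans hK₂)) fun s hs => ?_
  exact if_neg (hr s (hP₁ (hP₂ hs)))

theorem pivotUpdate {W : S → Matrix ρ ρ 𝕜} {v : S → ρ → 𝕜} {N : Finset ρ}
    (hW : KnownMat P K W) (hv : ∀ i, Known P K fun s => DetGB.pivotWeight (v s) r i)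
    (hN : ∀ s ∈ P, ∀ i, ∀ l ∉ N, W s i l = 0) (hr : r ∉ N) :
    Reaches (fun P' K' => KnownMat P' K' fun s => DetGB.pivotUpdate (W s) (v s) r) P K
      (Fintype.card ρ * (2 * N.card)) := by
  have hentry := forall_of_fintype (P := P) (K := K) (c := 2)
    (Q := fun (p : ρ × N) P' K' => Known P' K' fun s => DetGB.pivotUpdate (W s) (v s) r p.1 p.2)
    (fun hP hK h => h.mono hP hK) fun ⟨i, l⟩ P₁ K₁ hP₁ hK₁ =>
      (op .mul ((hv i).mono hP₁ hK₁) ((hW r l).mono hP₁ hK₁) fun _ _ => rfl).bind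
        fun P₂ K₂ hP₂ hK₂ h => op .add ((hW i l).mono (hP₂.trans hP₁) (hK₁.trans hK₂)) h
          fun s _ => congrArg some
            (pivotUpdate_apply_of_ne (W s) (v s) (ne_of_mem_of_not_mem l.2 hr) i).symm
  rw [Fintype.card_prod, Fintype.card_coe, Nat.mul_right_comm, Nat.mul_assoc] at hentry
  refine (hentry.imp fun P₁ K₁ hP hK h i l => ?_).mono_cost (by lia)
  by_cases hl : l ∈ N
  · exact h (i, ⟨l, hl⟩)
  · rcases eq_or_ne l r with rfl | hlr
    · exact ((hv i).mono hP hK).congr fun s hs =>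
        pivotUpdate_apply_self (v s) (fun j => hN s (hP hs) j l hl) i
    · refine (Known.const 0).congr fun s hs => ?_
      change DetGB.pivotUpdate (W s) (v s) r i l = 0
      rw [pivotUpdate_apply_of_ne _ _ hlr, hN s (hP hs) _ l hl, hN s (hP hs) _ l hl, mul_zero,
        add_zero]

end Reaches

variable {b μ p j : ℕ}

/-- A matrix `W` as in `PanelReduced` is known, with at most `j` nonzero columns; the pivots are
the same for all instances. -/
def PanelState (X : S → Matrix ρ (Fin k) 𝕜) (R₀ : Finset ρ) (t j : ℕ) (P : Set S)
    (K : Set (S → 𝕜)) : Prop :=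
  ∃ (W : S → Matrix ρ ρ 𝕜) (R : Finset ρ) (π : ρ → Fin k), KnownMat P K W ∧ R₀ ⊆ R ∧
    (R \ R₀).card ≤ j ∧ ∀ s ∈ P, PanelReduced (W s) (X s) R₀ R π t

namespace PanelState

variable {X : S → Matrix ρ (Fin k) 𝕜}

theorem step (h : PanelState X R₀ t j P K) (hX : KnownMat P K X) (hj : j < b) :
    Reaches (PanelState X R₀ (t + 1) (j + 1)) P K (Fintype.card ρ * (4 * b + 4)) := by
  obtain ⟨W, R, π, hW, hR, hcard, hred⟩ := h
  rcases Nat.lt_or_ge t k with htk | htk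
  swap
  · exact .done ⟨W, R, π, hW, hR, by lia, fun s hs => (hred s hs).succ_of_zero
      fun c hc => absurd c.2 (by lia)⟩
  obtain ⟨c, rfl⟩ : ∃ c : Fin k, (c : ℕ) = t := ⟨⟨t, htk⟩, rfl⟩
  have hN : Fintype.card ρ * (R \ R₀).card ≤ Fintype.card ρ * b :=
    Nat.mul_le_mul_left _ (by lia)
  let v : S → ρ → 𝕜 := fun s i => ((1 + W s) * X s : Matrix ρ _ 𝕜) i c
  refine ((Reaches.column_one_add_mul hW hX (fun s hs => (hred s hs).support) c).bind
    (c' := Fintype.card ρ + Fintype.card ρ * (2 * b + 2)) fun P₁ K₁ hP₁ hK₁ hv => ?_).mono_cost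
      (by lia)
  refine (Reaches.test_zero_family hv).bind fun P₂ K₂ hP₂ hK₂ ⟨Z, hZ⟩ => ?_
  by_cases hpivot : ∃ r ∉ R, r ∉ Z
  swap
  · push Not at hpivot
    refine .done ⟨W, R, π, hW.mono (hP₂.trans hP₁) (hK₁.trans hK₂), hR, by lia, fun s hs =>
      (hred s (hP₁ (hP₂ hs))).succ_of_zero fun c' hc i hi => ?_⟩
    rw [Fin.ext hc]
    exact (hZ s hs i).2 (hpivot i hi)
  obtain ⟨r, hrR, hrZ⟩ := hpivot
  have hvr : ∀ s ∈ P₂, v s r ≠ 0 := fun s hs h0 => hrZ ((hZ s hs r).1 h0)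
  refine ((Reaches.pivotWeight (v := v) (fun i => (hv i).mono hP₂ hK₂) hvr).bind
    (c' := Fintype.card ρ * (2 * (R \ R₀).card)) fun P₃ K₃ hP₃ hK₃ hw => ?_).mono_cost (by lia)
  have hP : P₃ ⊆ P := hP₃.trans (hP₂.trans hP₁)
  refine (Reaches.pivotUpdate (hW.mono hP (hK₁.trans (hK₂.trans hK₃))) hw
    (fun s hs => (hred s (hP hs)).support) fun h => hrR (Finset.mem_sdiff.1 h).1).imp
      fun P₄ K₄ hP₄ _ hW' => ⟨_, insert r R, Function.update π r c, hW',
        hR.trans (Finset.subset_insert _ _), ?_, fun s hs =>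
          (hred s (hP (hP₄ hs))).succ_of_pivot hR hrR (hvr s (hP₃ (hP₄ hs)))⟩
  rw [Finset.insert_sdiff_of_notMem _ fun hr => hrR (hR hr)]
  exact (Finset.card_insert_le _ _).trans (Nat.succ_le_succ hcard)

theorem iterate (h : PanelState X R₀ t 0 P K) (hX : KnownMat P K X) (hj : j ≤ b) :
    Reaches (PanelState X R₀ (t + j) j) P K (j * (Fintype.card ρ * (4 * b + 4))) := by
  induction j with
  | zero => exact .done h
  | succ j ih =>
    rw [Nat.add_mul, Nat.one_mul]
    exact (ih (by lia)).bind fun P' K' hP hK h' => h'.step (hX.mono hP hK) hj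

end PanelState

theorem HasMulTree.reaches_one_add_mul (hmul : HasMulTree 𝕜 b μ) {n : Type*} [Fintype n]
    (hρ : Fintype.card ρ ≤ p * b) (hn : Fintype.card n ≤ p * b) {W : S → Matrix ρ ρ 𝕜}
    {N : Finset ρ} (hN : N.card ≤ b) (hsupp : ∀ s ∈ P, ∀ i, ∀ l ∉ N, W s i l = 0)
    {X : S → Matrix ρ n 𝕜} (hW : KnownMat P K W) (hX : KnownMat P K X) :
    Reaches (fun P' K' => KnownMat P' K' fun s => (1 + W s) * X s) P K
      (p ^ 2 * (μ + b ^ 2) + (p * b) ^ 2) := by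
  have hprod := hmul.reaches_mul (n := N) (p := p) (q := 1) (t := p) hρ (by simpa using hN) hn
    (P := P) (K := K) (X := fun s => (W s).submatrix id Subtype.val)
    (Y := fun s => (X s).submatrix Subtype.val id) (fun i j => hW _ _) fun i j => hX _ _
  have hcost : Fintype.card ρ * Fintype.card n ≤ (p * b) * (p * b) := Nat.mul_le_mul hρ hn
  refine (hprod.bind fun P' K' hP hK h => (Reaches.add_mat (hX.mono hP hK) h).imp
    fun P'' K'' hP' _ h => h.congr fun s hs => ?_).mono_cost (by nlinarith)
  rw [Matrix.add_mul, Matrix.one_mul]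
  congr 1
  ext i j
  rw [Matrix.mul_apply, Matrix.mul_apply]
  refine (Fintype.sum_of_injective (Subtype.val : N → ρ) Subtype.val_injective _ _
    (fun l hl => ?_) fun l => rfl).symm
  rw [hsupp s (hP (hP' hs)) i l (by simpa using hl), zero_mul]

/-- An invertible matrix `V` is known for which `V * Y` is known and reduced up to column `t`; the
pivots are the same for all instances. -/
def EliminationState (Y : S → Matrix ρ (Fin k) 𝕜) (t : ℕ) (P : Set S) (K : Set (S → 𝕜)) : Prop :=
  ∃ (V : S → Matrix ρ ρ 𝕜) (R : Finset ρ) (π : ρ → Fin k),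
    KnownMat P K V ∧ KnownMat P K (fun s => V s * Y s) ∧ ∀ s ∈ P,
      IsUnit (V s) ∧ ReducedUpTo (V s * Y s) R π t

variable {Y : S → Matrix ρ (Fin k) 𝕜}

theorem EliminationState.panel (h : EliminationState Y t P K) (hmul : HasMulTree 𝕜 b μ)
    (hρ : Fintype.card ρ ≤ p * b) (hk : k ≤ p * b) :
    Reaches (EliminationState Y (t + b)) P K
      (b * (p * b * (4 * b + 4)) + 2 * (p ^ 2 * (μ + b ^ 2) + (p * b) ^ 2)) := by
  obtain ⟨V, R₀, π₀, hV, hX, hs⟩ := h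
  have hinit : PanelState (fun s => V s * Y s) R₀ t 0 P K :=
    ⟨fun _ => 0, R₀, π₀, fun _ _ => .const 0, subset_rfl, by simp, fun s hsP =>
      ⟨by simp, fun _ _ _ => rfl, by simpa using (hs s hsP).2⟩⟩
  rw [two_mul]
  refine ((hinit.iterate hX (le_refl b)).mono_cost (by gcongr)).bind
    fun P₁ K₁ hP₁ hK₁ ⟨W, R, π, hW, _, hcard, hW'⟩ => ?_
  refine (hmul.reaches_one_add_mul hρ hρ hcard (fun s hsP => (hW' s hsP).support) hW
    (hV.mono hP₁ hK₁)).bind fun P₂ K₂ hP₂ hK₂ h₂ => ?_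
  refine (hmul.reaches_one_add_mul hρ (by simpa using hk) hcard
    (fun s hsP => (hW' s (hP₂ hsP)).support) (hW.mono hP₂ hK₂)
    ((hX.mono hP₁ hK₁).mono hP₂ hK₂)).imp fun P₃ K₃ hP₃ hK₃ h₃ => ?_
  refine ⟨fun s => (1 + W s) * V s, R, π, h₂.mono hP₃ hK₃,
    h₃.congr fun s _ => Matrix.mul_assoc _ _ _, fun s hsP => ?_⟩
  have hred := hW' s (hP₂ (hP₃ hsP))
  rw [Matrix.mul_assoc]
  exact ⟨hred.isUnit.mul (hs s (hP₁ (hP₂ (hP₃ hsP)))).1, hred.reduced⟩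

theorem HasMulTree.reaches_eliminate (hmul : HasMulTree 𝕜 b μ) (hρ : Fintype.card ρ ≤ p * b)
    (hk : k ≤ p * b) (hk0 : 0 < k) (hY : KnownMat P K Y) :
    Reaches (EliminationState Y (p * b)) P K
      (p * (b * (p * b * (4 * b + 4)) + 2 * (p ^ 2 * (μ + b ^ 2) + (p * b) ^ 2))) := by
  suffices h : ∀ q : ℕ, Reaches (EliminationState Y (q * b)) P K
      (q * (b * (p * b * (4 * b + 4)) + 2 * (p ^ 2 * (μ + b ^ 2) + (p * b) ^ 2))) from h p
  intro q
  induction q with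
  | zero =>
    refine .done ⟨fun _ => 1, ∅, fun _ => ⟨0, hk0⟩, fun i j => .const _, ?_, fun s _ =>
      ⟨isUnit_one, by constructor <;> simp⟩⟩
    simpa only [Matrix.one_mul] using hY
  | succ q ih =>
    rw [Nat.add_mul, Nat.one_mul, Nat.add_mul, Nat.one_mul]
    exact ih.bind fun P' K' _ _ h => h.panel hmul hρ hk

end Elimination

/-! ### Reduction of a matrix with known pivots -/

section Echelon

variable {𝕜 C J : Type*} [Field 𝕜] {r : ℕ} {σ : Fin r → Option J}

theorem exists_row_order [LinearOrder C] [Fintype J] {piv : J → C} (hpiv : piv.Injective)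
    (hr : Fintype.card J ≤ r) :
    ∃ σ : Fin r → Option J, (∀ j, ∃ i, σ i = some j) ∧
      ∀ i i' j', i < i' → σ i' = some j' → ∃ j, σ i = some j ∧ piv j < piv j' := by
  let _ : LinearOrder J := LinearOrder.lift' piv hpiv
  let iso : Fin (Fintype.card J) ≃o J := Fintype.orderIsoFinOfCardEq J rfl
  refine ⟨fun i => if h : (i : ℕ) < Fintype.card J then some (iso ⟨i, h⟩) else none,
    fun j => ⟨⟨iso.symm j, (iso.symm j).2.trans_le hr⟩, by simp⟩, fun i i' j' hi h => ?_⟩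
  by_cases hi' : (i' : ℕ) < Fintype.card J
  · simp only [dif_pos hi', Option.some.injEq] at h
    refine ⟨iso ⟨i, (Fin.lt_def.1 hi).trans hi'⟩, dif_pos _, ?_⟩
    rw [← h]
    exact iso.strictMono (Fin.lt_def.1 hi)
  · simp [dif_neg hi'] at h

/-- The matrix with the rows `w j`, arranged according to `σ` and filled up by zero rows. -/
def listRows (σ : Fin r → Option J) (w : J → C → 𝕜) : Matrix (Fin r) C 𝕜 :=
  Matrix.of fun i c => (σ i).elim 0 fun j => w j c

theorem listRows_of_eq_some {i : Fin r} {j : J} (h : σ i = some j) (w : J → C → 𝕜) :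
    listRows σ w i = w j := by
  funext c
  simp [listRows, h]

theorem listRows_of_eq_none {i : Fin r} (h : σ i = none) (w : J → C → 𝕜) :
    listRows σ w i = 0 := by
  funext c
  simp [listRows, h]

theorem span_range_listRows (hσ : ∀ j, ∃ i, σ i = some j) (w : J → C → 𝕜) :
    Submodule.span 𝕜 (Set.range (listRows σ w)) = Submodule.span 𝕜 (Set.range w) := by
  refine le_antisymm (Submodule.span_le.2 ?_) (Submodule.span_mono ?_)
  · rintro _ ⟨i, rfl⟩
    rcases h : σ i with _ | j
    · rw [listRows_of_eq_none h]
      exact Submodule.zero_mem _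
    · rw [listRows_of_eq_some h]
      exact Submodule.subset_span (Set.mem_range_self j)
  · rintro _ ⟨j, rfl⟩
    obtain ⟨i, hi⟩ := hσ j
    exact ⟨i, listRows_of_eq_some hi w⟩

/-- The rows `w` form the unit matrix in the columns `piv` and vanish to the left of them. -/
structure HasPivots [LT C] (w : J → C → 𝕜) (piv : J → C) : Prop where
  one : ∀ j, w j (piv j) = 1
  zero : ∀ j j', j ≠ j' → w j (piv j') = 0
  left : ∀ j, ∀ c < piv j, w j c = 0

variable {w : J → C → 𝕜} {piv : J → C}

theorem HasPivots.injective [LT C] (h : HasPivots w piv) : piv.Injective := by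
  intro j j' hj
  by_contra hne
  have hzero := h.zero j j' hne
  rw [← hj, h.one] at hzero
  exact one_ne_zero hzero

theorem HasPivots.isReducedRowEchelon [LinearOrder C] (h : HasPivots w piv)
    (hσ : ∀ i i' j', i < i' → σ i' = some j' → ∃ j, σ i = some j ∧ piv j < piv j') :
    (listRows σ w).IsReducedRowEchelon := by
  have hpivot : ∀ {i j}, σ i = some j → (listRows σ w).IsLeadingEntry i (piv j) := by
    intro i j hi
    refine ⟨fun c hc => ?_, ?_⟩ <;> rw [listRows_of_eq_some hi]
    · exact h.left j c hc
    · rw [h.one]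
      exact one_ne_zero
  have hlead : ∀ {i c}, (listRows σ w).IsLeadingEntry i c → ∃ j, σ i = some j ∧ c = piv j := by
    intro i c hc
    rcases hi : σ i with _ | j
    · exact absurd (listRows_of_eq_none hi w) hc.row_ne_zero
    · exact ⟨j, rfl, hc.unique (hpivot hi)⟩
  constructor
  · intro i₁ i₂ hi c hc
    rcases hi₂ : σ i₂ with _ | j₂
    · rw [listRows_of_eq_none hi₂, Pi.zero_apply]
    · obtain ⟨j₁, hi₁, hlt⟩ := hσ i₁ i₂ j₂ hi hi₂
      have hle : c ≤ piv j₁ := not_lt.1 fun hlt => (hpivot hi₁).2 (hc _ hlt)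
      rw [listRows_of_eq_some hi₂, h.left j₂ c (hle.trans_lt hlt)]
  · intro i c hc
    obtain ⟨j, hi, rfl⟩ := hlead hc
    rw [listRows_of_eq_some hi, h.one]
  · intro i₁ i₂ c hi hc
    obtain ⟨j₂, hi₂, rfl⟩ := hlead hc
    obtain ⟨j₁, hi₁, hlt⟩ := hσ i₁ i₂ j₂ hi hi₂
    rw [listRows_of_eq_some hi₁, h.zero j₁ j₂ fun hj => hlt.ne (congrArg piv hj)]

end Echelon

section BlockReduction

variable {𝕜 C : Type*} [Field 𝕜]

/-- The columns of level at most `a`. -/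
abbrev Low (lev : C → ℕ) (a : ℕ) : Type _ := {c // lev c ≤ a}

/-- The columns of level `a`. -/
abbrev AtLevel (lev : C → ℕ) (a : ℕ) : Type _ := {c // lev c = a}

/-- The columns of level above `a`. -/
abbrev High (lev : C → ℕ) (a : ℕ) : Type _ := {c // a < lev c}

/-- The rows that have not been chosen as pivot rows. -/
abbrev RestRow {lev : C → ℕ} {a r : ℕ} (p : Low lev a → Fin r) : Type := {i // i ∉ Set.range p}

variable {lev : C → ℕ} {a r : ℕ}

/-- The column `ℓ` is a pivot of the row `x`: apart from `ℓ`, the row is supported in columns of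
level at least `a`, and of level above `a` if `ℓ` has level `a`. -/
def IsPivot (lev : C → ℕ) (a : ℕ) (x : C → 𝕜) (ℓ : C) : Prop :=
  x ℓ = 1 ∧ ∀ c, c ≠ ℓ → x c ≠ 0 → a ≤ lev c ∧ (lev ℓ = a → a < lev c)

theorem IsPivot.apply_ne_zero {x : C → 𝕜} {ℓ : C} (h : IsPivot lev a x ℓ) : x ℓ ≠ 0 := by
  rw [h.1]
  exact one_ne_zero

theorem IsPivot.eq_of_support_eq {x x' : C → 𝕜} {ℓ ℓ' : C} (h : IsPivot lev a x ℓ)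
    (h' : IsPivot lev a x' ℓ') (hℓ : lev ℓ ≤ a) (hℓ' : lev ℓ' ≤ a)
    (hx : ∀ c, x c = 0 ↔ x' c = 0) : ℓ = ℓ' := by
  by_contra hne
  have h₁ := h.2 ℓ' (Ne.symm hne) (mt (hx ℓ').1 h'.apply_ne_zero)
  have h₂ := h'.2 ℓ hne (mt (hx ℓ).2 h.apply_ne_zero)
  exact (h₁.2 (hℓ.antisymm h₂.1)).not_ge hℓ'

theorem IsPivot.apply_eq_single [DecidableEq C] {x : C → 𝕜} {ℓ c : C} (h : IsPivot lev a x ℓ)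
    (hc : lev c ≤ a) (hlt : lev ℓ = a ∨ lev c < a) : x c = (Pi.single ℓ 1 : C → 𝕜) c := by
  rcases eq_or_ne c ℓ with rfl | hne
  · rw [h.1, Pi.single_eq_same]
  · rw [Pi.single_eq_of_ne hne]
    by_contra h0
    have hlev := h.2 c hne h0
    lia

/-- Extension of vectors by zero to the columns of level at most `a`. -/
def extendHigh : (High lev a → 𝕜) →ₗ[𝕜] (C → 𝕜) :=
  Function.ExtendByZero.linearMap 𝕜 Subtype.val

theorem extendHigh_high (x : High lev a → 𝕜) (g : High lev a) : extendHigh x g = x g :=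
  Subtype.val_injective.extend_apply x 0 g

theorem extendHigh_low (x : High lev a → 𝕜) {c : C} (hc : lev c ≤ a) : extendHigh x c = 0 :=
  Function.extend_apply' x (0 : C → 𝕜) c (by rintro ⟨g, rfl⟩; exact g.2.not_ge hc)

theorem extendHigh_mul_row {m n : Type*} [Fintype n] (X : Matrix m n 𝕜)
    (Y : Matrix n (High lev a) 𝕜) (i : m) :
    extendHigh ((X * Y) i) = ∑ j, X i j • extendHigh (Y j) := by
  rw [Matrix.mul_apply_eq_vecMul, Matrix.vecMul_eq_sum, map_sum]
  simp only [map_smul]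

theorem High.ne_low (g : High lev a) (c : Low lev a) : (g : C) ≠ c :=
  fun h => (h ▸ g.2).not_ge c.2

variable [Fintype C] (p : Low lev a → Fin r) (A : Matrix (Fin r) C 𝕜)

/-- The entries of the pivot rows in the columns of level `a`, apart from the pivots. -/
def midBlock : Matrix (Low lev a) (AtLevel lev a) 𝕜 :=
  Matrix.of fun c m => if lev c < a then A (p c) m else 0

/-- The pivot rows, reduced by each other, in the columns of level above `a`. -/
def pivotBlock : Matrix (Low lev a) (High lev a) 𝕜 :=
  (Matrix.of fun c (g : High lev a) => A (p c) g) -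
    midBlock p A * Matrix.of fun (m : AtLevel lev a) (g : High lev a) => A (p ⟨m, m.2.le⟩) g

/-- The other rows, reduced by the pivot rows, in the columns of level above `a`. -/
def restBlock : Matrix (RestRow p) (High lev a) 𝕜 :=
  (Matrix.of fun (i : RestRow p) (g : High lev a) => A i g) -
    (Matrix.of fun (i : RestRow p) (c : Low lev a) => A i c) * pivotBlock p A

variable {p A} in
theorem sum_midBlock_mul (hp : ∀ c, IsPivot lev a (A (p c)) c) (c : Low lev a) {x : C}
    (hx : lev x ≤ a) :
    ∑ m : AtLevel lev a, midBlock p A c m * A (p ⟨m, m.2.le⟩) x =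
      if lev c < a ∧ lev x = a then A (p c) x else 0 := by
  classical
  simp only [fun m : AtLevel lev a => (hp ⟨m, m.2.le⟩).apply_eq_single hx (.inl m.2)]
  by_cases hxa : lev x = a
  · rw [Finset.sum_eq_single ⟨x, hxa⟩ (fun m _ hm => by
      rw [Pi.single_eq_of_ne fun h => hm (Subtype.ext h.symm), mul_zero]) (by simp)]
    simp [midBlock, hxa]
  · rw [Finset.sum_eq_zero fun m _ => by
      rw [Pi.single_eq_of_ne (by rintro rfl; exact hxa m.2), mul_zero]]
    rw [if_neg fun h => hxa h.2]

variable [DecidableEq C]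

/-- The reduced pivot row with pivot `c`. -/
def pivotRow (c : Low lev a) : C → 𝕜 :=
  Pi.single (c : C) 1 + extendHigh (pivotBlock p A c)

/-- The reduced pivot rows, followed by the other rows reduced by the pivot rows. -/
def reducedRow : Low lev a ⊕ RestRow p → C → 𝕜 :=
  Sum.elim (pivotRow p A) fun i => extendHigh (restBlock p A i)

variable {p A}

theorem pivotRow_high (c : Low lev a) (g : High lev a) :
    pivotRow p A c g = pivotBlock p A c g := by
  rw [pivotRow, Pi.add_apply, Pi.single_eq_of_ne (g.ne_low c), zero_add, extendHigh_high]

theorem pivotRow_low (c : Low lev a) {x : C} (hx : lev x ≤ a) :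
    pivotRow p A c x = (Pi.single (c : C) 1 : C → 𝕜) x := by
  rw [pivotRow, Pi.add_apply, extendHigh_low _ hx, add_zero]

theorem pivotRow_eq (hp : ∀ c, IsPivot lev a (A (p c)) c) (c : Low lev a) :
    pivotRow p A c = A (p c) - ∑ m : AtLevel lev a, midBlock p A c m • A (p ⟨m, m.2.le⟩) := by
  funext x
  simp only [Pi.sub_apply, Finset.sum_apply, Pi.smul_apply, smul_eq_mul]
  rcases lt_or_ge a (lev x) with hx | hx
  · rw [pivotRow_high c ⟨x, hx⟩]
    simp only [pivotBlock, Matrix.sub_apply, Matrix.mul_apply, Matrix.of_apply]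
  · rw [pivotRow_low c hx, sum_midBlock_mul hp c hx]
    split_ifs with h
    · rw [sub_self, Pi.single_eq_of_ne fun hxc => (hxc ▸ h.1).ne h.2]
    · rw [sub_zero, (hp c).apply_eq_single hx (by have := c.2; lia)]

theorem extendHigh_restBlock (i : RestRow p) :
    extendHigh (restBlock p A i) = A i - ∑ c : Low lev a, A i c • pivotRow p A c := by
  funext x
  simp only [Pi.sub_apply, Finset.sum_apply, Pi.smul_apply, smul_eq_mul]
  rcases lt_or_ge a (lev x) with hx | hx
  · rw [extendHigh_high _ ⟨x, hx⟩]
    simp only [restBlock, Matrix.sub_apply, Matrix.mul_apply, Matrix.of_apply,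
      fun c => pivotRow_high (p := p) (A := A) c ⟨x, hx⟩]
  · rw [extendHigh_low _ hx, Finset.sum_eq_single ⟨x, hx⟩]
    · rw [pivotRow_low _ hx, Pi.single_eq_same, mul_one, sub_self]
    · intro c _ hc
      rw [pivotRow_low _ hx, Pi.single_eq_of_ne fun h => hc (Subtype.ext h.symm), mul_zero]
    · simp

theorem pivotRow_mem_span (hp : ∀ c, IsPivot lev a (A (p c)) c) (c : Low lev a) :
    pivotRow p A c ∈ Submodule.span 𝕜 (Set.range A) := by
  rw [pivotRow_eq hp]
  exact sub_mem (Submodule.subset_span ⟨_, rfl⟩) (sum_mem fun m _ =>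
    Submodule.smul_mem _ _ (Submodule.subset_span ⟨_, rfl⟩))

theorem row_mem_span_reducedRow (hp : ∀ c, IsPivot lev a (A (p c)) c) (i : Fin r) :
    A i ∈ Submodule.span 𝕜 (Set.range (reducedRow p A)) := by
  have hrow : ∀ c, pivotRow p A c ∈ Submodule.span 𝕜 (Set.range (reducedRow p A)) := fun c =>
    Submodule.subset_span ⟨.inl c, rfl⟩
  by_cases hi : i ∈ Set.range p
  · obtain ⟨c, rfl⟩ := hi
    have hmid : ∀ m : AtLevel lev a, A (p ⟨m, m.2.le⟩) = pivotRow p A ⟨m, m.2.le⟩ := fun m => by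
      rw [pivotRow_eq hp]
      simp [midBlock, m.2]
    refine (eq_sub_iff_add_eq.1 (pivotRow_eq hp c)).subst (motive := (· ∈ _)) ?_
    exact add_mem (hrow c) (sum_mem fun m _ => Submodule.smul_mem _ _ (hmid m ▸ hrow _))
  · refine (eq_sub_iff_add_eq.1 (extendHigh_restBlock ⟨i, hi⟩)).subst (motive := (· ∈ _)) ?_
    exact add_mem (Submodule.subset_span ⟨.inr ⟨i, hi⟩, rfl⟩) (sum_mem fun c _ =>
      Submodule.smul_mem _ _ (hrow c))

theorem span_reducedRow (hp : ∀ c, IsPivot lev a (A (p c)) c) :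
    Submodule.span 𝕜 (Set.range (reducedRow p A)) = Submodule.span 𝕜 (Set.range A) := by
  refine le_antisymm (Submodule.span_le.2 ?_) (Submodule.span_le.2 ?_)
  · rintro _ ⟨c | i, rfl⟩
    · exact pivotRow_mem_span hp c
    · rw [reducedRow, Sum.elim_inr, extendHigh_restBlock]
      exact sub_mem (Submodule.subset_span ⟨_, rfl⟩) (sum_mem fun c _ =>
        Submodule.smul_mem _ _ (pivotRow_mem_span hp c))
  · rintro _ ⟨i, rfl⟩
    exact row_mem_span_reducedRow hp i

end BlockReduction

section PivotRows

variable {𝕜 C : Type*} [Field 𝕜] {lev : C → ℕ} {a r k : ℕ}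

/-- The properties of the matrix built by the algorithm that its reduction relies on: each row has
a pivot of level at most `a`, each column of level at most `a` is a pivot of some row, and a vector
of the row space is determined by its entries of level at most `a + 1`. -/
structure IsNearEchelon (lev : C → ℕ) (a : ℕ) (A : Matrix (Fin r) C 𝕜) : Prop where
  shape : ∀ i, ∃ ℓ, lev ℓ ≤ a ∧ IsPivot lev a (A i) ℓ
  cover : ∀ ℓ, lev ℓ ≤ a → ∃ i, IsPivot lev a (A i) ℓ
  null : ∀ v ∈ Submodule.span 𝕜 (Set.range A), (∀ c, lev c ≤ a + 1 → v c = 0) → v = 0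

variable {P : Set (Matrix (Fin r) C 𝕜)} {K : Set (Matrix (Fin r) C 𝕜 → 𝕜)}
  {p : Low lev a → Fin r} {u v w μ : ℕ}

theorem exists_pivotRows {Z : Set (Fin r × C)} (hP : ∀ A ∈ P, IsNearEchelon lev a A)
    (hZ : ∀ A ∈ P, ∀ j : Fin r × C, A j.1 j.2 = 0 ↔ j ∈ Z) (hne : P.Nonempty) :
    ∃ p : Low lev a → Fin r, p.Injective ∧ ∀ A ∈ P, ∀ c, IsPivot lev a (A (p c)) c := by
  obtain ⟨A₀, hA₀⟩ := hne
  choose p hp₀ using fun c : Low lev a => (hP A₀ hA₀).cover c c.2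
  refine ⟨p, fun c c' h => Subtype.ext ((hp₀ c).eq_of_support_eq (hp₀ c') c.2 c'.2 fun x => ?_),
    fun A hA c => ?_⟩
  · rw [h]
  · obtain ⟨ℓ, hℓ, hpiv⟩ := (hP A hA).shape (p c)
    have hsupp : ∀ x, A (p c) x = 0 ↔ A₀ (p c) x = 0 := fun x =>
      (hZ A hA (p c, x)).trans (hZ A₀ hA₀ (p c, x)).symm
    exact hpiv.eq_of_support_eq (hp₀ c) hℓ c.2 hsupp ▸ hpiv

variable [Fintype C]

theorem card_restRow (hp : p.Injective) :
    Fintype.card (RestRow p) + Fintype.card (Low lev a) = r := by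
  have hcompl := Fintype.card_compl_set (Set.range p)
  have hrange := Set.card_range_of_injective hp
  have hle := Fintype.card_le_of_injective p hp
  rw [Fintype.card_fin] at hcompl hle
  change Fintype.card (RestRow p) = _ at hcompl
  lia

namespace Reaches

theorem pivotRows (hP : ∀ A ∈ P, IsNearEchelon lev a A)
    (hA : KnownMat P K fun A : Matrix (Fin r) C 𝕜 => A) :
    Reaches (fun P' _ => ∃ p : Low lev a → Fin r, p.Injective ∧
      ∀ A ∈ P', ∀ c : Low lev a, IsPivot lev a (A (p c)) c) P K (r * Fintype.card C) := by
  have htest := test_zero_family fun j : Fin r × C => hA j.1 j.2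
  rw [Fintype.card_prod, Fintype.card_fin] at htest
  refine htest.bind (c' := 0) fun P₁ K₁ hP₁ _ ⟨Z, hZ⟩ => ?_
  rcases P₁.eq_empty_or_nonempty with rfl | hne
  · exact .empty
  · exact .done (exists_pivotRows (fun A hAP => hP A (hP₁ hAP)) hZ hne)

theorem pivotBlock (hμ : HasMulTree 𝕜 k μ) (hlow : Fintype.card (Low lev a) ≤ u * k)
    (hmid : Fintype.card (AtLevel lev a) ≤ w * k) (hhigh : Fintype.card (High lev a) ≤ v * k)
    (hA : KnownMat P K fun A : Matrix (Fin r) C 𝕜 => A) :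
    Reaches (fun P' K' => KnownMat P' K' (DetGB.pivotBlock p)) P K
      (u * w * v * (μ + k ^ 2) + (u * k) * (v * k)) := by
  have hmul := hμ.reaches_mul (P := P) (K := K) (X := midBlock p)
    (Y := fun A => Matrix.of fun (m : AtLevel lev a) (g : High lev a) => A (p ⟨m, m.2.le⟩) g)
    hlow hmid hhigh (fun c m => ?_) fun m g => hA _ _
  · exact (hmul.bind fun P' K' hP' hK' h => sub_mat (X := fun A : Matrix (Fin r) C 𝕜 =>
      Matrix.of fun (c : Low lev a) (g : High lev a) => A (p c) g)
        (fun c g => (hA _ _).mono hP' hK') h).mono_cost (by gcongr)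
  · by_cases hc : lev c < a
    · simpa only [midBlock, Matrix.of_apply, if_pos hc] using hA _ _
    · simpa only [midBlock, Matrix.of_apply, if_neg hc] using Known.const 0

theorem restBlock (hμ : HasMulTree 𝕜 k μ) (hrest : Fintype.card (RestRow p) ≤ k)
    (hlow : Fintype.card (Low lev a) ≤ u * k) (hhigh : Fintype.card (High lev a) ≤ v * k)
    (hA : KnownMat P K fun A : Matrix (Fin r) C 𝕜 => A)
    (hpivot : KnownMat P K (DetGB.pivotBlock p)) :
    Reaches (fun P' K' => KnownMat P' K' (DetGB.restBlock p)) P K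
      (u * v * (μ + k ^ 2) + k * (v * k)) := by
  have hmul := hμ.reaches_mul (p := 1) (P := P) (K := K)
    (X := fun A => Matrix.of fun (i : RestRow p) (c : Low lev a) => A i c)
    (by simpa using hrest) hlow hhigh (fun i c => hA _ _) hpivot
  rw [Nat.one_mul] at hmul
  exact (hmul.bind fun P' K' hP' hK' h => sub_mat (X := fun A : Matrix (Fin r) C 𝕜 =>
    Matrix.of fun (i : RestRow p) (g : High lev a) => A i g)
      (fun c g => (hA _ _).mono hP' hK') h).mono_cost (by gcongr)

end Reaches

end PivotRows

section Assembly

variable {𝕜 C : Type*} [Field 𝕜] [LinearOrder C] {lev : C → ℕ} {a r k t : ℕ}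

/-- The columns of level `a + 1`, as columns of level above `a`. -/
def nextHigh (o : Fin k ≃o AtLevel lev (a + 1)) (j : Fin k) : High lev a :=
  ⟨o j, (o j).2.ge⟩

theorem exists_nextHigh_eq (o : Fin k ≃o AtLevel lev (a + 1)) (g : High lev a)
    (hg : lev g = a + 1) : ∃ j, nextHigh o j = g :=
  ⟨o.symm ⟨g, hg⟩, Subtype.ext (by simp [nextHigh])⟩

variable [Fintype C]

section FinalRows

variable (p : Low lev a → Fin r) (o : Fin k ≃o AtLevel lev (a + 1)) (R : Finset (RestRow p))
  (π : RestRow p → Fin k) (A : Matrix (Fin r) C 𝕜) (V : Matrix (RestRow p) (RestRow p) 𝕜)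

/-- The other rows, reduced by the pivot rows, in the columns of level `a + 1`. -/
def nextBlock : Matrix (RestRow p) (Fin k) 𝕜 :=
  (restBlock p A).submatrix id (nextHigh o)

/-- The pivot columns of the reduced row echelon form. -/
def finalPivot : Low lev a ⊕ R → C :=
  Sum.elim (fun c => c) fun i => nextHigh o (π i)

/-- The coefficients of the reduced pivot rows at the remaining pivots. -/
def backBlock : Matrix (Low lev a) (RestRow p) 𝕜 :=
  (pivotBlock p A).submatrix id fun i => nextHigh o (π i)

/-- The pivot rows in the columns of level above `a`, after back substitution. -/
def clearedBlock : Matrix (Low lev a) (High lev a) 𝕜 :=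
  pivotBlock p A - backBlock p o π A * (V * restBlock p A)

/-- The nonzero rows of the reduced row echelon form. -/
def finalRow : Low lev a ⊕ R → C → 𝕜 :=
  Sum.elim (fun c => Pi.single (c : C) 1 + extendHigh (clearedBlock p o π A V c))
    fun i => extendHigh ((V * restBlock p A) i)

variable {p o R π A V}

theorem finalRow_inl_low (c : Low lev a) {x : C} (hx : lev x ≤ a) :
    finalRow p o R π A V (.inl c) x = (Pi.single (c : C) 1 : C → 𝕜) x := by
  rw [finalRow, Sum.elim_inl, Pi.add_apply, extendHigh_low _ hx, add_zero]

theorem finalRow_inl_high (c : Low lev a) (g : High lev a) :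
    finalRow p o R π A V (.inl c) g = clearedBlock p o π A V c g := by
  rw [finalRow, Sum.elim_inl, Pi.add_apply, Pi.single_eq_of_ne (g.ne_low c), zero_add,
    extendHigh_high]

theorem finalRow_inr_low (i : R) {x : C} (hx : lev x ≤ a) :
    finalRow p o R π A V (.inr i) x = 0 :=
  extendHigh_low _ hx

theorem finalRow_inr_high (i : R) (g : High lev a) :
    finalRow p o R π A V (.inr i) g = (V * restBlock p A : Matrix _ _ 𝕜) i g :=
  extendHigh_high _ g

theorem finalRow_inl (c : Low lev a) : finalRow p o R π A V (.inl c) =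
    pivotRow p A c - ∑ i, backBlock p o π A c i • extendHigh ((V * restBlock p A) i) := by
  rw [← extendHigh_mul_row, pivotRow, add_sub_assoc, ← map_sub]
  rfl

theorem extendHigh_mul_restBlock_mem_span (hp : ∀ c, IsPivot lev a (A (p c)) c) (i : RestRow p) :
    extendHigh ((V * restBlock p A) i) ∈ Submodule.span 𝕜 (Set.range A) := by
  rw [extendHigh_mul_row, ← span_reducedRow hp]
  exact sum_mem fun j _ => Submodule.smul_mem _ _ (Submodule.subset_span ⟨.inr j, rfl⟩)

theorem IsNearEchelon.extendHigh_eq_zero (hA : IsNearEchelon lev a A)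
    (hp : ∀ c, IsPivot lev a (A (p c)) c) (ht : k ≤ t)
    (hred : ReducedUpTo (V * nextBlock p o A) R π t) {i : RestRow p} (hi : i ∉ R) :
    extendHigh ((V * restBlock p A) i) = 0 := by
  refine hA.null _ (extendHigh_mul_restBlock_mem_span hp i) fun c hc => ?_
  rcases lt_or_ge a (lev c) with hac | hac
  · obtain ⟨j, hj⟩ := exists_nextHigh_eq o ⟨c, hac⟩ (hc.antisymm hac)
    rw [extendHigh_high _ ⟨c, hac⟩, ← hj]
    exact hred.zero i hi j (j.2.trans_le ht)
  · exact extendHigh_low _ hac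

theorem IsNearEchelon.span_finalRow (hA : IsNearEchelon lev a A)
    (hp : ∀ c, IsPivot lev a (A (p c)) c) (ht : k ≤ t) (hV : IsUnit V)
    (hred : ReducedUpTo (V * nextBlock p o A) R π t) :
    Submodule.span 𝕜 (Set.range (finalRow p o R π A V)) = Submodule.span 𝕜 (Set.range A) := by
  refine le_antisymm (Submodule.span_le.2 ?_) ?_
  · rintro _ ⟨c | i, rfl⟩
    · rw [finalRow_inl]
      exact sub_mem (pivotRow_mem_span hp c) (sum_mem fun i _ =>
        Submodule.smul_mem _ _ (extendHigh_mul_restBlock_mem_span hp i))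
    · exact extendHigh_mul_restBlock_mem_span hp i.1
  · have hrow : ∀ i, extendHigh ((V * restBlock p A) i) ∈
        Submodule.span 𝕜 (Set.range (finalRow p o R π A V)) := fun i => by
      by_cases hi : i ∈ R
      · exact Submodule.subset_span ⟨.inr ⟨i, hi⟩, rfl⟩
      · rw [hA.extendHigh_eq_zero hp ht hred hi]
        exact zero_mem _
    rw [← span_reducedRow hp, Submodule.span_le]
    rintro _ ⟨c | i, rfl⟩
    · rw [reducedRow, Sum.elim_inl, ← eq_sub_iff_add_eq.1 (finalRow_inl (R := R) (V := V) c)]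
      exact add_mem (Submodule.subset_span ⟨.inl c, rfl⟩)
        (sum_mem fun i _ => Submodule.smul_mem _ _ (hrow i))
    · obtain ⟨U, rfl⟩ := hV
      have hinv : restBlock p A = U.inv * (U.val * restBlock p A) := by
        rw [← Matrix.mul_assoc, U.inv_val, Matrix.one_mul]
      rw [reducedRow, Sum.elim_inr, hinv, extendHigh_mul_row]
      exact sum_mem fun j _ => Submodule.smul_mem _ _ (hrow j)

theorem mul_restBlock_pivot (hred : ReducedUpTo (V * nextBlock p o A) R π t) {i : RestRow p}
    (hi : i ∈ R) (j : RestRow p) :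
    (V * restBlock p A : Matrix _ _ 𝕜) j (nextHigh o (π i)) = if j = i then 1 else 0 :=
  hred.pivot i hi j

theorem clearedBlock_pivot (hred : ReducedUpTo (V * nextBlock p o A) R π t) (c : Low lev a)
    (i : R) : clearedBlock p o π A V c (nextHigh o (π i)) = 0 := by
  rw [clearedBlock, Matrix.sub_apply, Matrix.mul_apply]
  simp only [mul_restBlock_pivot hred i.2, mul_ite, mul_one, mul_zero, Finset.sum_ite_eq',
    Finset.mem_univ, if_true]
  exact sub_self _

theorem mul_restBlock_left (hlev : Monotone lev)
    (hred : ReducedUpTo (V * nextBlock p o A) R π t) (i : R) {g : High lev a}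
    (hg : (g : C) < nextHigh o (π i)) : (V * restBlock p A : Matrix _ _ 𝕜) i g = 0 := by
  obtain ⟨j, rfl⟩ :=
    exists_nextHigh_eq o g (((hlev hg.le).trans (o (π i)).2.le).antisymm g.2)
  exact hred.left i i.2 j (o.lt_iff_lt.1 hg)

theorem hasPivots_finalRow (hlev : Monotone lev)
    (hred : ReducedUpTo (V * nextBlock p o A) R π t) :
    HasPivots (finalRow p o R π A V) (finalPivot p o R π) where
  one
    | .inl c => by rw [finalPivot, Sum.elim_inl, finalRow_inl_low c c.2, Pi.single_eq_same]
    | .inr i => by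
      rw [finalPivot, Sum.elim_inr, finalRow_inr_high, mul_restBlock_pivot hred i.2, if_pos rfl]
  zero
    | .inl c, .inl c', h => by
      rw [finalPivot, Sum.elim_inl, finalRow_inl_low c c'.2,
        Pi.single_eq_of_ne fun h' => h (congrArg _ (Subtype.ext h'.symm))]
    | .inl c, .inr i, _ => by
      rw [finalPivot, Sum.elim_inr, finalRow_inl_high, clearedBlock_pivot hred]
    | .inr i, .inl c, _ => by rw [finalPivot, Sum.elim_inl, finalRow_inr_low i c.2]
    | .inr i, .inr i', h => by
      rw [finalPivot, Sum.elim_inr, finalRow_inr_high, mul_restBlock_pivot hred i'.2,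
        if_neg fun h' => h (congrArg _ (Subtype.ext h'))]
  left
    | .inl c', c, hc => by
      have hlt : c < (c' : C) := hc
      rw [finalRow_inl_low c' ((hlev hlt.le).trans c'.2), Pi.single_eq_of_ne hlt.ne]
    | .inr i, c, hc => by
      rcases lt_or_ge a (lev c) with hac | hac
      · rw [finalRow_inr_high i ⟨c, hac⟩, mul_restBlock_left hlev hred i hc]
      · exact finalRow_inr_low i hac

end FinalRows

section Trees

variable {P : Set (Matrix (Fin r) C 𝕜)} {K : Set (Matrix (Fin r) C 𝕜 → 𝕜)}
  {p : Low lev a → Fin r} {o : Fin k ≃o AtLevel lev (a + 1)} {u v w μ : ℕ}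

namespace Reaches

theorem clearedBlock {π : RestRow p → Fin k}
    {V : Matrix (Fin r) C 𝕜 → Matrix (RestRow p) (RestRow p) 𝕜} (hμ : HasMulTree 𝕜 k μ)
    (hrest : Fintype.card (RestRow p) ≤ k) (hlow : Fintype.card (Low lev a) ≤ u * k)
    (hhigh : Fintype.card (High lev a) ≤ v * k) (hpivot : KnownMat P K (DetGB.pivotBlock p))
    (hV : KnownMat P K fun A => V A * DetGB.restBlock p A) :
    Reaches (fun P' K' => KnownMat P' K' fun A => DetGB.clearedBlock p o π A (V A)) P K
      (u * v * (μ + k ^ 2) + (u * k) * (v * k)) := by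
  have hmul := hμ.reaches_mul (q := 1) (P := P) (K := K) (X := backBlock p o π)
    hlow (by simpa using hrest) hhigh (fun c i => hpivot _ _) hV
  rw [Nat.mul_one] at hmul
  exact (hmul.bind fun P' K' hP' hK' h => sub_mat (hpivot.mono hP' hK') h).mono_cost (by gcongr)

end Reaches

theorem known_finalRow {R : Finset (RestRow p)} {π : RestRow p → Fin k}
    {V : Matrix (Fin r) C 𝕜 → Matrix (RestRow p) (RestRow p) 𝕜}
    (hcleared : KnownMat P K fun A => clearedBlock p o π A (V A))
    (hV : KnownMat P K fun A => V A * restBlock p A) (j : Low lev a ⊕ R) (c : C) :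
    Known P K fun A => finalRow p o R π A (V A) j c := by
  rcases lt_or_ge a (lev c) with hac | hac <;> rcases j with c' | i
  · exact (hcleared c' ⟨c, hac⟩).congr fun A _ => finalRow_inl_high c' ⟨c, hac⟩
  · exact (hV i ⟨c, hac⟩).congr fun A _ => finalRow_inr_high i ⟨c, hac⟩
  · exact (Known.const _).congr fun A _ => finalRow_inl_low c' hac
  · exact (Known.const _).congr fun A _ => finalRow_inr_low i hac

/-- A reduced row echelon form of the matrix is known. -/
def EchelonState (P : Set (Matrix (Fin r) C 𝕜)) (K : Set (Matrix (Fin r) C 𝕜 → 𝕜)) : Prop :=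
  ∃ E : Matrix (Fin r) C 𝕜 → Matrix (Fin r) C 𝕜, KnownMat P K E ∧ ∀ A ∈ P,
    (E A).IsReducedRowEchelon ∧
      Submodule.span 𝕜 (Set.range (E A)) = Submodule.span 𝕜 (Set.range A)

theorem echelonState_of_finalRow (hlev : Monotone lev) (hP : ∀ A ∈ P, IsNearEchelon lev a A)
    (hpinj : p.Injective) (hp : ∀ A ∈ P, ∀ c, IsPivot lev a (A (p c)) c) (ht : k ≤ t)
    {R : Finset (RestRow p)} {π : RestRow p → Fin k}
    {V : Matrix (Fin r) C 𝕜 → Matrix (RestRow p) (RestRow p) 𝕜}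
    (hV : ∀ A ∈ P, IsUnit (V A) ∧ ReducedUpTo (V A * nextBlock p o A) R π t)
    (hknown : ∀ j c, Known P K fun A => finalRow p o R π A (V A) j c) (hne : P.Nonempty) :
    EchelonState P K := by
  obtain ⟨A₀, hA₀⟩ := hne
  have hpivots : ∀ A ∈ P, HasPivots (finalRow p o R π A (V A)) (finalPivot p o R π) :=
    fun A hA => hasPivots_finalRow hlev (hV A hA).2
  have hcard : Fintype.card (Low lev a ⊕ R) ≤ r := by
    have hR := Finset.card_le_univ R
    have hrest := card_restRow hpinj
    rw [Fintype.card_sum, Fintype.card_coe]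
    lia
  obtain ⟨σ, hσ, hσ'⟩ := exists_row_order (hpivots A₀ hA₀).injective hcard
  refine ⟨fun A => listRows σ (finalRow p o R π A (V A)), fun i c => ?_, fun A hA =>
    ⟨(hpivots A hA).isReducedRowEchelon hσ', ?_⟩⟩
  · rcases hi : σ i with _ | j
    · exact (Known.const 0).congr fun A _ => congrFun (listRows_of_eq_none hi _) c
    · exact (hknown j c).congr fun A _ => congrFun (listRows_of_eq_some hi _) c
  · rw [span_range_listRows hσ]
    exact (hP A hA).span_finalRow (hp A hA) ht (hV A hA).1 (hV A hA).2

/-- The number of steps of the reduction of a near-echelon matrix with `r` rows and `N` columns: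
`k` is the number of columns of level `a + 1`, the columns of level at most `a` and above `a` are
cut into `u` and `v` blocks of size `k`, and the final elimination works with `q` blocks of
size `b`; the numbers `μ` and `ν` are the costs of multiplying blocks of size `k` and `b`. -/
def reductionCost (r N k u v q b μ ν : ℕ) : ℕ :=
  r * N + (5 * u * v + v) * (μ + k ^ 2) + 2 * ((u * k) * (v * k)) + k * (v * k) +
    q * (b * (q * b * (4 * b + 4)) + 2 * (q ^ 2 * (ν + b ^ 2) + (q * b) ^ 2))

theorem reaches_echelonState (hlev : Monotone lev) {q b ν : ℕ} (hμ : HasMulTree 𝕜 k μ)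
    (hν : HasMulTree 𝕜 b ν) (hk : Fintype.card (AtLevel lev (a + 1)) = k) (hk0 : 0 < k)
    (hr : r ≤ Fintype.card (Low lev a) + k) (hlow : Fintype.card (Low lev a) ≤ u * k)
    (hmid : Fintype.card (AtLevel lev a) ≤ 3 * k) (hhigh : Fintype.card (High lev a) ≤ v * k)
    (hq : k ≤ q * b) (hP : ∀ A ∈ P, IsNearEchelon lev a A)
    (hA : KnownMat P K fun A : Matrix (Fin r) C 𝕜 => A) :
    Reaches EchelonState P K (reductionCost r (Fintype.card C) k u v q b μ ν) := by
  let o : Fin k ≃o AtLevel lev (a + 1) := Fintype.orderIsoFinOfCardEq _ hk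
  have hcost : reductionCost r (Fintype.card C) k u v q b μ ν =
      r * Fintype.card C + ((u * 3 * v * (μ + k ^ 2) + (u * k) * (v * k)) +
        ((u * v * (μ + k ^ 2) + k * (v * k)) +
          (q * (b * (q * b * (4 * b + 4)) + 2 * (q ^ 2 * (ν + b ^ 2) + (q * b) ^ 2)) +
            (1 * 1 * v * (μ + k ^ 2) + (u * v * (μ + k ^ 2) + (u * k) * (v * k) + 0))))) := by
    rw [reductionCost]
    ring
  rw [hcost]
  refine (Reaches.pivotRows hP hA).bind fun P₁ K₁ hP₁ hK₁ ⟨p, hpinj, hp⟩ => ?_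
  have hrest : Fintype.card (RestRow p) ≤ k := by
    have := card_restRow hpinj
    lia
  refine (Reaches.pivotBlock (p := p) hμ hlow hmid hhigh (hA.mono hP₁ hK₁)).bind
    fun P₂ K₂ hP₂ hK₂ hpivot => ?_
  refine (Reaches.restBlock hμ hrest hlow hhigh ((hA.mono hP₁ hK₁).mono hP₂ hK₂) hpivot).bind
    fun P₃ K₃ hP₃ hK₃ hrestB => ?_
  refine (hν.reaches_eliminate (Y := nextBlock p o) (hrest.trans hq) hq hk0
    fun i j => hrestB i _).bind fun P₄ K₄ hP₄ hK₄ ⟨V, R, π, hV, _, hred⟩ => ?_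
  refine (hμ.reaches_mul (p := 1) (q := 1) (by simpa using hrest) (by simpa using hrest) hhigh hV
    (hrestB.mono hP₄ hK₄)).bind fun P₅ K₅ hP₅ hK₅ hVrest => ?_
  refine (Reaches.clearedBlock (o := o) (π := π) hμ hrest hlow hhigh
    (hpivot.mono (hP₅.trans (hP₄.trans hP₃)) (hK₃.trans (hK₄.trans hK₅))) hVrest).bind
    fun P₆ K₆ hP₆ hK₆ hcleared => ?_
  rcases P₆.eq_empty_or_nonempty with rfl | hne
  · exact .empty
  have hP₆₄ := hP₆.trans hP₅
  have hP₆₁ := hP₆₄.trans (hP₄.trans (hP₃.trans hP₂))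
  exact .done (echelonState_of_finalRow hlev (fun A h => hP A (hP₁ (hP₆₁ h))) hpinj
    (fun A h => hp A (hP₆₁ h)) hq (fun A h => hred A (hP₆₄ h))
    (known_finalRow hcleared (hVrest.mono hP₆ hK₆)) hne)

end Trees

end Assembly

/-! ### The graded reverse lexicographic order -/

section Grevlex

variable {a b c σ τ : Fin 4 →₀ ℕ}

theorem degree_fin_four (m : Fin 4 →₀ ℕ) : m.degree = m 0 + m 1 + m 2 + m 3 := by
  rw [Finsupp.degree_eq_sum, Fin.sum_univ_four]

theorem finsupp_fin_four_ext (h₀ : a 0 = b 0) (h₁ : a 1 = b 1) (h₂ : a 2 = b 2)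
    (h₃ : a 3 = b 3) : a = b := by
  ext i
  fin_cases i <;> assumption

theorem grevlexLT_iff : GrevlexLT a b ↔
    a 0 + a 1 + a 2 + a 3 < b 0 + b 1 + b 2 + b 3 ∨
    (a 0 + a 1 + a 2 + a 3 = b 0 + b 1 + b 2 + b 3 ∧
      (b 3 < a 3 ∨ a 3 = b 3 ∧ (b 2 < a 2 ∨ a 2 = b 2 ∧ (b 1 < a 1 ∨ a 1 = b 1 ∧ b 0 < a 0)))) := by
  rw [GrevlexLT, degree_fin_four, degree_fin_four]
  refine or_congr Iff.rfl (and_congr Iff.rfl ?_)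
  simp only [Fin.exists_fin_succ, Fin.forall_fin_succ, IsEmpty.exists_iff, IsEmpty.forall_iff,
    Fin.isValue, lt_self_iff_false, Fin.succ_zero_eq_one, forall_const,
    Fin.succ_one_eq_two, Fin.reduceLT, Fin.reduceSucc, and_true, true_and, not_lt_zero,
    Fin.lt_one_iff, Nat.reduceAdd, Fin.reduceEq, and_self, or_false]
  grind

instance grevlexLT_isStrictTotalOrder : IsStrictTotalOrder (Fin 4 →₀ ℕ) GrevlexLT where
  irrefl a h := by rw [grevlexLT_iff] at h; lia
  trans a b c h h' := by rw [grevlexLT_iff] at *; omega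
  trichotomous a b h h' := by
    rw [grevlexLT_iff] at h h'
    apply finsupp_fin_four_ext <;> lia

theorem grevlexLT_add_right_iff : GrevlexLT (a + c) (b + c) ↔ GrevlexLT a b := by
  simp only [grevlexLT_iff, Finsupp.add_apply]
  lia

theorem GrevlexLT.apply_three_le (h : GrevlexLT a b) (hd : a.degree = b.degree) : b 3 ≤ a 3 := by
  rw [grevlexLT_iff] at h
  rw [degree_fin_four, degree_fin_four] at hd
  lia

theorem grevlexLT_of_forall_lt_eq_zero {k : Fin 4} (hd : τ.degree = σ.degree)
    (hσ : ∀ l, k < l → σ l = 0) (hτ : ∃ l, k < l ∧ τ l ≠ 0) : GrevlexLT τ σ := by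
  rw [grevlexLT_iff]
  rw [degree_fin_four, degree_fin_four] at hd
  obtain ⟨l, hl, h⟩ := hτ
  have h₁ : k < 1 → σ 1 = 0 := hσ 1
  have h₂ : k < 2 → σ 2 = 0 := hσ 2
  have h₃ : k < 3 → σ 3 = 0 := hσ 3
  fin_cases l <;> simp only [Fin.zero_eta, Fin.mk_one, Fin.reduceFinMk] at hl h <;> lia

theorem GrevlexLT.apply_le_of_forall_lt_eq_zero {k : Fin 4} (h : GrevlexLT σ τ)
    (hd : σ.degree = τ.degree) (hσ : ∀ l, k < l → σ l = 0) (hτ : ∀ l, k < l → τ l = 0) :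
    τ k ≤ σ k := by
  rw [grevlexLT_iff] at h
  rw [degree_fin_four, degree_fin_four] at hd
  have h₁ : k < 1 → σ 1 = 0 ∧ τ 1 = 0 := fun hk => ⟨hσ 1 hk, hτ 1 hk⟩
  have h₂ : k < 2 → σ 2 = 0 ∧ τ 2 = 0 := fun hk => ⟨hσ 2 hk, hτ 2 hk⟩
  have h₃ : k < 3 → σ 3 = 0 ∧ τ 3 = 0 := fun hk => ⟨hσ 3 hk, hτ 3 hk⟩
  fin_cases k <;> simp only [Fin.zero_eta, Fin.mk_one, Fin.reduceFinMk] at * <;> lia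

instance topLT_isStrictTotalOrder (s : ℕ) :
    IsStrictTotalOrder ((Fin 4 →₀ ℕ) × Fin s) TopLT where
  irrefl a h := h.elim (irrefl_of GrevlexLT _) fun h => lt_irrefl _ h.2
  trans a b c h h' := by
    rcases h with h | ⟨h, hs⟩ <;> rcases h' with h' | ⟨h', hs'⟩
    · exact .inl (trans_of GrevlexLT h h')
    · exact .inl (h' ▸ h)
    · exact .inl (h ▸ h')
    · exact .inr ⟨h.trans h', hs.trans hs'⟩
  trichotomous a b h h' := by
    simp only [TopLT, not_or, not_and] at h h'
    have hfst : a.1 = b.1 := Std.Trichotomous.trichotomous (r := GrevlexLT) _ _ h.1 h'.1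
    exact Prod.ext hfst (le_antisymm (not_lt.1 (h'.2 hfst.symm)) (not_lt.1 (h.2 hfst)))

theorem exists_greatest_of_isStrictTotalOrder {α : Type*} (lt : α → α → Prop)
    [IsStrictTotalOrder α lt] (s : Finset α) (hs : s.Nonempty) :
    ∃ m ∈ s, ∀ m' ∈ s, m' ≠ m → lt m' m := by
  classical
  let _ := linearOrderOfSTO lt
  exact ⟨s.max' hs, s.max'_mem hs, fun m' hm hne => lt_of_le_of_ne (s.le_max' m' hm) hne⟩

instance monDeg_lt_isStrictTotalOrder (d : ℕ) : IsStrictTotalOrder (MonDeg d) (· < ·) where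
  irrefl a := irrefl_of GrevlexLT a.1
  trans _ _ _ h h' := trans_of GrevlexLT h' h
  trichotomous a b h h' :=
    Subtype.ext (Std.Trichotomous.trichotomous (r := GrevlexLT) a.1 b.1 h' h)

open Classical in
instance monDegLinearOrder (d : ℕ) : LinearOrder (MonDeg d) :=
  linearOrderOfSTO (· < ·)

end Grevlex

/-! ### Counting monomials by the exponent of the last variable -/

section Counting

theorem mem_finsuppAntidiag_univ_iff {m : Fin 4 →₀ ℕ} {d : ℕ} :
    m ∈ Finset.finsuppAntidiag (Finset.univ : Finset (Fin 4)) d ↔ m.degree = d := by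
  simp [Finset.mem_finsuppAntidiag, Finsupp.degree_eq_sum]

theorem MonDeg.degree_eq {d : ℕ} (m : MonDeg d) : m.1.degree = d :=
  mem_finsuppAntidiag_univ_iff.1 m.2

/-- The monomial `m` as a monomial of degree `d`. -/
def MonDeg.mk {d : ℕ} (m : Fin 4 →₀ ℕ) (h : m.degree = d) : MonDeg d :=
  ⟨m, mem_finsuppAntidiag_univ_iff.2 h⟩

theorem card_monDeg (d : ℕ) : Fintype.card (MonDeg d) = (d + 3).choose 3 := by
  have hcard : Fintype.card (MonDeg d) =
      (Finset.finsuppAntidiag (Finset.univ : Finset (Fin 4)) d).card := Fintype.card_coe _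
  rw [hcard, Finset.card_finsuppAntidiag_nat_eq_choose, Finset.card_fin, add_comm 4 d]
  exact Nat.choose_symm_of_eq_add rfl

/-- The exponent of the last variable; it is the level of a column of a Macaulay matrix. -/
def lastExp {d : ℕ} (m : MonDeg d) : ℕ := m.1 3

theorem lastExp_monotone (d : ℕ) : Monotone (lastExp : MonDeg d → ℕ) := by
  intro a b h
  rcases h.eq_or_lt with rfl | h
  · exact le_rfl
  · exact GrevlexLT.apply_three_le h (b.degree_eq.trans a.degree_eq.symm)

theorem lastExp_le {d : ℕ} (m : MonDeg d) : lastExp m ≤ d := by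
  have := m.degree_eq
  rw [degree_fin_four] at this
  rw [lastExp]
  lia

/-- Division by the `l`-th power of the last variable. -/
def divLastPow {d l : ℕ} (h : l ≤ d) : {m : MonDeg d // l ≤ lastExp m} ≃ MonDeg (d - l) where
  toFun m := MonDeg.mk (m.1.1 - Finsupp.single 3 l) <| by
    have hd := m.1.degree_eq
    have hl : l ≤ m.1.1 3 := m.2
    rw [degree_fin_four] at hd ⊢
    simp
    lia
  invFun m := ⟨MonDeg.mk (m.1 + Finsupp.single 3 l) (by simp [m.degree_eq, h]),
    by simp [lastExp, MonDeg.mk]⟩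
  left_inv m := by
    have hl : l ≤ m.1.1 3 := m.2
    exact Subtype.ext (Subtype.ext (tsub_add_cancel_of_le (by simpa using hl)))
  right_inv m := Subtype.ext (add_tsub_cancel_right _ _)

theorem card_le_lastExp (d l : ℕ) :
    Fintype.card {m : MonDeg d // l ≤ lastExp m} = (d + 3 - l).choose 3 := by
  rcases Nat.lt_or_ge d l with h | h
  · rw [Nat.choose_eq_zero_of_lt (by lia), Fintype.card_eq_zero_iff]
    exact ⟨fun m => (m.2.trans (lastExp_le m.1)).not_gt h⟩
  · rw [Fintype.card_congr (divLastPow h), card_monDeg, Nat.sub_add_comm h]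

theorem card_high (d a : ℕ) :
    Fintype.card (High (lastExp : MonDeg d → ℕ) a) = (d + 2 - a).choose 3 := by
  rw [show d + 2 - a = d + 3 - (a + 1) by lia, ← card_le_lastExp]
  exact Fintype.card_congr (Equiv.refl _)

theorem card_low_add_card_high {C : Type*} [Fintype C] (lev : C → ℕ) (a : ℕ) :
    Fintype.card (Low lev a) + Fintype.card (High lev a) = Fintype.card C := by
  have h := Fintype.card_subtype_compl fun c => lev c ≤ a
  have hle := Fintype.card_subtype_le fun c => lev c ≤ a
  simp only [not_le] at h
  lia

theorem card_atLevel_add_card_high {C : Type*} [Fintype C] (lev : C → ℕ) (a : ℕ) :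
    Fintype.card (AtLevel lev a) + Fintype.card (High lev a) =
      Fintype.card {c : C // a ≤ lev c} := by
  classical
  rw [← Fintype.card_subtype_or_disjoint]
  · exact Fintype.card_congr (Equiv.subtypeEquivRight fun c => by lia)
  · rw [Pi.disjoint_iff]
    intro c
    simp only [Prop.disjoint_iff, not_and]
    lia

theorem card_atLevel (d a : ℕ) (h : a ≤ d) :
    Fintype.card (AtLevel (lastExp : MonDeg d → ℕ) a) = (d + 2 - a).choose 2 := by
  have hsum := card_atLevel_add_card_high (lastExp : MonDeg d → ℕ) a
  rw [card_high, card_le_lastExp, show d + 3 - a = d + 2 - a + 1 by lia,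
    Nat.choose_succ_succ'] at hsum
  lia

end Counting

/-! ### Homogeneous combinations and leading monomials -/

section Homogeneous

variable {σ R ι : Type*} [CommSemiring R] {f g : MvPolynomial σ R} {d e δ : ℕ} {m : σ →₀ ℕ}

theorem degree_of_isHomogeneous (hf : f.IsHomogeneous d) (hm : coeff m f ≠ 0) : m.degree = d := by
  by_contra h
  exact hm (hf.coeff_eq_zero h)

theorem isHomogeneous_of_degree (hf : ∀ m, coeff m f ≠ 0 → m.degree = d) : f.IsHomogeneous d :=
  fun m hm => (Finsupp.degree_eq_weight_one (R := ℕ) ▸ hf m hm :)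

theorem homogeneousComponent_mul_of_isHomogeneous (hg : g.IsHomogeneous δ) (e : ℕ) :
    homogeneousComponent (e + δ) (f * g) = homogeneousComponent e f * g := by
  let _ := MvPolynomial.gradedAlgebra (σ := σ) (R := R)
  have h := DirectSum.coe_decompose_mul_add_of_right_mem (homogeneousSubmodule σ R)
    (a := f) (i := e) ((mem_homogeneousSubmodule δ g).2 hg)
  simpa only [← DirectSum.Decomposition.decompose'_eq, decomposition.decompose'_apply] using h

variable [Fintype ι] {F : ι → MvPolynomial σ R}

theorem sum_homogeneousComponent_mul (hF : ∀ i, (F i).IsHomogeneous δ)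
    (u : ι → MvPolynomial σ R) (e : ℕ) :
    ∑ i, homogeneousComponent e (u i) * F i = homogeneousComponent (e + δ) (∑ i, u i * F i) := by
  rw [map_sum]
  exact Finset.sum_congr rfl fun i _ => (homogeneousComponent_mul_of_isHomogeneous (hF i) e).symm

theorem exists_homogeneous_combination (hF : ∀ i, (F i).IsHomogeneous δ)
    (hf : f ∈ Ideal.span (Set.range F)) (e : ℕ) :
    ∃ u : ι → MvPolynomial σ R, (∀ i, (u i).IsHomogeneous e) ∧
      ∑ i, u i * F i = homogeneousComponent (e + δ) f := by
  obtain ⟨u, hu⟩ := Ideal.mem_span_range_iff_exists_fun.1 hf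
  exact ⟨fun i => homogeneousComponent e (u i), fun i => homogeneousComponent_isHomogeneous _ _,
    by rw [sum_homogeneousComponent_mul hF, hu]⟩

theorem isHomogeneous_sum_mul (hF : ∀ i, (F i).IsHomogeneous δ) {u : ι → MvPolynomial σ R}
    (hu : ∀ i, (u i).IsHomogeneous e) : (∑ i, u i * F i).IsHomogeneous (e + δ) :=
  IsHomogeneous.sum _ _ _ fun i _ => (hu i).mul (hF i)

theorem homogeneousComponent_mem_span {ι : Type*} [Finite ι] {F : ι → MvPolynomial σ R}
    (hF : ∀ i, (F i).IsHomogeneous δ) (hf : f ∈ Ideal.span (Set.range F)) (hd : δ ≤ d) :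
    homogeneousComponent d f ∈ Ideal.span (Set.range F) := by
  have := Fintype.ofFinite ι
  obtain ⟨u, -, h⟩ := exists_homogeneous_combination hF hf (d - δ)
  rw [Nat.sub_add_cancel hd] at h
  exact Ideal.mem_span_range_iff_exists_fun.2 ⟨u, h⟩

end Homogeneous

section LeadingMonomials

variable {𝕜 : Type*} [Field 𝕜] {s : ℕ} {f : MvPolynomial (Fin 4) 𝕜}

theorem IsLM.homogeneousComponent {m : Fin 4 →₀ ℕ} (h : IsLM f m) :
    IsLM (homogeneousComponent m.degree f) m := by
  refine ⟨?_, fun m' hm' hne => h.2 m' ?_ hne⟩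
  · rw [mem_support_iff, coeff_homogeneousComponent, if_pos rfl]
    exact mem_support_iff.1 h.1
  · rw [mem_support_iff, coeff_homogeneousComponent] at hm'
    exact mem_support_iff.2 (ite_ne_right_iff.1 hm').2

theorem exists_isModLM {u : Fin s → MvPolynomial (Fin 4) 𝕜} (hu : u ≠ 0) : ∃ t, IsModLM u t := by
  classical
  let T : Finset ((Fin 4 →₀ ℕ) × Fin s) :=
    Finset.univ.biUnion fun i => (u i).support.map ⟨(·, i), Prod.mk_left_injective i⟩
  have mem_T (t) : t ∈ T ↔ coeff t.1 (u t.2) ≠ 0 := by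
    obtain ⟨m, i⟩ := t
    simp [T]
  obtain ⟨i, hi⟩ := Function.ne_iff.1 hu
  obtain ⟨m, hm⟩ := ne_zero_iff.1 hi
  obtain ⟨t, ht, h⟩ := exists_greatest_of_isStrictTotalOrder TopLT T ⟨(m, i), (mem_T (m, i)).2 hm⟩
  exact ⟨t, (mem_T t).1 ht, fun t' ht' => h t' ((mem_T t').2 ht')⟩

end LeadingMonomials

/-! ### Signatures -/

section Signatures

variable {𝕜 : Type*} [Field 𝕜] {s : ℕ} {F u v w : Fin s → MvPolynomial (Fin 4) 𝕜}
  {f g : MvPolynomial (Fin 4) 𝕜} {k : Fin 4} {p q : Fin 4 →₀ ℕ} {t : (Fin 4 →₀ ℕ) × Fin s}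
  {d e δ : ℕ}

/-- `t` is the smallest signature at which the leading monomial `p` occurs; the signature of a
row is the signature at its leading monomial. -/
def IsSignatureAt (F : Fin s → MvPolynomial (Fin 4) 𝕜) (p : Fin 4 →₀ ℕ)
    (t : (Fin 4 →₀ ℕ) × Fin s) : Prop :=
  Attains F p t ∧ ∀ t', Attains F p t' → t' ≠ t → TopLT t t'

theorem Attains.degree_eq (hF : ∀ i, (F i).IsHomogeneous δ) (h : Attains F p t) :
    t.1.degree + δ = p.degree := by
  obtain ⟨e, u, hu, hlm, hp⟩ := h
  rw [degree_of_isHomogeneous (hu t.2) hlm.1,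
    degree_of_isHomogeneous (isHomogeneous_sum_mul hF hu) (mem_support_iff.1 hp.1)]

theorem IsLM.sub_smul (hf : IsLM f p) (hg : ∀ m, coeff m g ≠ 0 → GrevlexLT m p) (a : 𝕜) :
    IsLM (f - a • g) p := by
  have hgp : coeff p g = 0 := by
    by_contra h
    exact irrefl_of GrevlexLT p (hg p h)
  constructor
  · rw [mem_support_iff, coeff_sub, coeff_smul, hgp, smul_zero, sub_zero]
    exact mem_support_iff.1 hf.1
  · intro m hm hne
    by_cases hfm : coeff m f = 0
    · refine hg m fun hgm => mem_support_iff.1 hm ?_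
      rw [coeff_sub, coeff_smul, hfm, hgm, smul_zero, sub_zero]
    · exact hf.2 m (mem_support_iff.2 hfm) hne

theorem IsModLM.exists_sub_smul (hu : IsModLM u t) (hv : IsModLM v t) :
    ∃ a : 𝕜, ∀ t', IsModLM (u - a • v) t' → TopLT t' t := by
  refine ⟨coeff t.1 (u t.2) / coeff t.1 (v t.2), fun t' ht' => ?_⟩
  have hcoeff := ht'.1
  rw [Pi.sub_apply, Pi.smul_apply, coeff_sub, coeff_smul, smul_eq_mul] at hcoeff
  have hne : t' ≠ t := by
    rintro rfl
    exact hcoeff (by rw [div_mul_cancel₀ _ hv.1, sub_self])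
  by_cases hut : coeff t'.1 (u t'.2) = 0
  · exact hv.2 t' (fun hvt => hcoeff (by rw [hut, hvt, mul_zero, sub_zero])) hne
  · exact hu.2 t' hut hne

theorem Attains.exists_smaller (h : Attains F p t) (hv : ∀ i, (v i).IsHomogeneous t.1.degree)
    (ht : IsModLM v t) (hlt : ∀ m, coeff m (∑ i, v i * F i) ≠ 0 → GrevlexLT m p) :
    ∃ t', Attains F p t' ∧ TopLT t' t := by
  obtain ⟨e, u, hu, hlm, hp⟩ := h
  obtain rfl : t.1.degree = e := degree_of_isHomogeneous (hu t.2) hlm.1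
  obtain ⟨a, ha⟩ := hlm.exists_sub_smul ht
  have hsum : ∑ i, (u - a • v) i * F i = ∑ i, u i * F i - a • ∑ i, v i * F i := by
    simp only [Pi.sub_apply, Pi.smul_apply, sub_mul, smul_mul_assoc, Finset.sum_sub_distrib,
      Finset.smul_sum]
  have hLM : IsLM (∑ i, (u - a • v) i * F i) p := hsum ▸ hp.sub_smul hlt a
  have hne : u - a • v ≠ 0 := by
    intro h
    rw [h] at hLM
    simpa using hLM.1
  obtain ⟨t', ht'⟩ := exists_isModLM hne
  refine ⟨t', ⟨t.1.degree, u - a • v, fun i => ?_, ht', hLM⟩, ha t' ht'⟩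
  exact (hu i).sub ((homogeneousSubmodule (Fin 4) 𝕜 t.1.degree).smul_mem a (hv i))

theorem exists_attains (hF : ∀ i, (F i).IsHomogeneous δ) (hf : f ∈ Ideal.span (Set.range F))
    (hd : δ ≤ d) (hfd : f.IsHomogeneous d) (hp : IsLM f p) : ∃ t, Attains F p t := by
  obtain ⟨u, hu, h⟩ := exists_homogeneous_combination hF hf (d - δ)
  rw [Nat.sub_add_cancel hd, homogeneousComponent_eq_self hfd] at h
  have hu0 : u ≠ 0 := by
    rintro rfl
    rw [← h] at hp
    simpa using hp.1
  obtain ⟨t, ht⟩ := exists_isModLM hu0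
  exact ⟨t, d - δ, u, hu, ht, h ▸ hp⟩

theorem Attains.exists_isSignatureAt (hF : ∀ i, (F i).IsHomogeneous δ) (h : Attains F p t) :
    ∃ t₀, IsSignatureAt F p t₀ := by
  classical
  let T : Finset ((Fin 4 →₀ ℕ) × Fin s) :=
    {t ∈ Finset.finsuppAntidiag Finset.univ (p.degree - δ) ×ˢ Finset.univ | Attains F p t}
  have mem_T (t) : t ∈ T ↔ Attains F p t := by
    simp only [T, Finset.mem_filter, Finset.mem_product, Finset.mem_univ, and_true,
      mem_finsuppAntidiag_univ_iff, and_iff_right_iff_imp]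
    exact fun h => (Nat.sub_eq_of_eq_add (h.degree_eq hF).symm).symm
  obtain ⟨t₀, ht₀, hmin⟩ := exists_greatest_of_isStrictTotalOrder (Function.swap TopLT) T
    ⟨t, (mem_T t).2 h⟩
  exact ⟨t₀, (mem_T t₀).1 ht₀, fun t' ht' => hmin t' ((mem_T t').2 ht')⟩

theorem IsSignatureAt.not_attains_of_lt (hp : IsSignatureAt F p t) (hq : GrevlexLT q p) :
    ¬ Attains F q t := by
  rintro ⟨e, v, hv, ht, hlm⟩
  obtain rfl : t.1.degree = e := degree_of_isHomogeneous (hv t.2) ht.1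
  obtain ⟨t', ht', hlt⟩ := hp.1.exists_smaller hv ht fun m hm => by
    rcases eq_or_ne m q with rfl | hne
    · exact hq
    · exact trans_of GrevlexLT (hlm.2 m (mem_support_iff.2 hm) hne) hq
  exact asymm_of TopLT hlt (hp.2 t' ht' fun h => irrefl_of TopLT t (h ▸ hlt))

theorem IsSignature.exists_isLM (hf : IsSignature F f t) (hg : IsSignature F g t) :
    ∃ p, IsLM f p ∧ IsLM g p := by
  obtain ⟨p, hp, hpt⟩ := hf
  obtain ⟨q, hq, hqt⟩ := hg
  rcases trichotomous_of GrevlexLT p q with h | rfl | h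
  · exact absurd hpt.1 (IsSignatureAt.not_attains_of_lt hqt h)
  · exact ⟨p, hp, hq⟩
  · exact absurd hqt.1 (IsSignatureAt.not_attains_of_lt hpt h)

/-- The ideal generated by the variables after `X k`. -/
def laterVars (𝕜 : Type*) [Field 𝕜] (k : Fin 4) : Ideal (MvPolynomial (Fin 4) 𝕜) :=
  Ideal.span (X '' Set.Ioi k)

theorem mem_laterVars_iff :
    f ∈ laterVars 𝕜 k ↔ ∀ m, coeff m f ≠ 0 → ∃ l, k < l ∧ m l ≠ 0 := by
  simp only [laterVars, mem_ideal_span_X_image, mem_support_iff, Set.mem_Ioi]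

theorem mem_laterVars_of_X_mul_mem (h : X k * f ∈ laterVars 𝕜 k) : f ∈ laterVars 𝕜 k := by
  rw [mem_laterVars_iff] at h ⊢
  intro m hm
  obtain ⟨l, hl, hml⟩ := h (Finsupp.single k 1 + m) (by rwa [coeff_X_mul])
  exact ⟨l, hl, by simpa [hl.ne] using hml⟩

theorem sum_mul_mem_laterVars (hu : ∀ i, u i ∈ laterVars 𝕜 k)
    (F : Fin s → MvPolynomial (Fin 4) 𝕜) :
    ∑ i, u i * F i ∈ laterVars 𝕜 k :=
  Ideal.sum_mem _ fun i _ => Ideal.mul_mem_right _ _ (hu i)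

theorem Attains.apply_eq_zero_of_forall_lt (hp : ∀ l, k < l → p l = 0) (h : Attains F p t) :
    ∀ l, k < l → t.1 l = 0 := by
  obtain ⟨e, u, hu, hlm, hpu⟩ := h
  by_contra! ht
  have hmem (i) : u i ∈ laterVars 𝕜 k := by
    rw [mem_laterVars_iff]
    intro m hm
    by_contra! hmk
    have hd : t.1.degree = m.degree := by
      rw [degree_of_isHomogeneous (hu i) hm, degree_of_isHomogeneous (hu t.2) hlm.1]
    have hlt : TopLT t (m, i) := .inl (grevlexLT_of_forall_lt_eq_zero hd hmk ht)
    exact asymm_of TopLT hlt (hlm.2 (m, i) hm fun h => irrefl_of TopLT t (h ▸ hlt))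
  obtain ⟨l, hl, hpl⟩ :=
    mem_laterVars_iff.1 (sum_mul_mem_laterVars hmem F) p (mem_support_iff.1 hpu.1)
  exact hpl (hp l hl)

theorem exists_isHomogeneous_syzygy (hF : ∀ i, (F i).IsHomogeneous δ) (h : t ∈ syzLM F) :
    ∃ w : Fin s → MvPolynomial (Fin 4) 𝕜, (∀ i, (w i).IsHomogeneous t.1.degree) ∧
      ∑ i, w i * F i = 0 ∧ IsModLM w t := by
  obtain ⟨w, hw, hlm⟩ := h
  refine ⟨fun i => homogeneousComponent t.1.degree (w i),
    fun i => homogeneousComponent_isHomogeneous _ _, ?_, ?_, fun t' ht' => hlm.2 t' ?_⟩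
  · rw [sum_homogeneousComponent_mul hF, hw, map_zero]
  · rw [coeff_homogeneousComponent, if_pos rfl]
    exact hlm.1
  · rw [coeff_homogeneousComponent] at ht'
    exact (ite_ne_right_iff.1 ht').2

theorem IsModLM.divMonomial (h : IsModLM w (t.1 + p, t.2)) :
    IsModLM (fun i => (w i).divMonomial p) t := by
  constructor
  · rw [coeff_divMonomial, add_comm]
    exact h.1
  · intro t' ht' hne
    rw [coeff_divMonomial, add_comm] at ht'
    have hne' : (t'.1 + p, t'.2) ≠ (t.1 + p, t.2) := by
      simpa [Prod.ext_iff] using hne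
    exact (h.2 (t'.1 + p, t'.2) ht' hne').imp grevlexLT_add_right_iff.1
      (And.imp_left add_right_cancel)

theorem modMonomial_mem_laterVars (hw : ∀ i, (w i).IsHomogeneous e) (ht : ∀ l, k < l → t.1 l = 0)
    (hlm : IsModLM w (t.1 + Finsupp.single k 1, t.2)) (i : Fin s) :
    (w i).modMonomial (Finsupp.single k 1) ∈ laterVars 𝕜 k := by
  rw [mem_laterVars_iff]
  intro m hm
  by_contra! hmk
  have hle : ¬ Finsupp.single k 1 ≤ m := fun hle => hm (coeff_modMonomial_of_le _ hle)
  have hmk0 : m k = 0 := by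
    rw [Finsupp.single_le_iff] at hle
    lia
  rw [coeff_modMonomial_of_not_le _ hle] at hm
  have hne : m ≠ t.1 + Finsupp.single k 1 := fun h => hle (h ▸ le_add_self)
  have hlt : GrevlexLT m (t.1 + Finsupp.single k 1) :=
    (hlm.2 (m, i) hm fun h => hne (congrArg Prod.fst h)).resolve_right fun h => hne h.1
  have hd : m.degree = (t.1 + Finsupp.single k 1).degree :=
    (degree_of_isHomogeneous (hw i) hm).trans (degree_of_isHomogeneous (hw t.2) hlm.1).symm
  have := hlt.apply_le_of_forall_lt_eq_zero hd hmk fun l hl => by simp [ht l hl, hl.ne]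
  simp [hmk0] at this

theorem IsSignatureAt.add_single_notMem_syzLM (hF : ∀ i, (F i).IsHomogeneous δ)
    (hp : ∀ l, k < l → p l = 0) (h : IsSignatureAt F p t) :
    (t.1 + Finsupp.single k 1, t.2) ∉ syzLM F := by
  intro hsyz
  obtain ⟨w, hw, hwF, hlm⟩ := exists_isHomogeneous_syzygy hF hsyz
  let v : Fin s → MvPolynomial (Fin 4) 𝕜 := fun i => (w i).divMonomial (Finsupp.single k 1)
  have hvF : ∑ i, v i * F i ∈ laterVars 𝕜 k := by
    -- `X k * ∑ v i * F i = -∑ (w i mod X k) * F i`, as `w` is a syzygy.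
    have hmod := sum_mul_mem_laterVars
      (modMonomial_mem_laterVars hw (h.1.apply_eq_zero_of_forall_lt hp) hlm) F
    refine mem_laterVars_of_X_mul_mem ((Submodule.add_mem_iff_left _ hmod).1 ?_)
    rw [Finset.mul_sum, ← Finset.sum_add_distrib]
    simp only [v, ← mul_assoc, ← add_mul, divMonomial_add_modMonomial_single, hwF, zero_mem]
  have hv (i) : (v i).IsHomogeneous t.1.degree := isHomogeneous_of_degree fun m hm => by
    rw [coeff_divMonomial] at hm
    simpa [add_comm] using degree_of_isHomogeneous (hw i) hm
  obtain ⟨t', ht', hlt⟩ := h.1.exists_smaller hv hlm.divMonomial fun m hm => by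
    refine grevlexLT_of_forall_lt_eq_zero ?_ hp (mem_laterVars_iff.1 hvF m hm)
    rw [degree_of_isHomogeneous (isHomogeneous_sum_mul hF hv) hm, h.1.degree_eq hF]
  exact asymm_of TopLT hlt (h.2 t' ht' fun h => irrefl_of TopLT t (h ▸ hlt))

end Signatures

/-! ### Leading positions and row spaces -/

section LeadingPositions

variable {𝕜 C : Type*} [Field 𝕜] [LinearOrder C]

/-- `c` is the first position at which the vector `v` does not vanish. -/
def IsLead (v : C → 𝕜) (c : C) : Prop := (∀ c' < c, v c' = 0) ∧ v c ≠ 0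

theorem IsLead.unique {v : C → 𝕜} {c c' : C} (h : IsLead v c) (h' : IsLead v c') : c = c' :=
  Matrix.IsLeadingEntry.unique (A := fun _ : Unit => v) (i := ()) h h'

theorem exists_isLead [Finite C] {v : C → 𝕜} (hv : v ≠ 0) : ∃ c, IsLead v c :=
  (Matrix.row_ne_zero_iff_exists_isLeadingEntry (A := fun _ : Unit => v) (i := ())).1 hv

theorem linearIndependent_of_isLead {s : Set C} [Finite s] {v : s → C → 𝕜}
    (hv : ∀ c, IsLead (v c) c.1) : LinearIndependent 𝕜 v := by
  have := Fintype.ofFinite s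
  let B : Matrix s s 𝕜 := fun c c' => v c c'.1
  have hB : B.IsUpperTriangular := fun _ c' h => (hv _).1 c'.1 h
  have hdet : IsUnit B := by
    rw [Matrix.isUnit_iff_isUnit_det, Matrix.det_of_isUpperTriangular hB, isUnit_iff_ne_zero]
    exact Finset.prod_ne_zero_iff.2 fun c _ => (hv c).2
  exact .of_comp (LinearMap.funLeft 𝕜 𝕜 Subtype.val) (B.linearIndependent_rows_iff_isUnit.2 hdet)

theorem injective_restrict_leads [Finite C] (W : Submodule 𝕜 (C → 𝕜)) :
    Function.Injective
      ((LinearMap.funLeft 𝕜 𝕜 (Subtype.val : {c | ∃ v ∈ W, IsLead v c} → C)).domRestrict W) := by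
  rw [← LinearMap.ker_eq_bot, LinearMap.ker_eq_bot']
  intro v hv
  by_contra hne
  obtain ⟨c, hc⟩ := exists_isLead fun h => hne (Subtype.ext h)
  exact hc.2 (congrFun hv ⟨c, v.1, v.2, hc⟩)

theorem finrank_eq_card_lead [Finite C] (W : Submodule 𝕜 (C → 𝕜)) :
    Module.finrank 𝕜 W = Nat.card {c | ∃ v ∈ W, IsLead v c} := by
  have := Fintype.ofFinite {c | ∃ v ∈ W, IsLead v c}
  rw [Nat.card_eq_fintype_card]
  apply le_antisymm
  · rw [← Module.finrank_fintype_fun_eq_card (R := 𝕜)]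
    exact LinearMap.finrank_le_finrank_of_injective (injective_restrict_leads W)
  · choose v hv hlead using fun c : {c | ∃ v ∈ W, IsLead v c} => c.2
    exact LinearIndependent.fintype_card_le_finrank (R := 𝕜) (b := fun c => (⟨v c, hv c⟩ : W))
      (.of_comp W.subtype (linearIndependent_of_isLead hlead))

variable {q : ℕ} {E : Matrix (Fin q) C 𝕜}

theorem sum_smul_apply_of_isRowEchelon (hE : E.IsRowEchelon) {g : Fin q → 𝕜} {i : Fin q}
    (hg : ∀ i' < i, g i' = 0) {c : C} (hc : ∀ c' < c, E i c' = 0) :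
    (∑ i', g i' • E i') c = g i * E i c := by
  rw [Finset.sum_apply, Finset.sum_eq_single_of_mem i (Finset.mem_univ i)]
  · rfl
  · intro i' _ hne
    rcases hne.lt_or_gt with h | h
    · rw [hg i' h, zero_smul, Pi.zero_apply]
    · rw [Pi.smul_apply, hE h hc, smul_zero]

theorem exists_isLeadingEntry_of_mem_span [Finite C] (hE : E.IsRowEchelon) {v : C → 𝕜}
    (hv : v ∈ Submodule.span 𝕜 (Set.range E)) {c : C} (hc : IsLead v c) :
    ∃ i, E.IsLeadingEntry i c := by
  obtain ⟨g, rfl⟩ := (Submodule.mem_span_range_iff_exists_fun 𝕜).1 hv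
  have hg : g ≠ 0 := by
    rintro rfl
    simpa using hc.2
  obtain ⟨i, hgi, hi⟩ := exists_isLead hg
  have hEi : E i ≠ 0 := fun h =>
    hc.2 (by rw [sum_smul_apply_of_isRowEchelon hE hgi (by simp [h]), h, Pi.zero_apply, mul_zero])
  obtain ⟨l, hl⟩ := exists_isLead hEi
  have hlead : IsLead (∑ i, g i • E i) l := by
    constructor
    · intro c' hc'
      rw [sum_smul_apply_of_isRowEchelon hE hgi fun x hx => hl.1 x (hx.trans hc'), hl.1 c' hc',
        mul_zero]
    · rw [sum_smul_apply_of_isRowEchelon hE hgi hl.1]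
      exact mul_ne_zero hi hl.2
  exact ⟨i, hc.unique hlead ▸ hl⟩

end LeadingPositions

section RowSpace

variable {𝕜 : Type*} [Field 𝕜] {d : ℕ}

theorem coeff_rowPoly (v : MonDeg d → 𝕜) (σ : MonDeg d) : coeff σ.1 (rowPoly v) = v σ := by
  classical
  rw [rowPoly, coeff_sum, Finset.sum_eq_single_of_mem σ (Finset.mem_univ σ)]
  · rw [coeff_monomial, if_pos rfl]
  · intro m _ hm
    rw [coeff_monomial, if_neg fun h => hm (Subtype.ext h)]

theorem isHomogeneous_rowPoly (v : MonDeg d → 𝕜) : (rowPoly v).IsHomogeneous d :=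
  IsHomogeneous.sum _ _ _ fun m _ => isHomogeneous_monomial _ m.degree_eq

theorem rowPoly_coeff {f : MvPolynomial (Fin 4) 𝕜} (hf : f.IsHomogeneous d) :
    rowPoly (fun σ : MonDeg d => coeff σ.1 f) = f := by
  ext m
  by_cases hm : m.degree = d
  · exact coeff_rowPoly _ (MonDeg.mk m hm)
  · rw [(isHomogeneous_rowPoly _).coeff_eq_zero hm, hf.coeff_eq_zero hm]

/-- The map sending a row to the polynomial that it represents, as a linear map. -/
def rowPolyLinear (𝕜 : Type*) [Field 𝕜] (d : ℕ) :
    (MonDeg d → 𝕜) →ₗ[𝕜] MvPolynomial (Fin 4) 𝕜 where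
  toFun := rowPoly
  map_add' v w := by simp [rowPoly, Finset.sum_add_distrib]
  map_smul' a v := by simp [rowPoly, Finset.smul_sum, smul_monomial]

theorem rowPolyLinear_injective : Function.Injective (rowPolyLinear 𝕜 d) := fun v w h =>
  funext fun σ => by
    rw [← coeff_rowPoly v, ← coeff_rowPoly w]
    exact congrArg (coeff σ.1) h

/-- The coefficient vectors of the forms of degree `d` in the ideal `I`. -/
def rowSpace (I : Ideal (MvPolynomial (Fin 4) 𝕜)) (d : ℕ) : Submodule 𝕜 (MonDeg d → 𝕜) :=
  (I.restrictScalars 𝕜).comap (rowPolyLinear 𝕜 d)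

theorem mem_rowSpace {I : Ideal (MvPolynomial (Fin 4) 𝕜)} {v : MonDeg d → 𝕜} :
    v ∈ rowSpace I d ↔ rowPoly v ∈ I :=
  Iff.rfl

theorem map_rowSpace (I : Ideal (MvPolynomial (Fin 4) 𝕜)) :
    (rowSpace I d).map (rowPolyLinear 𝕜 d) =
      Submodule.restrictScalars 𝕜 I ⊓ homogeneousSubmodule (Fin 4) 𝕜 d := by
  ext f
  constructor
  · rintro ⟨v, hv, rfl⟩
    exact ⟨hv, isHomogeneous_rowPoly v⟩
  · rintro ⟨hI, hf⟩
    have hrow := rowPoly_coeff hf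
    exact ⟨fun σ => coeff σ.1 f, mem_rowSpace.2 (hrow.symm ▸ hI), hrow⟩

theorem hilbertFun_eq_finrank (I : Ideal (MvPolynomial (Fin 4) 𝕜)) (d : ℕ) :
    hilbertFun I d = Module.finrank 𝕜 (rowSpace I d) := by
  rw [hilbertFun, ← map_rowSpace]
  exact (Submodule.equivMapOfInjective _ rowPolyLinear_injective (rowSpace I d)).finrank_eq.symm

theorem hilbertFun_le (I : Ideal (MvPolynomial (Fin 4) 𝕜)) (d : ℕ) :
    hilbertFun I d ≤ (d + 3).choose 3 := by
  rw [hilbertFun_eq_finrank, ← card_monDeg, ← Module.finrank_fintype_fun_eq_card (R := 𝕜)]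
  exact Submodule.finrank_le _

theorem isLM_rowPoly_iff {v : MonDeg d → 𝕜} {c : MonDeg d} :
    IsLM (rowPoly v) c.1 ↔ IsLead v c := by
  rw [IsLM, mem_support_iff, coeff_rowPoly, IsLead, and_comm]
  refine and_congr_left fun _ => ⟨fun h c' hc' => ?_, fun h m hm hne => ?_⟩
  · by_contra hne
    exact asymm_of GrevlexLT hc' (h c'.1 (by rwa [mem_support_iff, coeff_rowPoly])
      fun h => hc'.ne (Subtype.ext h))
  · rw [mem_support_iff] at hm
    obtain ⟨m, rfl⟩ : ∃ m' : MonDeg d, m'.1 = m :=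
      ⟨MonDeg.mk m (degree_of_isHomogeneous (isHomogeneous_rowPoly v) hm), rfl⟩
    rw [coeff_rowPoly] at hm
    exact lt_of_le_of_ne (not_lt.1 fun hlt => hm (h m hlt)) fun h => hne (congrArg _ h.symm)

variable {s : ℕ} {F : Fin s → MvPolynomial (Fin 4) 𝕜} {δ : ℕ}

theorem mem_leadingMonomials_iff (hF : ∀ i, (F i).IsHomogeneous δ) (hd : δ ≤ d) (c : MonDeg d) :
    c.1 ∈ leadingMonomials (Ideal.span (Set.range F)) ↔
      ∃ v ∈ rowSpace (Ideal.span (Set.range F)) d, IsLead v c := by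
  constructor
  · rintro ⟨f, hf, hlm⟩
    have hlm' := hlm.homogeneousComponent
    have hrow := rowPoly_coeff (homogeneousComponent_isHomogeneous d f)
    rw [c.degree_eq, ← hrow] at hlm'
    exact ⟨fun σ => coeff σ.1 (homogeneousComponent d f),
      mem_rowSpace.2 (hrow.symm ▸ homogeneousComponent_mem_span hF hf hd), isLM_rowPoly_iff.1 hlm'⟩
  · rintro ⟨v, hv, hlead⟩
    exact ⟨rowPoly v, hv, isLM_rowPoly_iff.2 hlead⟩

theorem hilbertFun_eq_card_leadingMonomials (hF : ∀ i, (F i).IsHomogeneous δ) (hd : δ ≤ d) :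
    hilbertFun (Ideal.span (Set.range F)) d =
      Nat.card {c : MonDeg d // c.1 ∈ leadingMonomials (Ideal.span (Set.range F))} := by
  rw [hilbertFun_eq_finrank, finrank_eq_card_lead]
  exact Nat.card_congr (Equiv.subtypeEquivRight fun c => (mem_leadingMonomials_iff hF hd c).symm)

theorem rowPoly_macaulay (hF : ∀ i, (F i).IsHomogeneous δ) (hd : δ ≤ d)
    (p : MonDeg (d - δ) × Fin s) :
    rowPoly (macaulay F δ d p) = monomial p.1.1 (1 : 𝕜) * F p.2 := by
  have h := (isHomogeneous_monomial (1 : 𝕜) p.1.degree_eq).mul (hF p.2)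
  rw [Nat.sub_add_cancel hd] at h
  exact rowPoly_coeff h

theorem mul_mem_map_span_macaulay (hF : ∀ i, (F i).IsHomogeneous δ) (hd : δ ≤ d)
    {u : MvPolynomial (Fin 4) 𝕜} (hu : u.IsHomogeneous (d - δ)) (i : Fin s) :
    u * F i ∈ (Submodule.span 𝕜 (Set.range (macaulay F δ d))).map (rowPolyLinear 𝕜 d) := by
  rw [← rowPoly_coeff hu, rowPoly, Finset.sum_mul]
  refine Submodule.sum_mem _ fun τ _ => ?_
  have hrow : monomial τ.1 (coeff τ.1 u) * F i =
      coeff τ.1 u • rowPoly (macaulay F δ d (τ, i)) := by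
    rw [rowPoly_macaulay hF hd, ← smul_mul_assoc, smul_monomial, smul_eq_mul, mul_one]
  rw [hrow]
  exact Submodule.smul_mem _ _ (Submodule.mem_map_of_mem (Submodule.subset_span ⟨(τ, i), rfl⟩))

theorem span_macaulay (hF : ∀ i, (F i).IsHomogeneous δ) (hd : δ ≤ d) :
    Submodule.span 𝕜 (Set.range (macaulay F δ d)) = rowSpace (Ideal.span (Set.range F)) d := by
  apply le_antisymm
  · rw [Submodule.span_le]
    rintro _ ⟨p, rfl⟩
    rw [SetLike.mem_coe, mem_rowSpace, rowPoly_macaulay hF hd]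
    exact Ideal.mul_mem_left _ _ (Ideal.subset_span ⟨p.2, rfl⟩)
  · intro v hv
    obtain ⟨u, hu, h⟩ := exists_homogeneous_combination hF (mem_rowSpace.1 hv) (d - δ)
    rw [Nat.sub_add_cancel hd, homogeneousComponent_eq_self (isHomogeneous_rowPoly v)] at h
    refine (Submodule.map_le_map_iff_of_injective rowPolyLinear_injective (.span 𝕜 {v}) _).1 ?_
      (Submodule.mem_span_singleton_self v)
    rw [Submodule.map_span_le]
    rintro _ rfl
    refine (h : _ = rowPolyLinear 𝕜 d _).subst (motive := (· ∈ _)) ?_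
    exact Submodule.sum_mem _ fun i _ => mul_mem_map_span_macaulay hF hd (hu i) i

end RowSpace

/-! ### Rows and signatures of the built matrix -/

section ShiftedRow

variable {𝕜 : Type*} [Field 𝕜] {d a : ℕ} {k : Fin 4}

/-- The monomial `X k * m`. -/
def MonDeg.mulX (k : Fin 4) (m : MonDeg d) : MonDeg (d + 1) :=
  MonDeg.mk (m.1 + Finsupp.single k 1) (by simp [m.degree_eq])

theorem lastExp_mulX (k : Fin 4) (m : MonDeg d) :
    lastExp (m.mulX k) = lastExp m + if k = 3 then 1 else 0 := by
  simp [lastExp, MonDeg.mulX, MonDeg.mk, Finsupp.single_apply]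

theorem MonDeg.exists_mulX_eq {σ : MonDeg (d + 1)} (h : σ.1 k ≠ 0) :
    ∃ m : MonDeg d, m.mulX k = σ := by
  have heq : σ.1 - Finsupp.single k 1 + Finsupp.single k 1 = σ.1 :=
    tsub_add_cancel_of_le (by rw [Finsupp.single_le_iff]; lia)
  have hdeg : (σ.1 - Finsupp.single k 1).degree = d := by
    have hσ := σ.degree_eq
    rw [← heq] at hσ
    simpa using hσ
  exact ⟨MonDeg.mk _ hdeg, Subtype.ext heq⟩

theorem MonDeg.exists_mulX_last_eq (σ : MonDeg (d + 1)) :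
    ∃ (k : Fin 4) (m : MonDeg d), m.mulX k = σ ∧ ∀ l, k < l → m.1 l = 0 := by
  have hne : σ.1.support.Nonempty := by
    rw [Finsupp.support_nonempty_iff]
    intro h
    simpa [h] using σ.degree_eq
  let k := σ.1.support.max' hne
  obtain ⟨m, hm⟩ := exists_mulX_eq (Finsupp.mem_support_iff.1 (σ.1.support.max'_mem hne))
  refine ⟨k, m, hm, fun l hl => by_contra fun hml => hl.not_ge (σ.1.support.le_max' l ?_)⟩
  rw [← hm, Finsupp.mem_support_iff]
  exact fun h => hml (Nat.add_eq_zero_iff.1 h).1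

/-- The row that represents `X k` times the polynomial represented by `v`. -/
def shiftedRow (k : Fin 4) (v : MonDeg d → 𝕜) (σ : MonDeg (d + 1)) : 𝕜 :=
  coeff σ.1 (X k * rowPoly v)

theorem shiftedRow_mulX (v : MonDeg d → 𝕜) (m : MonDeg d) :
    shiftedRow k v (m.mulX k) = v m := by
  have h := coeff_X_mul m.1 k (rowPoly v)
  rwa [coeff_rowPoly, add_comm] at h

theorem exists_of_shiftedRow_ne_zero {v : MonDeg d → 𝕜} {σ : MonDeg (d + 1)}
    (h : shiftedRow k v σ ≠ 0) : ∃ m : MonDeg d, m.mulX k = σ ∧ v m ≠ 0 := by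
  have hσ : σ.1 k ≠ 0 := by
    rw [shiftedRow, coeff_X_mul'] at h
    exact Finsupp.mem_support_iff.1 (ite_ne_right_iff.1 h).1
  obtain ⟨m, rfl⟩ := MonDeg.exists_mulX_eq hσ
  exact ⟨m, rfl, by rwa [shiftedRow_mulX] at h⟩

theorem rowPoly_shiftedRow (k : Fin 4) (v : MonDeg d → 𝕜) :
    rowPoly (shiftedRow k v) = X k * rowPoly v := by
  refine rowPoly_coeff ?_
  rw [add_comm]
  exact (isHomogeneous_X 𝕜 k).mul (isHomogeneous_rowPoly v)

variable {q : ℕ} {E : Matrix (Fin q) (MonDeg d) 𝕜} {i : Fin q} {c : MonDeg d}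

theorem lastExp_mulX_le (hc : lastExp c < a) (k : Fin 4) : lastExp (c.mulX k) ≤ a := by
  rw [lastExp_mulX]
  lia

theorem isPivot_shiftedRow (hE : E.IsReducedRowEchelon)
    (hlead : ∀ m : MonDeg d, lastExp m < a → ∃ j, E.IsLeadingEntry j m)
    (hc : E.IsLeadingEntry i c) (hca : lastExp c < a) (k : Fin 4) :
    IsPivot lastExp a (shiftedRow k (E i)) (c.mulX k) := by
  refine ⟨(shiftedRow_mulX _ _).trans (hE.eq_one hc), fun σ hσ hne => ?_⟩
  obtain ⟨m, rfl, hm⟩ := exists_of_shiftedRow_ne_zero hne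
  have hma : a ≤ lastExp m := by
    by_contra! hlt
    obtain ⟨j, hj⟩ := hlead m hlt
    refine hm (hE.eq_zero_of_ne_of_isLeadingEntry (fun hij => hσ ?_) hj)
    rw [IsLead.unique (hij ▸ hj : E.IsLeadingEntry i m) hc]
  rw [lastExp_mulX, lastExp_mulX]
  lia

end ShiftedRow

section NearEchelon

variable {𝕜 : Type*} [Field 𝕜] {s : ℕ} {F : Fin s → MvPolynomial (Fin 4) 𝕜} {δ d a r q : ℕ}
  {E : Matrix (Fin q) (MonDeg d) 𝕜} {A : Matrix (Fin r) (MonDeg (d + 1)) 𝕜}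

theorem IsRREFOf.span_eq_rowSpace (hF : ∀ i, (F i).IsHomogeneous δ) (hd : δ ≤ d)
    (hE : IsRREFOf (macaulay F δ d) E) :
    Submodule.span 𝕜 (Set.range E) = rowSpace (Ideal.span (Set.range F)) d :=
  hE.2.trans (span_macaulay hF hd)

theorem mem_newRows (hF : ∀ i, (F i).IsHomogeneous δ) (hd : δ ≤ d) {i : Fin q}
    (hi : rowPoly (E i) ∈ Ideal.span (Set.range F)) {c : MonDeg d} (hc : E.IsLeadingEntry i c)
    {k : Fin 4} (hk : ∀ l, k < l → c.1 l = 0) : (i, k) ∈ newRows F E := by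
  have hlm : IsLM (rowPoly (E i)) c.1 := isLM_rowPoly_iff.2 hc
  obtain ⟨t', ht'⟩ := exists_attains hF hi hd (isHomogeneous_rowPoly _) hlm
  obtain ⟨t, ht⟩ := ht'.exists_isSignatureAt hF
  refine ⟨hc.row_ne_zero, t, ⟨c.1, hlm, ht⟩, fun l hl => ?_, ht.add_single_notMem_syzLM hF hk⟩
  by_contra! hkl
  exact Finsupp.mem_support_iff.1 hl (ht.1.apply_eq_zero_of_forall_lt hk l hkl)

theorem isNearEchelon_of_leadingMonomials (hF : ∀ i, (F i).IsHomogeneous δ) (hd : δ ≤ d)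
    (ha : 0 < a)
    (hlow : ∀ m : MonDeg d, m.1 ∈ leadingMonomials (Ideal.span (Set.range F)) ↔ lastExp m < a)
    (hnext : ∀ m : MonDeg (d + 1),
      m.1 ∈ leadingMonomials (Ideal.span (Set.range F)) → lastExp m ≤ a + 1)
    (hA : IsBuiltMatrix F δ d A) : IsNearEchelon lastExp a A := by
  obtain ⟨q, E, hE, e, he⟩ := hA
  have hspan := hE.span_eq_rowSpace hF hd
  have hrow (i) : A i = shiftedRow (e i).1.2 (E (e i).1.1) := funext (he i)
  have hmem (i) : rowPoly (E i) ∈ Ideal.span (Set.range F) :=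
    mem_rowSpace.1 (hspan ▸ Submodule.subset_span (Set.mem_range_self i))
  have hlead (m : MonDeg d) (hm : lastExp m < a) : ∃ i, E.IsLeadingEntry i m := by
    obtain ⟨v, hv, hvm⟩ := (mem_leadingMonomials_iff hF hd m).1 ((hlow m).2 hm)
    exact exists_isLeadingEntry_of_mem_span hE.1.1 (hspan ▸ hv) hvm
  constructor
  · intro i
    obtain ⟨c, hc⟩ := exists_isLead (e i).2.1
    have hca : lastExp c < a := (hlow c).1 ⟨_, hmem _, isLM_rowPoly_iff.2 hc⟩
    exact ⟨_, lastExp_mulX_le hca _, hrow i ▸ isPivot_shiftedRow hE.1 hlead hc hca _⟩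
  · intro ℓ hℓ
    obtain ⟨k, c, rfl, hk⟩ := MonDeg.exists_mulX_last_eq ℓ
    have hca : lastExp c < a := by
      rw [lastExp_mulX] at hℓ
      split_ifs at hℓ with hk3
      · lia
      · exact (hk 3 (by lia)).trans_lt ha
    obtain ⟨i, hi⟩ := hlead c hca
    refine ⟨e.symm ⟨(i, k), mem_newRows hF hd (hmem i) hi hk⟩, ?_⟩
    rw [hrow, Equiv.apply_symm_apply]
    exact isPivot_shiftedRow hE.1 hlead hi hca k
  · intro v hv hzero
    have hle : Submodule.span 𝕜 (Set.range A) ≤ rowSpace (Ideal.span (Set.range F)) (d + 1) := by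
      rw [Submodule.span_le]
      rintro _ ⟨i, rfl⟩
      rw [SetLike.mem_coe, mem_rowSpace, hrow, rowPoly_shiftedRow]
      exact Ideal.mul_mem_left _ _ (hmem _)
    by_contra hne
    obtain ⟨c, hc⟩ := exists_isLead hne
    exact hc.2 (hzero c (hnext c ⟨_, mem_rowSpace.1 (hle hv), isLM_rowPoly_iff.2 hc⟩))

end NearEchelon

section RowCount

variable {𝕜 : Type*} [Field 𝕜] {s : ℕ} {F : Fin s → MvPolynomial (Fin 4) 𝕜} {δ d r q : ℕ}

theorem card_le_hilbertFun {ι : Type*} [Fintype ι] {I : Ideal (MvPolynomial (Fin 4) 𝕜)}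
    {f : ι → MvPolynomial (Fin 4) 𝕜} (hf : LinearIndependent 𝕜 f) (hI : ∀ i, f i ∈ I)
    (hd : ∀ i, (f i).IsHomogeneous d) : Fintype.card ι ≤ hilbertFun I d := by
  let v (i : ι) : rowSpace I d :=
    ⟨fun σ => coeff σ.1 (f i), mem_rowSpace.2 ((rowPoly_coeff (hd i)).symm ▸ hI i)⟩
  have hv : (rowPolyLinear 𝕜 d).comp (rowSpace I d).subtype ∘ v = f :=
    funext fun i => rowPoly_coeff (hd i)
  rw [hilbertFun_eq_finrank]
  exact (LinearIndependent.of_comp _ (hv.symm ▸ hf)).fintype_card_le_finrank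

theorem coeff_single_monomial (t x : (Fin 4 →₀ ℕ) × Fin s) (b : 𝕜) :
    coeff x.1 (Pi.single (M := fun _ => MvPolynomial (Fin 4) 𝕜) t.2 (monomial t.1 b) x.2) =
      if t = x then b else 0 := by
  rcases eq_or_ne t.2 x.2 with h | h
  · rw [← h, Pi.single_eq_same, coeff_monomial]
    simp only [Prod.ext_iff, h, and_true]
  · rw [Pi.single_eq_of_ne' h, coeff_zero, if_neg fun htx => h (congrArg Prod.snd htx)]

theorem linearIndependent_of_notMem_syzLM {ι : Type*} [Finite ι]
    {T : ι → (Fin 4 →₀ ℕ) × Fin s} (hT : T.Injective) (hsyz : ∀ i, T i ∉ syzLM F) :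
    LinearIndependent 𝕜 fun i => monomial (T i).1 (1 : 𝕜) * F (T i).2 := by
  have := Fintype.ofFinite ι
  rw [Fintype.linearIndependent_iff]
  intro g hg
  let w : Fin s → MvPolynomial (Fin 4) 𝕜 := ∑ i, Pi.single (T i).2 (monomial (T i).1 (g i))
  have hcoeff (x : (Fin 4 →₀ ℕ) × Fin s) :
      coeff x.1 (w x.2) = ∑ i, if T i = x then g i else 0 := by
    simp only [w, Finset.sum_apply, coeff_sum, coeff_single_monomial]
  have hw : ∑ j, w j * F j = 0 := by
    rw [← hg]
    simp only [w, Finset.sum_apply, Finset.sum_mul]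
    rw [Finset.sum_comm]
    refine Finset.sum_congr rfl fun i _ => ?_
    rw [Fintype.sum_eq_single (T i).2 fun j hj => by rw [Pi.single_eq_of_ne hj, zero_mul],
      Pi.single_eq_same, ← smul_mul_assoc, smul_monomial, smul_eq_mul, mul_one]
  have hw0 : w = 0 := by
    by_contra hne
    obtain ⟨x, hx⟩ := exists_isModLM hne
    obtain ⟨i, rfl⟩ : ∃ i, T i = x := by
      by_contra! h
      exact hx.1 ((hcoeff x).trans (Finset.sum_eq_zero fun i _ => if_neg (h i)))
    exact hsyz i ⟨w, hw, hx⟩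
  intro i
  have hi := hcoeff (T i)
  rw [Fintype.sum_eq_single i fun j hj => if_neg fun h => hj (hT h), if_pos rfl, hw0] at hi
  exact hi.symm

theorem eq_of_add_single_eq {t t' : Fin 4 →₀ ℕ} {k k' : Fin 4} (ht : ∀ l ∈ t.support, l ≤ k)
    (ht' : ∀ l ∈ t'.support, l ≤ k') (h : t + Finsupp.single k 1 = t' + Finsupp.single k' 1) :
    t = t' ∧ k = k' := by
  have le_of_eq {t t' : Fin 4 →₀ ℕ} {k k' : Fin 4} (ht' : ∀ l ∈ t'.support, l ≤ k')
      (h : t + Finsupp.single k 1 = t' + Finsupp.single k' 1) : k ≤ k' := by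
    by_contra! hlt
    have hk := DFunLike.congr_fun h k
    simp only [Finsupp.add_apply, Finsupp.single_eq_same, Finsupp.single_eq_of_ne hlt.ne'] at hk
    exact hlt.not_ge (ht' k (Finsupp.mem_support_iff.2 (by lia)))
  obtain rfl := le_antisymm (le_of_eq ht' h) (le_of_eq ht h.symm)
  exact ⟨add_right_cancel h, rfl⟩

theorem eq_of_isSignature {E : Matrix (Fin q) (MonDeg d) 𝕜} (hE : E.IsReducedRowEchelon)
    {i j : Fin q} {t : (Fin 4 →₀ ℕ) × Fin s} (hi : IsSignature F (rowPoly (E i)) t)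
    (hj : IsSignature F (rowPoly (E j)) t) : i = j := by
  obtain ⟨p, hpi, hpj⟩ := hi.exists_isLM hj
  obtain ⟨c, rfl⟩ : ∃ c : MonDeg d, c.1 = p := ⟨MonDeg.mk p
    (degree_of_isHomogeneous (isHomogeneous_rowPoly _) (mem_support_iff.1 hpi.1)), rfl⟩
  rw [isLM_rowPoly_iff] at hpi hpj
  by_contra hne
  exact hpi.2 (hE.eq_zero_of_ne_of_isLeadingEntry hne hpj)

theorem IsSignature.degree_eq (hF : ∀ i, (F i).IsHomogeneous δ)
    {f : MvPolynomial (Fin 4) 𝕜} (hf : f.IsHomogeneous d) {t : (Fin 4 →₀ ℕ) × Fin s}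
    (ht : IsSignature F f t) : t.1.degree + δ = d := by
  obtain ⟨p, hp, hatt, -⟩ := ht
  rw [hatt.degree_eq hF, degree_of_isHomogeneous hf (mem_support_iff.1 hp.1)]

theorem card_rows_le_hilbertFun (hF : ∀ i, (F i).IsHomogeneous δ)
    {A : Matrix (Fin r) (MonDeg (d + 1)) 𝕜} (hA : IsBuiltMatrix F δ d A) :
    r ≤ hilbertFun (Ideal.span (Set.range F)) (d + 1) := by
  obtain ⟨q, E, hE, e, -⟩ := hA
  choose _ t hsig hvar hsyz using fun i => (e i).2
  let T (i : Fin r) : (Fin 4 →₀ ℕ) × Fin s := ((t i).1 + Finsupp.single (e i).1.2 1, (t i).2)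
  have hT : T.Injective := by
    intro i j hij
    obtain ⟨hmon, hpos⟩ := Prod.ext_iff.1 hij
    obtain ⟨ht, hk⟩ := eq_of_add_single_eq (hvar i) (hvar j) hmon
    have hsigj : IsSignature F (rowPoly (E (e j).1.1)) (t i) := Prod.ext ht hpos ▸ hsig j
    exact e.injective (Subtype.ext (Prod.ext (eq_of_isSignature hE.1 (hsig i) hsigj) hk))
  have hdeg (i) : (monomial (T i).1 (1 : 𝕜) * F (T i).2).IsHomogeneous (d + 1) := by
    have hti := (hsig i).degree_eq hF (isHomogeneous_rowPoly _)
    have hTi : (T i).1.degree + δ = d + 1 := by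
      simp only [T, map_add, Finsupp.degree_single]
      lia
    exact hTi ▸ (isHomogeneous_monomial 1 rfl).mul (hF _)
  have hmem (i) : monomial (T i).1 (1 : 𝕜) * F (T i).2 ∈ Ideal.span (Set.range F) :=
    Ideal.mul_mem_left _ _ (Ideal.subset_span (Set.mem_range_self _))
  simpa using card_le_hilbertFun (linearIndependent_of_notMem_syzLM hT hsyz) hmem hdeg

end RowCount

/-! ### Reverse lexicographic ideals with the generic Hilbert function -/

section GenericHilbertFunction

theorem cast_choose_three (K : Type*) [Field K] [CharZero K] (a : ℕ) :
    (a.choose 3 : K) = a * (a - 1) * (a - 2) / 6 := by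
  rw [Nat.cast_choose_eq_descPochhammer_div]
  simp [descPochhammer_succ_right, Nat.factorial, mul_assoc]

theorem card_lastExp_lt (d l : ℕ) :
    Fintype.card {m : MonDeg d // lastExp m < l} + (d + 3 - l).choose 3 = (d + 3).choose 3 := by
  have h := Fintype.card_subtype_compl fun m : MonDeg d => l ≤ lastExp m
  have hle := Fintype.card_subtype_le fun m : MonDeg d => l ≤ lastExp m
  simp only [not_le] at h
  rw [h, ← card_le_lastExp, ← card_monDeg, Nat.sub_add_cancel hle]

theorem eq_of_isLowerSet_of_card_eq {α : Type*} [LinearOrder α] [Finite α] {s t : Set α}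
    (hs : IsLowerSet s) (ht : IsLowerSet t) (h : Nat.card s = Nat.card t) : s = t :=
  (hs.total ht).elim (fun hst => Set.eq_of_subset_of_ncard_le hst h.ge)
    fun hts => (Set.eq_of_subset_of_ncard_le hts h.le).symm

variable {𝕜 : Type*} [Field 𝕜] {n D : ℕ} {I : Ideal (MvPolynomial (Fin 4) 𝕜)}

theorem HasGenericHilbertFun.hilbertFun_add_choose (h : HasGenericHilbertFun n I) (h₁ : n ≤ D + 1)
    (h₂ : D + 3 ≤ 2 * n) : hilbertFun I D + (2 * n - 1 - D).choose 3 = (D + 3).choose 3 := by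
  have hD := congrArg (Int.cast : ℤ → ℚ) (h D (by lia) (by lia))
  obtain ⟨y, hy⟩ : ∃ y, D + 1 = n + y := Nat.exists_eq_add_of_le h₁
  have hyD : (y : ℚ) = D + 1 - n := by
    rw [eq_sub_iff_add_eq']
    exact_mod_cast hy.symm
  rw [show D + 4 - n = y + 3 by lia, show D + 3 - n = y + 2 by lia,
    show D + 2 - n = y + 1 by lia] at hD
  push_cast at hD
  rw [← Nat.cast_inj (R := ℚ)]
  push_cast
  rw [hD, cast_choose_three, cast_choose_three, cast_choose_three, cast_choose_three,
    cast_choose_three, Nat.cast_sub (by lia), Nat.cast_sub (by lia)]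
  push_cast
  rw [hyD]
  ring

theorem IsReverseLex.isLowerSet (h : IsReverseLex I) :
    IsLowerSet {c : MonDeg D | c.1 ∈ leadingMonomials I} := by
  intro x y hyx hx
  rcases hyx.eq_or_lt with rfl | hlt
  · exact hx
  · exact h.2 _ hx _ (y.degree_eq.trans x.degree_eq.symm) hlt

variable {s : ℕ} {F : Fin s → MvPolynomial (Fin 4) 𝕜}

theorem mem_leadingMonomials_iff_lastExp_lt (hF : ∀ i, (F i).IsHomogeneous (n - 1))
    (hrev : IsReverseLex (Ideal.span (Set.range F)))
    (hgen : HasGenericHilbertFun n (Ideal.span (Set.range F)))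
    (h₁ : n ≤ D + 1) (h₂ : D + 3 ≤ 2 * n) (c : MonDeg D) :
    c.1 ∈ leadingMonomials (Ideal.span (Set.range F)) ↔ lastExp c < 2 * (D + 2 - n) := by
  have hlow : IsLowerSet {c : MonDeg D | lastExp c < 2 * (D + 2 - n)} :=
    fun _ _ hyx hx => (lastExp_monotone D hyx).trans_lt hx
  have hcard : Nat.card {c : MonDeg D // c.1 ∈ leadingMonomials (Ideal.span (Set.range F))} =
      Nat.card {c : MonDeg D // lastExp c < 2 * (D + 2 - n)} := by
    have hlt := card_lastExp_lt D (2 * (D + 2 - n))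
    rw [show D + 3 - 2 * (D + 2 - n) = 2 * n - 1 - D by lia,
      ← hgen.hilbertFun_add_choose h₁ h₂] at hlt
    rw [← hilbertFun_eq_card_leadingMonomials hF (by lia), Nat.card_eq_fintype_card]
    exact (Nat.add_right_cancel hlt).symm
  exact Set.ext_iff.1 (eq_of_isLowerSet_of_card_eq hrev.isLowerSet hlow hcard) c

end GenericHilbertFunction

section Minors

variable {𝕜 : Type*} [Field 𝕜] {n : ℕ} {M : Matrix (Fin n) (Fin n) (MvPolynomial (Fin 4) 𝕜)}

theorem isHomogeneous_minor (hM : ∀ i j, (M i j).IsHomogeneous 1)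
    (p : (Fin (n - 1) ↪o Fin n) × (Fin (n - 1) ↪o Fin n)) :
    (minor M p).IsHomogeneous (n - 1) := by
  rw [minor, Matrix.det_apply]
  refine IsHomogeneous.sum _ _ _ fun σ _ => ?_
  have hprod : (∏ i, M.submatrix p.1 p.2 (σ i) i).IsHomogeneous (n - 1) := by
    simpa using IsHomogeneous.prod Finset.univ _ (fun _ => 1) fun i _ => hM (p.1 (σ i)) (p.2 i)
  exact zsmul_mem (S := Submodule 𝕜 (MvPolynomial (Fin 4) 𝕜))
    (K := homogeneousSubmodule (Fin 4) 𝕜 (n - 1)) hprod _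

theorem detIdeal_eq_span {ι : Type*} (M : Matrix (Fin n) (Fin n) (MvPolynomial (Fin 4) 𝕜))
    (ord : ι ≃ (Fin (n - 1) ↪o Fin n) × (Fin (n - 1) ↪o Fin n)) :
    detIdeal M = Ideal.span (Set.range fun i => minor M (ord i)) :=
  congrArg Ideal.span (ord.surjective.range_comp (minor M)).symm

end Minors

/-! ### Operation counts -/

section Cost

variable {ω c : ℝ} {e k β γ r u v μ ν : ℕ}

theorem floor_mul_rpow_add_sq_le (hω : 2 ≤ ω) (he : 1 ≤ e) (hek : e ≤ k) :
    (⌊c * (e : ℝ) ^ ω⌋₊ + e ^ 2 : ℝ) ≤ e ^ 2 * ((|c| + 1) * (k : ℝ) ^ (ω - 2)) := by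
  have he0 : (0 : ℝ) < e := by exact_mod_cast he
  have hexp : 0 ≤ ω - 2 := by linarith
  have hone : 1 ≤ (e : ℝ) ^ (ω - 2) := Real.one_le_rpow (by exact_mod_cast he) hexp
  have hmono : (e : ℝ) ^ (ω - 2) ≤ (k : ℝ) ^ (ω - 2) := by gcongr
  have hsplit : (e : ℝ) ^ ω = e ^ 2 * (e : ℝ) ^ (ω - 2) := by
    rw [← Real.rpow_two, ← Real.rpow_add he0, add_sub_cancel]
  have hfloor : (⌊c * (e : ℝ) ^ ω⌋₊ : ℝ) ≤ |c| * (e : ℝ) ^ ω :=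
    (Nat.cast_le.2 (Nat.floor_le_floor (by gcongr; exact le_abs_self c))).trans
      (Nat.floor_le (by positivity))
  calc (⌊c * (e : ℝ) ^ ω⌋₊ + e ^ 2 : ℝ)
      ≤ |c| * (e ^ 2 * (e : ℝ) ^ (ω - 2)) + e ^ 2 * (e : ℝ) ^ (ω - 2) := by
        gcongr
        · rwa [← hsplit]
        · exact le_mul_of_one_le_right (by positivity) hone
    _ = e ^ 2 * ((|c| + 1) * (e : ℝ) ^ (ω - 2)) := by ring
    _ ≤ e ^ 2 * ((|c| + 1) * (k : ℝ) ^ (ω - 2)) := by gcongr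

variable {y : ℝ}

theorem blockProductCost_le (hkβ : k ≤ β) (hu : u * k ≤ 2 * β) (hv : v * k ≤ 2 * γ)
    (hy : 0 ≤ y) (hμ : (μ + k ^ 2 : ℝ) ≤ k ^ 2 * y) :
    ((5 * u * v + v) * (μ + k ^ 2) : ℝ) ≤ 22 * (β * γ) * y := by
  have hblocks : 5 * (u * k * (v * k)) + k * (v * k) ≤ 22 * (β * γ) := by
    calc 5 * (u * k * (v * k)) + k * (v * k)
        ≤ 5 * (2 * β * (2 * γ)) + β * (2 * γ) := by gcongr
      _ = 22 * (β * γ) := by ring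
  calc ((5 * u * v + v) * (μ + k ^ 2) : ℝ) ≤ (5 * u * v + v) * (k ^ 2 * y) := by gcongr
    _ = ((5 * (u * k * (v * k)) + k * (v * k) : ℕ) : ℝ) * y := by push_cast; ring
    _ ≤ ((22 * (β * γ) : ℕ) : ℝ) * y := by gcongr
    _ = 22 * (β * γ) * y := by push_cast; ring

theorem blockAdditionCost_le (hkβ : k ≤ β) (hu : u * k ≤ 2 * β) (hv : v * k ≤ 2 * γ) :
    2 * ((u * k) * (v * k)) + k * (v * k) ≤ 10 * (β * γ) := by
  calc 2 * ((u * k) * (v * k)) + k * (v * k)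
      ≤ 2 * (2 * β * (2 * γ)) + β * (2 * γ) := by gcongr
    _ = 10 * (β * γ) := by ring

theorem eliminationCost_le (he : 1 ≤ e) (he5 : e ^ 5 ≤ 12 * (β * γ)) (hy : 1 ≤ y)
    (hν : (ν + e ^ 2 : ℝ) ≤ e ^ 2 * y) :
    (e * (e * (e * e * (4 * e + 4)) + 2 * (e ^ 2 * (ν + e ^ 2) + (e * e) ^ 2)) : ℝ) ≤
      144 * (β * γ) * y := by
  have he4 : (e : ℝ) ^ 4 ≤ e ^ 5 := pow_le_pow_right₀ (by exact_mod_cast he) (by norm_num)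
  have he5y : (e : ℝ) ^ 5 ≤ e ^ 5 * y := le_mul_of_one_le_right (by positivity) hy
  have he5' : (e : ℝ) ^ 5 ≤ 12 * (β * γ) := by exact_mod_cast he5
  calc (e * (e * (e * e * (4 * e + 4)) + 2 * (e ^ 2 * (ν + e ^ 2) + (e * e) ^ 2)) : ℝ)
      = 4 * e ^ 4 + 6 * e ^ 5 + 2 * e ^ 3 * (ν + e ^ 2) := by ring
    _ ≤ 4 * e ^ 4 + 6 * e ^ 5 + 2 * e ^ 3 * (e ^ 2 * y) := by gcongr
    _ ≤ 12 * (e ^ 5 * y) := by linarith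
    _ ≤ 12 * (12 * (β * γ) * y) := by gcongr
    _ = 144 * (β * γ) * y := by ring

theorem reductionCost_le (he : 1 ≤ e) (hkβ : k ≤ β) (hr : r ≤ β + k) (hu : u * k ≤ 2 * β)
    (hv : v * k ≤ 2 * γ) (he5 : e ^ 5 ≤ 12 * (β * γ)) (hy : 1 ≤ y)
    (hμ : (μ + k ^ 2 : ℝ) ≤ k ^ 2 * y) (hν : (ν + e ^ 2 : ℝ) ≤ e ^ 2 * y) :
    (reductionCost r (β + γ) k u v e e μ ν : ℝ) ≤ 178 * ((β ^ 2 + β * γ) * y) := by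
  have hrows : (r * (β + γ) : ℝ) ≤ 2 * (β ^ 2 + β * γ) := by
    have hr' : r ≤ 2 * β := by lia
    calc (r * (β + γ) : ℝ) ≤ ((2 * β : ℕ) : ℝ) * (β + γ) := by gcongr
      _ = 2 * (β ^ 2 + β * γ) := by push_cast; ring
  have hadd : (2 * ((u * k) * (v * k)) + k * (v * k) : ℝ) ≤ 10 * (β * γ) := by
    exact_mod_cast blockAdditionCost_le hkβ hu hv
  have hprod := blockProductCost_le hkβ hu hv (zero_le_one.trans hy) hμ
  have helim := eliminationCost_le he he5 hy hν
  have hβ : (β ^ 2 : ℝ) ≤ β ^ 2 * y := le_mul_of_one_le_right (by positivity) hy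
  have hβγ : (β * γ : ℝ) ≤ β * γ * y := le_mul_of_one_le_right (by positivity) hy
  have hβ0 : (0 : ℝ) ≤ β ^ 2 * y := by positivity
  rw [reductionCost]
  push_cast
  linarith

end Cost

section BlockSizes

variable {e k x : ℕ}

theorem pow_le_factorial_mul_choose (e k : ℕ) : e ^ k ≤ k.factorial * (e + k - 1).choose k :=
  Nat.ascFactorial_eq_factorial_mul_choose' e k ▸ Nat.pow_succ_le_ascFactorial e k

theorem pow_five_le {β : ℕ} (h : (e + 1).choose 2 ≤ β) :
    e ^ 5 ≤ 12 * (β * (e + 2).choose 3) := by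
  calc e ^ 5 = e ^ 2 * e ^ 3 := by ring
    _ ≤ (2 * (e + 1).choose 2) * (6 * (e + 2).choose 3) :=
      Nat.mul_le_mul (pow_le_factorial_mul_choose e 2) (pow_le_factorial_mul_choose e 3)
    _ ≤ (2 * β) * (6 * (e + 2).choose 3) := by gcongr
    _ = 12 * (β * (e + 2).choose 3) := by ring

theorem le_choose_two_succ (e : ℕ) : e ≤ (e + 1).choose 2 := by
  rw [Nat.choose_succ_succ', Nat.choose_one_right]
  exact Nat.le_add_right _ _

theorem choose_two_succ_le_mul_self (e : ℕ) : (e + 1).choose 2 ≤ e * e := by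
  rw [Nat.choose_two_right]
  exact Nat.div_le_of_le_mul (by rw [Nat.add_sub_cancel]; linarith [Nat.le_mul_self e])

theorem choose_two_add_two_le (he : 1 ≤ e) : (e + 2).choose 2 ≤ 3 * (e + 1).choose 2 := by
  have := le_choose_two_succ e
  rw [Nat.choose_succ_succ' (e + 1), Nat.choose_one_right]
  lia

theorem le_div_add_one_mul (hk : 0 < k) (x : ℕ) : x ≤ (x / k + 1) * k := by
  rw [add_one_mul]
  exact (Nat.lt_div_mul_add hk).le

theorem div_add_one_mul_le (hk : k ≤ x) : (x / k + 1) * k ≤ 2 * x := by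
  rw [add_one_mul, two_mul]
  exact Nat.add_le_add (Nat.div_mul_le_self x k) hk

end BlockSizes

/-! ### The computation tree -/

section FullRank

variable {𝕜 C : Type*} [Field 𝕜] {lev : C → ℕ} {a r : ℕ}
  {A : Matrix (Fin r) C 𝕜}

theorem IsNearEchelon.span_eq_top [Finite C] (hA : IsNearEchelon lev a A)
    (hlev : ∀ c, lev c ≤ a) : Submodule.span 𝕜 (Set.range A) = ⊤ := by
  classical
  have := Fintype.ofFinite C
  choose p hp using fun c : Low lev a => hA.cover c c.2
  rw [eq_top_iff, ← (Pi.basisFun 𝕜 C).span_eq, Submodule.span_le]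
  rintro _ ⟨c, rfl⟩
  have hc : pivotRow p A ⟨c, hlev c⟩ = Pi.basisFun 𝕜 C c := by
    funext x
    rw [pivotRow_low _ (hlev x), Pi.basisFun_apply]
  exact hc ▸ pivotRow_mem_span hp _

theorem card_le_of_span_eq_top [Fintype C] (hA : Submodule.span 𝕜 (Set.range A) = ⊤) :
    Fintype.card C ≤ r := by
  have h := finrank_range_le_card (R := 𝕜) A
  rwa [Set.finrank, hA, finrank_top, Module.finrank_fintype_fun_eq_card, Fintype.card_fin] at h

theorem exists_isReducedRowEchelon_span_eq_top [Fintype C] [LinearOrder C]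
    (hr : Fintype.card C ≤ r) :
    ∃ E : Matrix (Fin r) C 𝕜, E.IsReducedRowEchelon ∧ Submodule.span 𝕜 (Set.range E) = ⊤ := by
  obtain ⟨σ, hσ, hσ'⟩ := exists_row_order (Function.injective_id (α := C)) hr
  have hpiv : HasPivots (Pi.basisFun 𝕜 C) (id : C → C) :=
    ⟨fun j => by simp, fun j j' h => by simp [h.symm],
      fun j c h => by simpa using Pi.single_eq_of_ne h.ne _⟩
  exact ⟨listRows σ (Pi.basisFun 𝕜 C), hpiv.isReducedRowEchelon hσ',
    (span_range_listRows hσ _).trans (Pi.basisFun 𝕜 C).span_eq⟩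

theorem exists_tree_of_full (𝕜 : Type*) [Field 𝕜] [Finite C] [LinearOrder C] (r : ℕ)
    (hlev : ∀ c, lev c ≤ a) :
    ∃ t : CompTree 𝕜 (Fin r × C) (Fin r × C), ∀ A : Matrix (Fin r) C 𝕜, IsNearEchelon lev a A →
      ∃ E : Matrix (Fin r) C 𝕜, t.Computes (fun p => A p.1 p.2) (fun p => E p.1 p.2) 0 ∧
        E.IsReducedRowEchelon ∧
          Submodule.span 𝕜 (Set.range E) = Submodule.span 𝕜 (Set.range A) := by
  have := Fintype.ofFinite C
  by_cases hr : Fintype.card C ≤ r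
  · obtain ⟨E, hE, hspan⟩ := exists_isReducedRowEchelon_span_eq_top (𝕜 := 𝕜) hr
    exact ⟨.output fun p => .const (E p.1 p.2), fun A hA =>
      ⟨E, rfl, hE, hspan.trans (hA.span_eq_top hlev).symm⟩⟩
  · exact ⟨.output fun _ => .const 0, fun A hA =>
      absurd (card_le_of_span_eq_top (hA.span_eq_top hlev)) hr⟩

end FullRank

section Reduction

variable {𝕜 : Type*} [Field 𝕜] {ω c : ℝ}

theorem exists_tree_of_reaches_echelonState {C : Type*} [LinearOrder C] {r N : ℕ}
    {P : Set (Matrix (Fin r) C 𝕜)}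
    (h : Reaches EchelonState P (Set.range fun (p : Fin r × C) A => A p.1 p.2) N) :
    ∃ t : CompTree 𝕜 (Fin r × C) (Fin r × C), ∀ A ∈ P, ∃ (E : Matrix (Fin r) C 𝕜) (cost : ℕ),
      t.Computes (fun p => A p.1 p.2) (fun p => E p.1 p.2) cost ∧
        (E.IsReducedRowEchelon ∧
          Submodule.span 𝕜 (Set.range E) = Submodule.span 𝕜 (Set.range A)) ∧ cost ≤ N := by
  obtain ⟨t, ht⟩ := Reaches.exists_tree (fun (A : Matrix (Fin r) C 𝕜) (p : Fin r × C) => A p.1 p.2)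
    (fun A y => (Matrix.of fun i c => y (i, c)).IsReducedRowEchelon ∧
      Submodule.span 𝕜 (Set.range (Matrix.of fun i c => y (i, c))) =
        Submodule.span 𝕜 (Set.range A))
    (h.imp fun P' K' _ _ ⟨E, hE, hspec⟩ => ⟨fun p A => E A p.1 p.2, fun p => hE p.1 p.2, hspec⟩)
  refine ⟨t, fun A hA => ?_⟩
  obtain ⟨y, cost, hrun, hy, hcost⟩ := ht A hA
  exact ⟨Matrix.of fun i c => y (i, c), cost, hrun, hy, hcost⟩

theorem exists_tree_of_card {C : Type*} [Fintype C] [LinearOrder C] {lev : C → ℕ}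
    (hlev : Monotone lev) (hω : 2 ≤ ω) (hmul : IsMatMulExponent 𝕜 ω c)
    {a e r k β γ : ℕ} (hlow : Fintype.card (Low lev a) = β)
    (hhigh : Fintype.card (High lev a) = γ) (hnext : Fintype.card (AtLevel lev (a + 1)) = k)
    (hmid : Fintype.card (AtLevel lev a) ≤ 3 * k) (he : 1 ≤ e) (hek : e ≤ k) (hke : k ≤ e * e)
    (hkβ : k ≤ β) (hkγ : k ≤ γ) (he5 : e ^ 5 ≤ 12 * (β * γ)) (hr : r ≤ β + k) :
    ∃ t : CompTree 𝕜 (Fin r × C) (Fin r × C), ∀ A : Matrix (Fin r) C 𝕜, IsNearEchelon lev a A →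
      ∃ (E : Matrix (Fin r) C 𝕜) (cost : ℕ),
        t.Computes (fun p => A p.1 p.2) (fun p => E p.1 p.2) cost ∧
        (E.IsReducedRowEchelon ∧
          Submodule.span 𝕜 (Set.range E) = Submodule.span 𝕜 (Set.range A)) ∧
        (cost : ℝ) ≤ 178 * (((β : ℝ) ^ 2 + β * γ) * ((|c| + 1) * (k : ℝ) ^ (ω - 2))) := by
  have hk : 0 < k := he.trans hek
  have hinput : KnownMat {A : Matrix (Fin r) C 𝕜 | IsNearEchelon lev a A}
      (Set.range fun (p : Fin r × C) A => A p.1 p.2) fun A => A :=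
    fun i c => .of_mem ⟨(i, c), rfl⟩
  have hreach := reaches_echelonState hlev (hmul.hasMulTree k) (hmul.hasMulTree e) hnext hk
    (hlow ▸ hr) (hlow ▸ le_div_add_one_mul hk β) hmid (hhigh ▸ le_div_add_one_mul hk γ) hke
    (fun _ hA => hA) hinput
  obtain ⟨t, ht⟩ := exists_tree_of_reaches_echelonState hreach
  have hscale : 1 ≤ (|c| + 1) * (k : ℝ) ^ (ω - 2) :=
    one_le_mul_of_one_le_of_one_le (le_add_of_nonneg_left (abs_nonneg c))
      (Real.one_le_rpow (by exact_mod_cast hk) (by linarith))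
  refine ⟨t, fun A hA => ?_⟩
  obtain ⟨E, cost, hrun, hE, hcost⟩ := ht A hA
  refine ⟨E, cost, hrun, hE, (Nat.cast_le.2 hcost).trans ?_⟩
  rw [← card_low_add_card_high lev a, hlow, hhigh]
  exact reductionCost_le he hkβ hr (div_add_one_mul_le hkβ) (div_add_one_mul_le hkγ) he5 hscale
    (floor_mul_rpow_add_sq_le hω hk le_rfl) (floor_mul_rpow_add_sq_le hω he hek)

theorem exists_tree_of_isNearEchelon (hω : 2 ≤ ω) (hmul : IsMatMulExponent 𝕜 ω c) {d a e : ℕ}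
    (hd : d + 1 = a + e) (r : ℕ) :
    ∃ t : CompTree 𝕜 (Fin r × MonDeg (d + 1)) (Fin r × MonDeg (d + 1)),
      ∀ A : Matrix (Fin r) (MonDeg (d + 1)) 𝕜, IsNearEchelon lastExp a A →
        r ≤ Fintype.card (Low (lastExp : MonDeg (d + 1) → ℕ) a) + (e + 1).choose 2 →
        ∃ (E : Matrix (Fin r) (MonDeg (d + 1)) 𝕜) (cost : ℕ),
          t.Computes (fun p => A p.1 p.2) (fun p => E p.1 p.2) cost ∧ IsRREFOf A E ∧
          (cost : ℝ) ≤ 178 * (|c| + 1) *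
            ((Fintype.card (Low (lastExp : MonDeg (d + 1) → ℕ) a) : ℝ) ^ 2 *
                ((e + 1).choose 2 : ℕ) ^ (ω - 2) +
              (((e + 1).choose 2 : ℕ) : ℝ) ^ (ω - 2) *
                Fintype.card (Low (lastExp : MonDeg (d + 1) → ℕ) a) * ((e + 2).choose 3 : ℕ)) := by
  obtain rfl | he := e.eq_zero_or_pos
  · obtain ⟨t, ht⟩ := exists_tree_of_full 𝕜 r fun m : MonDeg (d + 1) => (lastExp_le m).trans hd.le
    refine ⟨t, fun A hA _ => ?_⟩
    obtain ⟨E, hrun, hE⟩ := ht A hA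
    refine ⟨E, 0, hrun, hE, ?_⟩
    have hbound (β k γ : ℕ) : 0 ≤ 178 * (|c| + 1) *
        ((β : ℝ) ^ 2 * k ^ (ω - 2) + (k : ℝ) ^ (ω - 2) * β * γ) := by positivity
    exact Nat.cast_zero.trans_le (hbound _ _ _)
  by_cases hr : r ≤ Fintype.card (Low (lastExp : MonDeg (d + 1) → ℕ) a) + (e + 1).choose 2
  swap
  · exact ⟨.output fun _ => .const 0, fun A _ h => absurd h hr⟩
  have hmid := card_atLevel (d + 1) a (by lia)
  have hnext := card_atLevel (d + 1) (a + 1) (by lia)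
  have hhigh := card_high (d + 1) a
  rw [show d + 1 + 2 - a = e + 2 by lia] at hmid hhigh
  rw [show d + 1 + 2 - (a + 1) = e + 1 by lia] at hnext
  have hkβ : (e + 1).choose 2 ≤ Fintype.card (Low (lastExp : MonDeg (d + 1) → ℕ) a) :=
    (Nat.choose_le_choose 2 (by lia)).trans
      (hmid.ge.trans (Fintype.card_subtype_mono _ _ fun _ => le_of_eq))
  have hkγ : (e + 1).choose 2 ≤ (e + 2).choose 3 :=
    (Nat.le_add_right _ _).trans (Nat.choose_succ_succ (e + 1) 2).ge
  obtain ⟨t, ht⟩ := exists_tree_of_card (lastExp_monotone (d + 1)) hω hmul rfl hhigh hnext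
    (hmid.trans_le (choose_two_add_two_le he)) he (le_choose_two_succ e)
    (choose_two_succ_le_mul_self e) hkβ hkγ (pow_five_le hkβ) hr
  refine ⟨t, fun A hA _ => ?_⟩
  obtain ⟨E, cost, hrun, hE, hcost⟩ := ht A hA
  exact ⟨E, cost, hrun, hE, hcost.trans_eq (by ring)⟩

end Reduction

section BlockSizes

variable {𝕜 : Type*} [Field 𝕜] {s n d e r : ℕ} {F : Fin s → MvPolynomial (Fin 4) 𝕜}
  {A : Matrix (Fin r) (MonDeg (d + 1)) 𝕜}

theorem alphaSucc_eq_choose (he : d + e + 3 = 2 * n) :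
    alphaSucc n d = ((e + 1).choose 2 : ℕ) := by
  have hd : (d : ℝ) = 2 * n - 3 - e := by
    rw [sub_sub, eq_sub_iff_add_eq, ← add_assoc, add_right_comm]
    exact_mod_cast he
  rw [alphaSucc, Nat.cast_choose_two, hd]
  push_cast
  ring

theorem IsBuiltMatrix.isNearEchelon (hF : ∀ i, (F i).IsHomogeneous (n - 1))
    (hrev : IsReverseLex (Ideal.span (Set.range F)))
    (hgen : HasGenericHilbertFun n (Ideal.span (Set.range F))) (h₁ : n ≤ d + 1)
    (h₂ : d + 3 ≤ 2 * n) (hA : IsBuiltMatrix F (n - 1) d A) :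
    IsNearEchelon lastExp (2 * (d + 2 - n)) A := by
  refine isNearEchelon_of_leadingMonomials hF (by lia) (by lia)
    (mem_leadingMonomials_iff_lastExp_lt hF hrev hgen h₁ h₂) (fun m hm => ?_) hA
  obtain hd | hd := le_or_gt (d + 4) (2 * n)
  · have := (mem_leadingMonomials_iff_lastExp_lt hF hrev hgen (by lia) hd m).1 hm
    lia
  · have := lastExp_le m
    lia

theorem hilbertFun_succ_eq (hF : ∀ i, (F i).IsHomogeneous (n - 1))
    (hrev : IsReverseLex (Ideal.span (Set.range F)))
    (hgen : HasGenericHilbertFun n (Ideal.span (Set.range F))) (h₁ : n ≤ d + 1)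
    (he : d + e + 3 = 2 * n) (hA : IsBuiltMatrix F (n - 1) d A) :
    hilbertFun (Ideal.span (Set.range F)) (d + 1) =
      Fintype.card (Low (lastExp : MonDeg (d + 1) → ℕ) (2 * (d + 2 - n))) +
        (e + 1).choose 2 := by
  have hsum := card_low_add_card_high (lastExp : MonDeg (d + 1) → ℕ) (2 * (d + 2 - n))
  rw [card_high, card_monDeg, show d + 1 + 2 - 2 * (d + 2 - n) = e + 2 by lia] at hsum
  obtain rfl | hpos := e.eq_zero_or_pos
  · have htop := (hA.isNearEchelon hF hrev hgen h₁ he.le).span_eq_top fun m =>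
      (lastExp_le m).trans (by lia)
    have hcard := (card_le_of_span_eq_top htop).trans (card_rows_le_hilbertFun hF hA)
    have hle := hilbertFun_le (Ideal.span (Set.range F)) (d + 1)
    rw [card_monDeg] at hcard
    exact (hle.antisymm hcard).trans hsum.symm
  · have hgen' := hgen.hilbertFun_add_choose (D := d + 1) (by lia) (by lia)
    have hpascal : (e + 2).choose 3 = _ := Nat.choose_succ_succ (e + 1) 2
    rw [show 2 * n - 1 - (d + 1) = e + 1 by lia] at hgen'
    lia

theorem betaSucc_eq_card (hF : ∀ i, (F i).IsHomogeneous (n - 1))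
    (hrev : IsReverseLex (Ideal.span (Set.range F)))
    (hgen : HasGenericHilbertFun n (Ideal.span (Set.range F))) (h₁ : n ≤ d + 1)
    (h₂ : d + 3 ≤ 2 * n) (hA : IsBuiltMatrix F (n - 1) d A) :
    betaSucc n d (Ideal.span (Set.range F)) =
      Fintype.card (Low (lastExp : MonDeg (d + 1) → ℕ) (2 * (d + 2 - n))) := by
  obtain ⟨e, he⟩ := Nat.exists_eq_add_of_le' h₂
  replace he : d + e + 3 = 2 * n := by lia
  rw [betaSucc, alphaSucc_eq_choose he, hilbertFun_succ_eq hF hrev hgen h₁ he hA, Nat.cast_add,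
    add_sub_cancel_right]

theorem gammaSucc_eq_choose (he : d + e + 3 = 2 * n) (h₁ : n ≤ d + 1)
    {I : Ideal (MvPolynomial (Fin 4) 𝕜)}
    (hβ : betaSucc n d I =
      Fintype.card (Low (lastExp : MonDeg (d + 1) → ℕ) (2 * (d + 2 - n)))) :
    gammaSucc n d I = ((e + 2).choose 3 : ℕ) := by
  have hsum := card_low_add_card_high (lastExp : MonDeg (d + 1) → ℕ) (2 * (d + 2 - n))
  rw [card_high, card_monDeg, show d + 1 + 2 - 2 * (d + 2 - n) = e + 2 by lia] at hsum
  rw [gammaSucc, hβ, sub_eq_iff_eq_add', ← Nat.cast_add, hsum]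

end BlockSizes

end DetGB

end

theorem mainTheorem7_general (ω c : ℝ) (hω₂ : 2 ≤ ω) :
    ∃ C : ℝ, 0 < C ∧
      ∀ (𝕜 : Type*) [Field 𝕜], DetGB.IsMatMulExponent 𝕜 ω c →
      ∀ n d : ℕ, n ≤ d + 1 → d + 3 ≤ 2 * n →
      ∀ r : ℕ, ∃ t : DetGB.CompTree 𝕜 (Fin r × DetGB.MonDeg (d + 1))
          (Fin r × DetGB.MonDeg (d + 1)),
        ∀ {s : ℕ} (F : Fin s → MvPolynomial (Fin 4) 𝕜),
          (∀ i, (F i).IsHomogeneous (n - 1)) →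
          DetGB.IsReverseLex (Ideal.span (Set.range F)) →
          DetGB.HasGenericHilbertFun n (Ideal.span (Set.range F)) →
        ∀ A : Matrix (Fin r) (DetGB.MonDeg (d + 1)) 𝕜,
          DetGB.IsBuiltMatrix F (n - 1) d A →
          ∃ (E : Matrix (Fin r) (DetGB.MonDeg (d + 1)) 𝕜) (cost : ℕ),
            t.Computes (fun p => A p.1 p.2) (fun p => E p.1 p.2) cost ∧
            DetGB.IsRREFOf A E ∧
            (cost : ℝ) ≤ C *
              (DetGB.betaSucc n d (Ideal.span (Set.range F)) ^ 2 *
                  DetGB.alphaSucc n d ^ (ω - 2) +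
                DetGB.alphaSucc n d ^ (ω - 2) * DetGB.betaSucc n d (Ideal.span (Set.range F)) *
                  DetGB.gammaSucc n d (Ideal.span (Set.range F))) := by
  refine ⟨178 * (|c| + 1), by positivity, fun 𝕜 _ hmul n d h₁ h₂ r => ?_⟩
  obtain ⟨e, he⟩ := Nat.exists_eq_add_of_le h₂
  replace he : d + e + 3 = 2 * n := by lia
  obtain ⟨t, ht⟩ := DetGB.exists_tree_of_isNearEchelon hω₂ hmul
    (show d + 1 = 2 * (d + 2 - n) + e by lia) r
  refine ⟨t, fun F hF hrev hgen A hA => ?_⟩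
  have hr := DetGB.card_rows_le_hilbertFun hF hA
  rw [DetGB.hilbertFun_succ_eq hF hrev hgen h₁ he hA] at hr
  have hβ := DetGB.betaSucc_eq_card hF hrev hgen h₁ h₂ hA
  rw [DetGB.gammaSucc_eq_choose he h₁ hβ, hβ, DetGB.alphaSucc_eq_choose he]
  exact ht A (hA.isNearEchelon hF hrev hgen h₁ h₂) hr

theorem mainTheorem7 (ω c : ℝ) (hω₂ : 2 ≤ ω) (hω₃ : ω ≤ 3) :
    ∃ C : ℝ, 0 < C ∧
      ∀ (𝕜 : Type*) [Field 𝕜], DetGB.IsMatMulExponent 𝕜 ω c →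
      ∀ n d : ℕ, 3 ≤ n → n - 1 ≤ d → d ≤ 2 * n - 3 →
      ∀ r : ℕ, ∃ t : DetGB.CompTree 𝕜 (Fin r × DetGB.MonDeg (d + 1))
          (Fin r × DetGB.MonDeg (d + 1)),
        ∀ M : Matrix (Fin n) (Fin n) (MvPolynomial (Fin 4) 𝕜),
          (∀ i j, (M i j).IsHomogeneous 1) →
          DetGB.IsReverseLex (DetGB.detIdeal M) →
          DetGB.HasGenericHilbertFun n (DetGB.detIdeal M) →
        ∀ (ord : Fin (n ^ 2) ≃ (Fin (n - 1) ↪o Fin n) × (Fin (n - 1) ↪o Fin n))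
          (A : Matrix (Fin r) (DetGB.MonDeg (d + 1)) 𝕜),
          DetGB.IsBuiltMatrix (fun i => DetGB.minor M (ord i)) (n - 1) d A →
          ∃ (E : Matrix (Fin r) (DetGB.MonDeg (d + 1)) 𝕜) (cost : ℕ),
            t.Computes (fun p => A p.1 p.2) (fun p => E p.1 p.2) cost ∧
            DetGB.IsRREFOf A E ∧
            (cost : ℝ) ≤ C *
              (DetGB.betaSucc n d (DetGB.detIdeal M) ^ 2 * DetGB.alphaSucc n d ^ (ω - 2) +
                DetGB.alphaSucc n d ^ (ω - 2) * DetGB.betaSucc n d (DetGB.detIdeal M) *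
                  DetGB.gammaSucc n d (DetGB.detIdeal M)) := by
  obtain ⟨C, hC, h⟩ := mainTheorem7_general ω c hω₂
  refine ⟨C, hC, fun 𝕜 _ hmul n d hn h₁ h₂ r => ?_⟩
  obtain ⟨t, ht⟩ := h 𝕜 hmul n d (by lia) (by lia) r
  refine ⟨t, fun M hM hrev hgen ord A hA => ?_⟩
  rw [DetGB.detIdeal_eq_span M ord] at hrev hgen ⊢
  exact ht _ (fun i => DetGB.isHomogeneous_minor hM (ord i)) hrev hgen A hA
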